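/- Let $K$ be a finite extension of $\mathbb{Q}_p$ (more generally, the fraction field of a complete discrete valuation ring with finite residue field), $R$ its valuation ring, $\pi$ a prime element of $R$, and $V$ a finite-dimensional $K$-vector space. Let $X$ be the Bruhat–Tits building of $PGL(V)$ with its canonical metric. Its vertices are the homothety classes $\{L\}$ of $R$-lattices $L$ of full rank in $V$. For a subspace $0\neq W\subsetneq V$ let $y_W$ be the vertex of the boundary $X_\infty$ of $X$ at infinity that corresponds to $W$, i.e. the boundary point whose stabilizer in $GL(V)$ is the stabilizer of $W$. Fix a lattice $M$ of full rank in $V$, let $x=\{M\}$ be the corresponding vertex of $X$, and let $m\geq 1$ be an integer. Let $[x,y_W]_m$ denote the sequence of the first $m+1$ vertices of $X$ on the half-geodesic $[x,y_W]$ in $X$ which starts in $x$ and converges to $y_W$; this is well defined for every $W$. Put $\mathbb{P}(V)=\operatorname{Proj}\operatorname{Sym}_K V^*$ and $\mathbb{P}(M)=\operatorname{Proj}\operatorname{Sym}_R M^*$, and let $\overline{\mathbb{P}(W)}$ be the closure in $\mathbb{P}(M)$ of the closed subscheme $\mathbb{P}(W)=\operatorname{Proj}\operatorname{Sym}_K W^*$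 of $\mathbb{P}(V)$. A linear cycle in $\mathbb{P}(M)\otimes_R R/\pi^m$ is a closed subscheme of the form $\mathbb{P}(N)=\operatorname{Proj}\operatorname{Sym}N^*$ for a direct summand $N$ of the $R/\pi^m$-module $M\otimes_R R/\pi^m$ with $0\neq N\neq M\otimes_R R/\pi^m$. Then $$[x,y_W]_m\longmapsto \overline{\mathbb{P}(W)}\otimes_R R/\pi^m$$ is a well-defined bijection $$\{[x,y_W]_m : 0\neq W\subsetneq V\}\longrightarrow\{\text{linear cycles in }\mathbb{P}(M)\otimes_R R/\pi^m\}.$$ Hence $[x,y_{W_1}]_m=[x,y_{W_2}]_m$ if and only if $\overline{\mathbb{P}(W_1)}\otimes_R R/\pi^m=\overline{\mathbb{P}(W_2)}\otimes_R R/\pi^m$. -/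

import Mathlib

universe u

namespace LinearCycles

open CategoryTheory AlgebraicGeometry HomogeneousIdeal
open scoped TensorProduct DirectSum Graded NNReal

/-! ### Projective spaces and linear cycles

A closed subscheme is given by its ideal sheaf. -/

section Sym
variable (A : Type u) [CommRing A] (E : Type u) [AddCommGroup E] [Module A E]

/-- The degree `d` part of `Sym_A E`: the span of the products of `d` elements of `E`. -/
def symGrading (d : ℕ) : Submodule A (SymmetricAlgebra A E) :=
  LinearMap.range (SymmetricAlgebra.ι A E) ^ d

/-- `Sym_A E`, with its usual grading, is a graded ring. -/
noncomputable instance symGrading.gradedAlgebra : GradedAlgebra (symGrading A E) := by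
  let i : E →ₗ[A] ⨁ d, symGrading A E d :=
    DirectSum.lof A ℕ (fun d => symGrading A E d) 1 ∘ₗ
      (SymmetricAlgebra.ι A E).codRestrict _ fun m => by
        simpa only [symGrading, pow_one] using LinearMap.mem_range_self _ m
  have : SetLike.GradedMonoid (symGrading A E) := Submodule.nat_power_gradedMonoid _
  have hi : ∀ m, i m = DirectSum.of (fun d => symGrading A E d) 1
    ⟨SymmetricAlgebra.ι A E m, by
      simpa only [symGrading, pow_one] using LinearMap.mem_range_self _ m⟩ := fun _ => rfl
  refine GradedAlgebra.ofAlgHom _ (SymmetricAlgebra.lift i) ?_ ?_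
  · ext m
    simp [hi]
  · rintro d ⟨x, hx⟩
    dsimp only [Subtype.coe_mk, DirectSum.lof_eq_of]
    unfold symGrading at hx
    induction hx using Submodule.pow_induction_on_left' with
    | algebraMap r => rw [AlgHom.commutes, DirectSum.algebraMap_apply]; rfl
    | add x y i hx hy ihx ihy =>
      rw [map_add, ihx, ihy, ← map_add]
      rfl
    | mem_mul m hm i x hx ih =>
      obtain ⟨_, rfl⟩ := hm
      rw [map_mul, ih, SymmetricAlgebra.lift_ι_apply, hi, DirectSum.of_mul_of]
      exact DirectSum.of_eq_of_gradedMonoid_eq (Sigma.subtype_ext (add_comm _ _) rfl)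

/-- `Proj Sym_A E`. -/
noncomputable def projSym : Scheme.{u} := Proj (symGrading A E)

/-- The structure morphism of `Proj Sym_A E`. -/
noncomputable def projSymToSpec : projSym A E ⟶ Spec (.of A) :=
  Proj.toSpecZero (symGrading A E) ≫ Spec.map (CommRingCat.ofHom (algebraMap A (symGrading A E 0)))
end Sym

section Functor
variable {A B : Type u} [CommRing A] [CommRing B] [Algebra A B]
  {E : Type u} [AddCommGroup E] [Module A E]
  {F : Type u} [AddCommGroup F] [Module A F] [Module B F] [IsScalarTower A B F]

/-- The graded ring homomorphism `Sym_A E → Sym_B F` induced by an `A`-linear map `E → F`. -/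
noncomputable def symHom (φ : E →ₗ[A] F) : symGrading A E →+*ᵍ symGrading B F where
  toRingHom := (SymmetricAlgebra.lift
    (((SymmetricAlgebra.ι B F).restrictScalars A).comp φ)).toRingHom
  map_mem {d x} hx := by
    unfold symGrading at hx
    induction hx using Submodule.pow_induction_on_left' with
    | algebraMap r =>
      simp only [AlgHom.toRingHom_eq_coe, RingHom.coe_coe, AlgHom.commutes]
      rw [IsScalarTower.algebraMap_apply A B]
      exact Submodule.algebraMap_mem _
    | add x y i hx hy ihx ihy => rw [map_add]; exact add_mem ihx ihy
    | mem_mul m hm i x hx ih =>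
      obtain ⟨e, rfl⟩ := hm
      rw [map_mul]
      unfold symGrading at ih ⊢
      rw [Nat.succ_eq_add_one, pow_succ']
      refine Submodule.mul_mem_mul ⟨φ e, ?_⟩ ih
      simp

theorem symHom_ι (φ : E →ₗ[A] F) (e : E) :
    symHom (B := B) φ (SymmetricAlgebra.ι A E e) = SymmetricAlgebra.ι B F (φ e) := by
  change SymmetricAlgebra.lift _ _ = _
  simp

theorem symHom_algebraMap (φ : E →ₗ[A] F) (a : A) :
    symHom (B := B) φ (algebraMap A _ a) = algebraMap B _ (algebraMap A B a) := by
  change SymmetricAlgebra.lift _ _ = _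
  rw [AlgHom.commutes, IsScalarTower.algebraMap_apply A B]

theorem irrelevant_le_map_symHom (φ : E →ₗ[A] F)
    (hφ : Submodule.span B (Set.range φ) = ⊤) :
    irrelevant (symGrading B F) ≤ (irrelevant (symGrading A E)).map (symHom φ) := by
  rw [← toIdeal_le_toIdeal_iff, toIdeal_irrelevant_le]
  have key : ∀ f : F, SymmetricAlgebra.ι B F f ∈
      ((irrelevant (symGrading A E)).map (symHom (B := B) φ)).toIdeal := by
    intro f
    have hf : f ∈ Submodule.span B (Set.range φ) := by rw [hφ]; trivial
    induction hf using Submodule.span_induction with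
    | mem x hx =>
      obtain ⟨e, rfl⟩ := hx
      rw [← symHom_ι]
      refine Ideal.mem_map_of_mem _ (mem_irrelevant_of_mem _ one_pos ?_)
      simp only [symGrading, pow_one]
      exact LinearMap.mem_range_self _ e
    | zero => rw [map_zero]; exact Ideal.zero_mem _
    | add x y _ _ hx hy => rw [map_add]; exact Ideal.add_mem _ hx hy
    | smul b x _ hx => rw [map_smul, Algebra.smul_def]; exact Ideal.mul_mem_left _ _ hx
  intro d hd x hx
  obtain ⟨d, rfl⟩ := Nat.exists_eq_succ_of_ne_zero hd.ne'
  change x ∈ symGrading B F _ at hx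
  rw [symGrading, Nat.succ_eq_add_one, pow_succ'] at hx
  change x ∈ ((irrelevant (symGrading A E)).map (symHom (B := B) φ)).toIdeal
  induction hx using Submodule.mul_induction_on' with
  | mem_mul_mem m hm n hn =>
    obtain ⟨f, rfl⟩ := hm
    exact Ideal.mul_mem_right _ _ (key f)
  | add x _ y _ hx hy => exact Ideal.add_mem _ hx hy

/-- The morphism `Proj Sym_B F ⟶ Proj Sym_A E` induced by an `A`-linear map `E → F` whose image
generates `F` over `B`. -/
noncomputable def projSymMap (φ : E →ₗ[A] F) (hφ : Submodule.span B (Set.range φ) = ⊤) :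
    projSym B F ⟶ projSym A E :=
  Proj.map (symHom φ) (irrelevant_le_map_symHom φ hφ)

theorem projSymMap_toSpec (φ : E →ₗ[A] F) (hφ : Submodule.span B (Set.range φ) = ⊤) :
    projSymMap φ hφ ≫ projSymToSpec A E =
      projSymToSpec B F ≫ Spec.map (CommRingCat.ofHom (algebraMap A B)) := by
  change Proj.map (symHom φ) (irrelevant_le_map_symHom φ hφ) ≫
    Proj.toSpecZero (symGrading A E) ≫ Spec.map _ =
    (Proj.toSpecZero (symGrading B F) ≫ Spec.map _) ≫ Spec.map _
  have key (i : ℕ) (hi : 0 < i) (t : SymmetricAlgebra A E) (ht : t ∈ symGrading A E i) :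
      Proj.awayι (symGrading B F) (symHom φ t) ((symHom φ).2 ht) hi ≫
        Proj.map (symHom φ) (irrelevant_le_map_symHom φ hφ) ≫ Proj.toSpecZero (symGrading A E) ≫
          Spec.map (CommRingCat.ofHom (algebraMap A (symGrading A E 0))) =
      Proj.awayι (symGrading B F) (symHom φ t) ((symHom φ).2 ht) hi ≫
        (Proj.toSpecZero (symGrading B F) ≫
          Spec.map (CommRingCat.ofHom (algebraMap B (symGrading B F 0)))) ≫
            Spec.map (CommRingCat.ofHom (algebraMap A B)) := by
    rw [Proj.awayι_comp_map_assoc _ _ hi _ ht, Proj.awayι_toSpecZero_assoc,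
      Category.assoc, Proj.awayι_toSpecZero_assoc,
      ← Spec.map_comp, ← Spec.map_comp, ← Spec.map_comp, ← Spec.map_comp]
    congr 1
    ext a
    simp only [CommRingCat.hom_comp, CommRingCat.hom_ofHom, RingHom.comp_apply]
    change Localization.mk (symHom (B := B) φ (algebraMap A _ a)) ⟨symHom (B := B) φ 1, _⟩ =
      Localization.mk (algebraMap B _ (algebraMap A B a)) ⟨1, _⟩
    congr 1
    · exact symHom_algebraMap φ a
    · exact Subtype.ext (map_one (symHom (B := B) φ))
  exact (Proj.mapAffineOpenCover _ (irrelevant_le_map_symHom φ hφ)).openCover.hom_ext _ _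
    fun s => key s.1 s.1.2 s.2 s.2.2
end Functor

section Models
variable (R : Type u) [CommRing R] (M : Type u) [AddCommGroup M] [Module R M]

/-- The projective space `ℙ(M) = Proj Sym_R (M^*)`. -/
noncomputable abbrev projSpace : Scheme.{u} := projSym R (Module.Dual R M)

/-- The base change `ℙ(M) ⊗_R R/I`. -/
noncomputable abbrev projSpaceMod (I : Ideal R) : Scheme.{u} :=
  Limits.pullback (projSymToSpec R (Module.Dual R M))
    (Spec.map (CommRingCat.ofHom (algebraMap R (R ⧸ I))))

variable {R M} {I : Ideal R}

/-- The map `M^* → N^*` which restricts the reduction of a linear form on `M` to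
a submodule `N` of `M ⊗ R/I`. -/
noncomputable def dualRestrictMod (N : Submodule (R ⧸ I) ((R ⧸ I) ⊗[R] M)) :
    Module.Dual R M →ₗ[R] Module.Dual (R ⧸ I) N :=
  ((Submodule.dualRestrict N).restrictScalars R).comp (Module.Dual.baseChange (R ⧸ I))

theorem span_range_dualRestrictMod [Module.Free R M] [Module.Finite R M]
    {N : Submodule (R ⧸ I) ((R ⧸ I) ⊗[R] M)} (hN : ∃ N', IsCompl N N') :
    Submodule.span (R ⧸ I) (Set.range (dualRestrictMod N)) = ⊤ := by
  classical
  obtain ⟨N', hN⟩ := hN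
  rw [_root_.eq_top_iff]
  rintro ψ -
  let b := Module.Free.chooseBasis R M
  let bA := b.baseChange (R ⧸ I)
  let Ψ : Module.Dual (R ⧸ I) ((R ⧸ I) ⊗[R] M) := ψ ∘ₗ N.projectionOnto N' hN
  have h1 : ψ = N.dualRestrict Ψ := by
    ext x
    change ψ x = ψ (N.projectionOnto N' hN x)
    simp
  have h2 : Ψ = ∑ i, Ψ (bA i) • Module.Dual.baseChange (R ⧸ I) (b.coord i) := by
    apply bA.ext
    intro j
    simp [bA, Module.Dual.baseChange, Finsupp.single_apply]
  rw [h1, h2, map_sum]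
  refine Submodule.sum_mem _ fun i _ => ?_
  rw [map_smul]
  exact Submodule.smul_mem _ _ (Submodule.subset_span ⟨b.coord i, rfl⟩)

/-- The linear cycle `ℙ(N) ↪ ℙ(M) ⊗_R R/I` of a split submodule `N` of `M ⊗_R R/I`, as
a closed subscheme. -/
noncomputable def linearCycleMod [Module.Free R M] [Module.Finite R M]
    (N : Submodule (R ⧸ I) ((R ⧸ I) ⊗[R] M)) (hN : ∃ N', IsCompl N N') :
    (projSpaceMod R M I).IdealSheafData :=
  (Limits.pullback.lift (projSymMap (dualRestrictMod N) (span_range_dualRestrictMod hN))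
    (projSymToSpec (R ⧸ I) (Module.Dual (R ⧸ I) N)) (projSymMap_toSpec _ _)).ker

variable (R M I) in
/-- The set of linear cycles of `ℙ(M) ⊗_R R/I`: those given by the non-trivial (i.e. non-zero and
proper) split submodules of `M ⊗_R R/I`. -/
def linearCyclesMod [Module.Free R M] [Module.Finite R M] :
    Set (projSpaceMod R M I).IdealSheafData :=
  {Z | ∃ (N : Submodule (R ⧸ I) ((R ⧸ I) ⊗[R] M)) (hN : ∃ N', IsCompl N N'),
    N ≠ ⊥ ∧ N ≠ ⊤ ∧ Z = linearCycleMod N hN}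

end Models

section Lattice
variable {R : Type u} [CommRing R] [IsDomain R] [IsPrincipalIdealRing R]
  (K : Type u) [Field K] [Algebra R K] [IsFractionRing R K]
  {V : Type u} [AddCommGroup V] [Module K V] [Module R V] [IsScalarTower R K V]
  (M : Submodule R V) [M.IsLattice K]

/-- The map `M^* → V^*` sending an `R`-linear form on the lattice `M` to its `K`-linear
extension. -/
noncomputable def extendDual : Module.Dual R M →ₗ[R] Module.Dual K V :=
  let b := Module.Free.chooseBasis R M
  { toFun := fun f => (b.extendOfIsLattice K).constr K fun i => algebraMap R K (f (b i))
    map_add' := fun f g => (b.extendOfIsLattice K).ext fun i => by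
      simp only [Module.Basis.constr_basis, LinearMap.add_apply, map_add]
    map_smul' := fun r f => (b.extendOfIsLattice K).ext fun i => by
      simp only [Module.Basis.constr_basis, LinearMap.smul_apply, RingHom.id_apply,
        smul_eq_mul, map_mul, algebra_compatible_smul K r] }

theorem extendDual_apply (f : Module.Dual R M) (x : M) :
    extendDual K M f x = algebraMap R K (f x) := by
  let b := Module.Free.chooseBasis R M
  have : ((extendDual K M f).restrictScalars R).comp M.subtype =
      (Algebra.linearMap R K).comp f := by
    refine b.ext fun i => ?_
    have : ((b i : M) : V) = b.extendOfIsLattice K i := by simp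
    simp only [LinearMap.comp_apply, LinearMap.restrictScalars_apply, Submodule.subtype_apply]
    rw [this]
    simp [extendDual, b, -Module.Basis.extendOfIsLattice_apply]
  exact congr($this x)

theorem span_range_extendDual :
    Submodule.span K (Set.range (extendDual K M)) = ⊤ := by
  classical
  rw [_root_.eq_top_iff]
  rintro ψ -
  let b := Module.Free.chooseBasis R M
  let bK := b.extendOfIsLattice K
  have h2 : ψ = ∑ i, ψ (bK i) • extendDual K M (b.coord i) := by
    apply bK.ext
    intro j
    have : bK j = ((b j : M) : V) := by simp [bK]
    simp only [LinearMap.sum_apply, LinearMap.smul_apply]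
    rw [Finset.sum_eq_single j]
    · rw [this, extendDual_apply]
      simp
    · intro i _ hij
      rw [this, extendDual_apply]
      simp [hij.symm]
    · simp
  rw [h2]
  exact Submodule.sum_mem _ fun i _ =>
    Submodule.smul_mem _ _ (Submodule.subset_span ⟨b.coord i, rfl⟩)

/-- The inclusion of the generic fibre `ℙ(V)` into the model `ℙ(M)`. -/
noncomputable def genericFibre : projSpace K V ⟶ projSpace R M :=
  projSymMap (extendDual K M) (span_range_extendDual K M)

variable {K}

/-- The linear cycle `Z_W` as a morphism: the closed immersion `ℙ(W) ↪ ℙ(V)` of a subspace `W`. -/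
noncomputable def linearCycle (W : Submodule K V) : projSpace K W ⟶ projSpace K V :=
  projSymMap W.dualRestrict (by
    rw [Set.range_eq_univ.2 (Subspace.dualRestrict_surjective), Submodule.span_univ])

/-- The scheme-theoretic closure of `ℙ(W)` in the model `ℙ(M)`. -/
noncomputable def cycleClosure (W : Submodule K V) : (projSpace R M).IdealSheafData :=
  (linearCycle W ≫ genericFibre K M).ker

/-- The reduction in `ℙ(M) ⊗_R R/I` of the closure of `ℙ(W)` in `ℙ(M)`. -/
noncomputable def cycleReduction (W : Submodule K V) (I : Ideal R) :
    (projSpaceMod R M I).IdealSheafData :=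
  (cycleClosure M W).comap (Limits.pullback.fst _ _)

end Lattice
/-! ### The Bruhat–Tits building of `PGL(V)` -/

section Norms
variable (R : Type u) [CommRing R] [IsDomain R] [IsDiscreteValuationRing R]
  [Finite (IsLocalRing.ResidueField R)]
  (K : Type u) [Field K] [Algebra R K] [IsFractionRing R K]

/-- The number `q` of elements of the residue field. -/
noncomputable def residueCard : ℝ≥0 := Nat.card (IsLocalRing.ResidueField R)

theorem one_lt_residueCard : 1 < residueCard R := by
  have : 1 < Nat.card (IsLocalRing.ResidueField R) := Finite.one_lt_card
  unfold residueCard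
  exact_mod_cast this

/-- The absolute value `|x| = q ^ (-v x)` on `K`. -/
noncomputable def absVal : AbsoluteValue K ℝ :=
  (IsDiscreteValuationRing.maximalIdeal R).adicAbv (one_lt_residueCard R)

theorem absVal_le_one_iff (x : K) : absVal R K x ≤ 1 ↔ ∃ a : R, algebraMap R K a = x := by
  constructor
  · intro h
    apply IsDiscreteValuationRing.exists_lift_of_le_one
    have h' : (IsDiscreteValuationRing.maximalIdeal R).adicAbvDef (one_lt_residueCard R) x ≤ 1 := by
      exact_mod_cast h
    rwa [IsDedekindDomain.HeightOneSpectrum.adicAbvDef,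
      WithZeroMulInt.toNNReal_le_one_iff (one_lt_residueCard R)] at h'
  · rintro ⟨a, rfl⟩
    rw [absVal, IsDedekindDomain.HeightOneSpectrum.adicAbv_of_algebraMap]
    exact IsDedekindDomain.HeightOneSpectrum.intAdicAbv_le_one _ _ _

variable {K}
variable {V : Type u} [AddCommGroup V] [Module K V]

/-- `α` is the norm `∑ c_i e_i ↦ max |c_i| α(e_i)`, with positive weights `α(e_i)`. -/
def IsSplitBy (α : V → ℝ) (e : Module.Basis (Fin (Module.finrank K V)) K V) : Prop :=
  (∀ i, 0 < α (e i)) ∧ ∀ v, α v = ⨆ i, absVal R K (e.repr v i) * α (e i)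

variable (K V) in
/-- Non-archimedean norms on `V` which are split by some basis; the norms split by a given basis
make up the apartment of that basis: the point `∑ x_i η_i` of the standard apartment corresponds to
the norm with weights `α(v_i) = q ^ (-x_i)`. -/
structure SplitNorm where
  toFun : V → ℝ
  exists_isSplitBy : ∃ e : Module.Basis (Fin (Module.finrank K V)) K V, IsSplitBy R toFun e

variable (K V) in
/-- Homothety of norms. -/
def homothety : Setoid (SplitNorm R K V) where
  r α β := ∃ c : ℝ, 0 < c ∧ ∀ v, β.toFun v = c * α.toFun v
  iseqv :=
    { refl := fun _ => ⟨1, one_pos, fun _ => (one_mul _).symm⟩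
      symm := fun {α β} ⟨c, hc, h⟩ => ⟨c⁻¹, inv_pos.2 hc, fun v => by
        rw [h, inv_mul_cancel_left₀ hc.ne']⟩
      trans := fun {α β γ} ⟨c, hc, h⟩ ⟨d, hd, h'⟩ => ⟨d * c, mul_pos hd hc, fun v => by
        rw [h', h, mul_assoc]⟩ }

variable (K V) in
/-- The Bruhat–Tits building of `PGL(V)`, realized as the set of homothety classes of split
norms on `V`, i.e. the union of the apartments (each of them a copy of `ℝ^n / ℝ (1, …, 1)`) of all
bases of `V`. -/
def Building : Type u := Quotient (homothety R K V)

variable {R}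

/-- The point of the building given by a norm. -/
def Building.mk (α : SplitNorm R K V) : Building R K V := Quotient.mk _ α

/-- The action of `GL(V)` on norms, `(g α)(v) = α (g⁻¹ v)`. -/
def SplitNorm.act (g : V ≃ₗ[K] V) (α : SplitNorm R K V) : SplitNorm R K V where
  toFun v := α.toFun (g.symm v)
  exists_isSplitBy := by
    obtain ⟨e, he, h⟩ := α.exists_isSplitBy
    refine ⟨e.map g, by simpa using he, fun v => ?_⟩
    change α.toFun (g.symm v) = _
    rw [h]
    simp

/-- The action of `GL(V)` (through `PGL(V)`) on the building. -/
def Building.act (g : V ≃ₗ[K] V) : Building R K V → Building R K V :=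
  Quotient.map (SplitNorm.act g) fun _ _ ⟨c, hc, h⟩ => ⟨c, hc, fun _ => h _⟩

/-- The norm on `ℝ^n / ℝ (1, …, 1)` which is induced by the scalar product of `ℝ^n`; it is
invariant under the Weyl group. -/
noncomputable def apartmentNorm {n : ℕ} (x : Fin n → ℝ) : ℝ :=
  Real.sqrt (∑ i, (x i - (∑ j, x j) / n) ^ 2)

/-- The metric of the building: in an apartment which contains both points it is the Euclidean
distance in the coordinates `log_q α(e_i)`. (The set is a singleton.) -/
noncomputable def Building.dist (x y : Building R K V) : ℝ :=
  sInf {r | ∃ α β : SplitNorm R K V, x = .mk α ∧ y = .mk β ∧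
    ∃ e : Module.Basis (Fin (Module.finrank K V)) K V,
      IsSplitBy R α.toFun e ∧ IsSplitBy R β.toFun e ∧
      r = apartmentNorm fun i =>
        Real.logb (residueCard R) (α.toFun (e i)) - Real.logb (residueCard R) (β.toFun (e i))}

/-- Half-geodesics: isometric maps from `ℝ_{≥ 0}` to the building. -/
def IsHalfGeodesic (c : ℝ≥0 → Building R K V) : Prop :=
  ∀ s t, (c s).dist (c t) = |(s : ℝ) - t|

/-- Two half-geodesics are asymptotic, i.e. define the same point of the boundary at infinity, if
they stay at bounded distance. -/
def Asymptotic (c c' : ℝ≥0 → Building R K V) : Prop :=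
  ∃ C : ℝ, ∀ t, (c t).dist (c' t) ≤ C

/-- The half-geodesic `c` converges to the vertex `y_W` of the boundary at infinity. The boundary
points are the classes of asymptotic half-geodesics, and `y_W` (for a non-trivial subspace `W`) is
the one whose stabilizer is the maximal parabolic subgroup that corresponds to `W`, i.e. the
stabilizer of `W`. -/
def ConvergesTo (c : ℝ≥0 → Building R K V) (W : Submodule K V) : Prop :=
  ∀ g : V ≃ₗ[K] V, Asymptotic (fun t => (c t).act g) c ↔ W.map (g : V →ₗ[K] V) = W

variable [Module R V] [IsScalarTower R K V]

theorem mem_lattice_iff {n : ℕ} {M : Submodule R V} [M.IsLattice K] (b : Module.Basis (Fin n) R M)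
    (v : V) : v ∈ M ↔ ∀ i, absVal R K ((b.extendOfIsLattice K).repr v i) ≤ 1 := by
  have hb : ∀ i, b.extendOfIsLattice K i = ((b i : M) : V) := by simp
  constructor
  · intro hv i
    rw [absVal_le_one_iff]
    refine ⟨b.repr ⟨v, hv⟩ i, ?_⟩
    have : v = ∑ j, algebraMap R K (b.repr ⟨v, hv⟩ j) • b.extendOfIsLattice K j := by
      have := congrArg M.subtype (b.sum_repr ⟨v, hv⟩)
      simp only [map_sum, map_smul, Submodule.subtype_apply] at this
      refine this.symm.trans ?_
      simp [hb]
    conv_rhs => rw [this]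
    rw [Module.Basis.repr_sum_self]
  · intro h
    choose a ha using fun i => (absVal_le_one_iff R K _).1 (h i)
    rw [← (b.extendOfIsLattice K).sum_repr v]
    refine Submodule.sum_mem _ fun i _ => ?_
    rw [← ha, hb, algebraMap_smul]
    exact M.smul_mem _ (b i).2

theorem isLeast_latticeNorm {n : ℕ} {M : Submodule R V} [M.IsLattice K]
    (b : Module.Basis (Fin n) R M) (v : V) :
    IsLeast {r | ∃ c : K, r = absVal R K c ∧ ∃ w ∈ M, v = c • w}
      (⨆ i, absVal R K ((b.extendOfIsLattice K).repr v i)) := by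
  set e := b.extendOfIsLattice K
  constructor
  · by_cases hv : v = 0
    · refine ⟨0, ?_, 0, M.zero_mem, by simp [hv]⟩
      simp [hv]
    have : Nonempty (Fin n) := by
      by_contra hn
      rw [not_nonempty_iff] at hn
      exact hv (by rw [← e.sum_repr v]; simp)
    obtain ⟨i, hi⟩ := exists_eq_ciSup_of_finite (f := fun i => absVal R K (e.repr v i))
    have hle : ∀ j, absVal R K (e.repr v j) ≤ absVal R K (e.repr v i) := fun j => by
      rw [hi]; exact le_ciSup (f := fun i => absVal R K (e.repr v i)) (Set.finite_range _).bddAbove j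
    have h0 : e.repr v i ≠ 0 := by
      intro h0
      refine hv (e.repr.map_eq_zero_iff.1 (Finsupp.ext fun j => ?_))
      have := hle j
      rw [h0, map_zero] at this
      exact (absVal R K).eq_zero.1 (le_antisymm this ((absVal R K).nonneg _))
    refine ⟨e.repr v i, hi.symm, (e.repr v i)⁻¹ • v, ?_, by rw [smul_inv_smul₀ h0]⟩
    rw [mem_lattice_iff b]
    intro j
    change absVal R K (e.repr _ j) ≤ 1
    rw [map_smul, Finsupp.smul_apply, smul_eq_mul, map_mul, map_inv₀, inv_mul_le_one₀]
    · exact hle j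
    · exact (absVal R K).pos h0
  · rintro _ ⟨c, rfl, w, hw, rfl⟩
    refine Real.iSup_le (fun i => ?_) ((absVal R K).nonneg _)
    rw [map_smul, Finsupp.smul_apply, smul_eq_mul, map_mul]
    exact mul_le_of_le_one_right ((absVal R K).nonneg _) ((mem_lattice_iff b w).1 hw i)

/-- The norm `v ↦ min {|c| : v ∈ c M}` of a lattice `M`. -/
noncomputable def latticeNorm (M : Submodule R V) [M.IsLattice K] : SplitNorm R K V where
  toFun v := sInf {r | ∃ c : K, r = absVal R K c ∧ ∃ w ∈ M, v = c • w}
  exists_isSplitBy := by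
    have : Module.finrank R M = Module.finrank K V := by
      rw [Module.finrank, Submodule.IsLattice.rank' K M, Module.finrank]
    let b := Module.finBasisOfFinrankEq R M this
    have h : ∀ v, sInf {r | ∃ c : K, r = absVal R K c ∧ ∃ w ∈ M, v = c • w} =
        ⨆ i, absVal R K ((b.extendOfIsLattice K).repr v i) :=
      fun v => (isLeast_latticeNorm b v).csInf_eq
    have h1 : ∀ i, sInf {r | ∃ c : K, r = absVal R K c ∧ ∃ w ∈ M,
        b.extendOfIsLattice K i = c • w} = 1 := by
      intro i
      rw [h]
      have hle : ∀ j, absVal R K ((b.extendOfIsLattice K).repr (b.extendOfIsLattice K i) j) ≤ 1 :=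
        (mem_lattice_iff b _).1 (by simp)
      refine le_antisymm (Real.iSup_le hle zero_le_one) ?_
      refine le_trans (le_of_eq ?_) (le_ciSup (Set.finite_range _).bddAbove i)
      rw [Module.Basis.repr_self]
      simp
    refine ⟨b.extendOfIsLattice K, fun i => ?_, fun v => ?_⟩
    · exact one_pos.trans_eq (h1 i).symm
    · simp only [h1, mul_one]
      exact h v

/-- The vertex `{M}` of the building defined by a lattice `M`. -/
noncomputable def vertex (M : Submodule R V) [M.IsLattice K] : Building R K V :=
  .mk (latticeNorm M)

/-- The vertices of the building are the points `{M}` for lattices `M`. -/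
def IsVertex (x : Building R K V) : Prop :=
  ∃ (M : Submodule R V) (_ : M.IsLattice K), x = vertex M

/-- `s` is the initial segment `[x, y_W]_m`: the sequence of the first `m + 1` vertices on the
half-geodesic which starts in `x` and converges to `y_W`. -/
def IsInitialSegment (x : Building R K V) (W : Submodule K V) (m : ℕ)
    (s : Fin (m + 1) → Building R K V) : Prop :=
  ∃ c : ℝ≥0 → Building R K V, IsHalfGeodesic c ∧ c 0 = x ∧ ConvergesTo c W ∧
    ∃ t : Fin (m + 1) → ℝ≥0, StrictMono t ∧ (∀ i, s i = c (t i)) ∧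
      ∀ u ≤ t (Fin.last m), IsVertex (c u) ↔ u ∈ Set.range t

/-- The set of the initial segments `[x, y]_m` for all vertices `y = y_W` at infinity. -/
def initialSegments (x : Building R K V) (m : ℕ) : Set (Fin (m + 1) → Building R K V) :=
  {s | ∃ W : Submodule K V, W ≠ ⊥ ∧ W ≠ ⊤ ∧ IsInitialSegment x W m s}

end Norms
end LinearCycles

namespace LinearCycles

open scoped NNReal

/-! ### The absolute value -/

section AbsVal
variable (R : Type u) [CommRing R] [IsDomain R] [IsDiscreteValuationRing R]
  [Finite (IsLocalRing.ResidueField R)]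
  {K : Type u} [Field K] [Algebra R K] [IsFractionRing R K]

/-! Choose a basis `b` of `M` such that `W` is spanned by the `b i` with `i ∈ S`; it exists because
`M ∩ W` is saturated, hence a direct summand of `M` (`exists_basisSpan_eq`). In the apartment of `b`
the ray from `{M}` to `y_W` consists of the norms with weight `1` on `S` and `q ^ τ` off `S`, and
its `k`-th vertex is the class of the lattice `(M ∩ W) + π ^ k M`. So the first `m + 1` vertices and
the image of `M ∩ W` in `M / π ^ m M` determine each other (`forall_mk_eq_iff`), and this image is
the summand `N` for which `ℙ(N)` is the reduction of the closure of `ℙ(W)`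
(`cycleReduction_basisSpan`). Since `N` can be recovered from `ℙ(N)` (`linearCycleMod_redSpan_inj`)
and every split `N` comes from a part of a basis of `M` (`exists_redSpan_eq`), the bijection
follows.

The main work is to show that this ray is the only half-geodesic from `{M}` whose end has the
stabilizer of `W` as its stabilizer. Any two split norms have a common orthogonal basis
(`IsTame.exists_common`), so distances can be computed in an apartment (`Building.dist_mk`).
Interpolation between norms is convex (`IsInterp.ratioLE`), half-geodesics are interpolations
(`IsHalfGeodesic.isInterp`), and asymptotic ones with the same origin coincide
(`IsHalfGeodesic.eq_of_asymptotic`). Consequently every `g` which preserves `M` and `W` fixes such a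
ray pointwise. Diagonal matrices of units force the ray into the apartment of `b`
(`isOrthogonal_of_convergesTo`); permutations and transvections then leave only one direction
(`eq_stdRay_of_convergesTo`).

On the geometric side everything is checked on the charts `D₊(f)` with `f ∈ M^*`. In coordinates
adapted to `S` the maps of symmetric algebras kill the variables outside `S` and extend scalars, so
their kernels are read off from coefficients (`symHom_eq_zero_iff`). -/

theorem one_lt_residueCard_real : (1 : ℝ) < residueCard R := by
  exact_mod_cast one_lt_residueCard R

theorem residueCard_pos : (0 : ℝ) < residueCard R :=
  one_pos.trans (one_lt_residueCard_real R)

theorem absVal_add_le (x y : K) : absVal R K (x + y) ≤ max (absVal R K x) (absVal R K y) :=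
  IsDedekindDomain.HeightOneSpectrum.isNonarchimedean_adicAbv _ (one_lt_residueCard R) x y

theorem exists_absVal_eq_zpow {x : K} (hx : x ≠ 0) :
    ∃ k : ℤ, absVal R K x = (residueCard R : ℝ) ^ k := by
  have h : (IsDiscreteValuationRing.maximalIdeal R).valuation K x ≠ 0 := by simpa using hx
  refine ⟨(WithZero.unzero h).toAdd, ?_⟩
  change ((IsDedekindDomain.HeightOneSpectrum.adicAbvDef _ (one_lt_residueCard R) x : ℝ≥0) : ℝ) = _
  rw [IsDedekindDomain.HeightOneSpectrum.adicAbvDef, WithZeroMulInt.toNNReal_neg_apply _ h]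
  simp

theorem exists_absVal_eq_inv : ∃ x : K, absVal R K x = (residueCard R : ℝ)⁻¹ := by
  obtain ⟨x, hx⟩ := (IsDiscreteValuationRing.maximalIdeal R).valuation_exists_uniformizer K
  have h : (IsDiscreteValuationRing.maximalIdeal R).valuation K x ≠ 0 := by simp [hx]
  refine ⟨x, ?_⟩
  change ((IsDedekindDomain.HeightOneSpectrum.adicAbvDef _ (one_lt_residueCard R) x : ℝ≥0) : ℝ) = _
  rw [IsDedekindDomain.HeightOneSpectrum.adicAbvDef, WithZeroMulInt.toNNReal_neg_apply _ h]
  simp only [hx]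
  change ((residueCard R ^ (-1 : ℤ) : ℝ≥0) : ℝ) = _
  simp

theorem absVal_algebraMap_le_one (r : R) : absVal R K (algebraMap R K r) ≤ 1 :=
  (absVal_le_one_iff R K _).2 ⟨r, rfl⟩

theorem absVal_algebraMap_lt_one_iff {r : R} :
    absVal R K (algebraMap R K r) < 1 ↔ ¬ IsUnit r := by
  rw [absVal, IsDedekindDomain.HeightOneSpectrum.adicAbv_coe_lt_one_iff]
  rfl

theorem absVal_irreducible {π : R} (hπ : Irreducible π) :
    absVal R K (algebraMap R K π) = (residueCard R : ℝ)⁻¹ := by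
  have hq := one_lt_residueCard_real R
  obtain ⟨x, hx⟩ := exists_absVal_eq_inv R (K := K)
  have hx1 : absVal R K x < 1 := hx.trans_lt (inv_lt_one_of_one_lt₀ hq)
  obtain ⟨r, rfl⟩ := (absVal_le_one_iff R K x).1 hx1.le
  rw [absVal_algebraMap_lt_one_iff] at hx1
  have hr : r ∈ IsLocalRing.maximalIdeal R := hx1
  rw [(IsDiscreteValuationRing.irreducible_iff_uniformizer π).1 hπ,
    Ideal.mem_span_singleton] at hr
  obtain ⟨s, rfl⟩ := hr
  -- The multiple `π s` has absolute value `q⁻¹`, so `q⁻¹ ≤ |π| < 1`; as `|π|` is an integral power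
  -- of `q`, only the exponent `-1` is left.
  have h1 : (residueCard R : ℝ)⁻¹ ≤ absVal R K (algebraMap R K π) := by
    rw [← hx, map_mul, map_mul]
    exact mul_le_of_le_one_right ((absVal R K).nonneg _) (absVal_algebraMap_le_one R s)
  have h2 : absVal R K (algebraMap R K π) < 1 := (absVal_algebraMap_lt_one_iff R).2 hπ.not_isUnit
  obtain ⟨k, hk⟩ := exists_absVal_eq_zpow R (x := algebraMap R K π) (by
    simpa using hπ.ne_zero)
  rw [hk] at h1 h2 ⊢
  have h3 : k < 0 := by
    rw [← zpow_zero (residueCard R : ℝ)] at h2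
    exact (zpow_lt_zpow_iff_right₀ hq).1 h2
  have h4 : -1 ≤ k := by
    rw [← zpow_neg_one] at h1
    exact (zpow_le_zpow_iff_right₀ hq).1 h1
  rw [show k = -1 by omega, zpow_neg_one]

theorem exists_absVal_eq (k : ℤ) : ∃ x : K, x ≠ 0 ∧ absVal R K x = (residueCard R : ℝ) ^ k := by
  obtain ⟨x, hx⟩ := exists_absVal_eq_inv R (K := K)
  have hx0 : x ≠ 0 := fun h => by
    rw [h, map_zero] at hx
    exact (inv_pos.2 (residueCard_pos R)).ne hx
  refine ⟨x ^ (-k), zpow_ne_zero _ hx0, ?_⟩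
  rw [map_zpow₀, hx, inv_zpow, zpow_neg, inv_inv]

theorem absVal_le_pow_iff {π : R} (hπ : Irreducible π) (r : R) (k : ℕ) :
    absVal R K (algebraMap R K r) * (residueCard R : ℝ) ^ k ≤ 1 ↔ π ^ k ∣ r := by
  have hq := residueCard_pos R
  have h0 : algebraMap R K π ≠ 0 := by simpa using hπ.ne_zero
  have h : absVal R K (algebraMap R K r) * (residueCard R : ℝ) ^ k =
      absVal R K (algebraMap R K r / algebraMap R K π ^ k) := by
    rw [map_div₀, map_pow, absVal_irreducible R hπ, inv_pow, div_inv_eq_mul]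
  rw [h, absVal_le_one_iff]
  constructor
  · rintro ⟨a, ha⟩
    rw [eq_div_iff (pow_ne_zero _ h0), ← map_pow, ← map_mul] at ha
    exact ⟨a, by rw [mul_comm, IsFractionRing.injective R K ha]⟩
  · rintro ⟨a, rfl⟩
    exact ⟨a, by rw [map_mul, map_pow, mul_div_cancel_left₀ _ (pow_ne_zero _ h0)]⟩

end AbsVal

/-! ### Ultrametric norms and orthogonal bases -/

section Ultranorm
variable (R : Type u) [CommRing R] [IsDomain R] [IsDiscreteValuationRing R]
  [Finite (IsLocalRing.ResidueField R)]
  (K : Type u) [Field K] [Algebra R K] [IsFractionRing R K]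
  {V : Type u} [AddCommGroup V] [Module K V]

/-- Ultrametric norms on a vector space. -/
structure IsUltranorm (α : V → ℝ) : Prop where
  pos : ∀ v, v ≠ 0 → 0 < α v
  smul : ∀ (c : K) v, α (c • v) = absVal R K c * α v
  add_le : ∀ v w, α (v + w) ≤ max (α v) (α w)

variable {K} in
/-- A basis is orthogonal for `α` if `α (∑ c_i e_i) ≥ |c_i| α(e_i)` for all `i`. -/
def IsOrthogonal {ι : Type*} (α : V → ℝ) (e : Module.Basis ι K V) : Prop :=
  ∀ v i, absVal R K (e.repr v i) * α (e i) ≤ α v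

variable {R K} {α β : V → ℝ}

namespace IsUltranorm
theorem map_zero (hα : IsUltranorm R K α) : α 0 = 0 := by
  have := hα.smul 0 0
  simpa using this

theorem nonneg (hα : IsUltranorm R K α) (v : V) : 0 ≤ α v := by
  by_cases hv : v = 0
  · rw [hv, hα.map_zero]
  · exact (hα.pos v hv).le

theorem map_neg (hα : IsUltranorm R K α) (v : V) : α (-v) = α v := by
  have := hα.smul (-1) v
  simpa using this

theorem sub_le (hα : IsUltranorm R K α) (v w : V) : α (v - w) ≤ max (α v) (α w) := by
  rw [sub_eq_add_neg, ← hα.map_neg w]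
  exact hα.add_le _ _

theorem sum_le (hα : IsUltranorm R K α) {ι : Type*} (s : Finset ι) (f : ι → V) {C : ℝ} (hC : 0 ≤ C)
    (h : ∀ i ∈ s, α (f i) ≤ C) : α (∑ i ∈ s, f i) ≤ C := by
  classical
  induction s using Finset.induction_on with
  | empty => simpa [hα.map_zero] using hC
  | insert i s hi ih =>
    rw [Finset.sum_insert hi]
    exact (hα.add_le _ _).trans (max_le (h i (by simp))
      (ih fun j hj => h j (Finset.mem_insert_of_mem hj)))

theorem le_of_repr (hα : IsUltranorm R K α) {ι : Type*} [Fintype ι] (e : Module.Basis ι K V) (v : V)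
    {C : ℝ} (hC : 0 ≤ C) (h : ∀ i, absVal R K (e.repr v i) * α (e i) ≤ C) : α v ≤ C := by
  rw [← e.sum_repr v]
  refine hα.sum_le _ _ hC fun i _ => ?_
  rw [hα.smul]
  exact h i

theorem exists_le_of_ne_zero (hα : IsUltranorm R K α) {ι : Type*} [Fintype ι]
    (e : Module.Basis ι K V) {v : V} (hv : v ≠ 0) :
    ∃ i, e.repr v i ≠ 0 ∧ α v ≤ absVal R K (e.repr v i) * α (e i) := by
  have hne : Nonempty ι := by
    by_contra h
    rw [not_nonempty_iff] at h
    exact hv (by rw [← e.sum_repr v]; simp)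
  obtain ⟨i, hi⟩ := Finite.exists_max fun i => absVal R K (e.repr v i) * α (e i)
  have h := hα.le_of_repr e v (mul_nonneg ((absVal R K).nonneg _) (hα.nonneg _)) hi
  refine ⟨i, fun h0 => ?_, h⟩
  rw [h0, _root_.map_zero, zero_mul] at h
  exact (hα.pos v hv).not_ge h

theorem exists_eq (hα : IsUltranorm R K α) {ι : Type*} [Fintype ι]
    {e : Module.Basis ι K V} (he : IsOrthogonal R α e) {v : V} (hv : v ≠ 0) :
    ∃ i, e.repr v i ≠ 0 ∧ α v = absVal R K (e.repr v i) * α (e i) := by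
  obtain ⟨i, hi, h⟩ := hα.exists_le_of_ne_zero e hv
  exact ⟨i, hi, h.antisymm (he v i)⟩

theorem basis_pos (hα : IsUltranorm R K α) {ι : Type*} (e : Module.Basis ι K V) (i : ι) :
    0 < α (e i) := hα.pos _ (e.ne_zero i)

theorem congr_of_orthogonal (hα : IsUltranorm R K α) (hβ : IsUltranorm R K β) {ι : Type*} [Fintype ι]
    {e : Module.Basis ι K V} (he : IsOrthogonal R α e) (he' : IsOrthogonal R β e)
    (h : ∀ i, α (e i) = β (e i)) : α = β := by
  ext v
  refine le_antisymm (hα.le_of_repr e v (hβ.nonneg _) fun i => ?_)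
    (hβ.le_of_repr e v (hα.nonneg _) fun i => ?_)
  · rw [h]; exact he' v i
  · rw [← h]; exact he v i

theorem const_mul (hα : IsUltranorm R K α) {c : ℝ} (hc : 0 < c) :
    IsUltranorm R K (fun v => c * α v) where
  pos v hv := mul_pos hc (hα.pos v hv)
  smul a v := by rw [hα.smul]; ring
  add_le v w := by
    rw [← mul_max_of_nonneg _ _ hc.le]
    exact mul_le_mul_of_nonneg_left (hα.add_le v w) hc.le

theorem comp (hα : IsUltranorm R K α) {W : Type u} [AddCommGroup W] [Module K W] (g : W →ₗ[K] V)
    (hg : Function.Injective g) : IsUltranorm R K (fun w => α (g w)) where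
  pos w hw := hα.pos _ fun h => hw (hg (by rw [h, _root_.map_zero]))
  smul c w := by rw [map_smul, hα.smul]
  add_le v w := by rw [map_add]; exact hα.add_le _ _

end IsUltranorm

theorem IsOrthogonal.const_mul {ι : Type*} {e : Module.Basis ι K V} (he : IsOrthogonal R α e)
    {c : ℝ} (hc : 0 < c) : IsOrthogonal R (fun v => c * α v) e := fun v i => by
  rw [mul_left_comm]
  exact mul_le_mul_of_nonneg_left (he v i) hc.le

theorem IsOrthogonal.comp {ι : Type*} {e : Module.Basis ι K V} (he : IsOrthogonal R α e)
    {W : Type u} [AddCommGroup W] [Module K W] (g : W ≃ₗ[K] V) :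
    IsOrthogonal R (fun v => α (g v)) (e.map g.symm) := fun v i => by
  simpa using he (g v) i

/-- The supremum formula amounts to two inequalities: `≤` is the ultrametric inequality for the
expansion in `e`, `≥` is orthogonality. -/
theorem isSplitBy_iff {e : Module.Basis (Fin (Module.finrank K V)) K V} :
    IsSplitBy R α e ↔ IsUltranorm R K α ∧ IsOrthogonal R α e := by
  constructor
  · rintro ⟨hpos, h⟩
    have hle : ∀ v i, absVal R K (e.repr v i) * α (e i) ≤ α v := fun v i => by
      rw [h v]
      exact le_ciSup (f := fun i => absVal R K (e.repr v i) * α (e i))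
        (Set.finite_range _).bddAbove i
    have hnn : ∀ v, 0 ≤ α v := fun v => by
      rw [h v]
      exact Real.iSup_nonneg fun i => mul_nonneg ((absVal R K).nonneg _) (hpos i).le
    refine ⟨⟨fun v hv => ?_, fun c v => ?_, fun v w => ?_⟩, hle⟩
    · obtain ⟨i, hi⟩ : ∃ i, e.repr v i ≠ 0 := by
        by_contra! h0
        exact hv (e.repr.map_eq_zero_iff.1 (Finsupp.ext h0))
      exact (mul_pos ((absVal R K).pos hi) (hpos i)).trans_le (hle v i)
    · rw [h, h v, Real.mul_iSup_of_nonneg ((absVal R K).nonneg _)]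
      simp [mul_assoc]
    · rw [h (v + w)]
      refine Real.iSup_le (fun i => ?_) (le_max_of_le_left (hnn v))
      rw [map_add, Finsupp.add_apply]
      refine (mul_le_mul_of_nonneg_right (absVal_add_le R _ _) (hpos i).le).trans ?_
      rw [max_mul_of_nonneg _ _ (hpos i).le]
      exact max_le_max (hle v i) (hle w i)
  · rintro ⟨hα, he⟩
    refine ⟨hα.basis_pos e, fun v => le_antisymm ?_ (Real.iSup_le (he v) (hα.nonneg v))⟩
    refine hα.le_of_repr e v
      (Real.iSup_nonneg fun i => mul_nonneg ((absVal R K).nonneg _) (hα.nonneg _)) fun i => ?_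
    exact le_ciSup (f := fun i => absVal R K (e.repr v i) * α (e i))
        (Set.finite_range _).bddAbove i

theorem SplitNorm.isUltranorm (α : SplitNorm R K V) : IsUltranorm R K α.toFun :=
  let ⟨_, he⟩ := α.exists_isSplitBy
  (isSplitBy_iff.1 he).1

theorem Building.mk_eq_mk {α β : SplitNorm R K V} :
    Building.mk α = Building.mk β ↔ ∃ c : ℝ, 0 < c ∧ ∀ v, β.toFun v = c * α.toFun v :=
  Quotient.eq (r := homothety R K V)

theorem Building.exists_eq_mk (x : Building R K V) : ∃ α, x = .mk α :=
  let ⟨α, h⟩ := Quotient.exists_rep x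
  ⟨α, h.symm⟩

end Ultranorm

/-! ### Discrete sets of values -/

section LogDiscrete

/-- A set of positive real numbers which is contained in a finite union of cosets of `q ^ ℤ`. -/
def IsLogDiscrete (q : ℝ) (s : Set ℝ) : Prop :=
  ∃ F : Finset ℝ, (∀ x ∈ F, 0 < x) ∧ ∀ x ∈ s, ∃ f ∈ F, ∃ k : ℤ, x = f * q ^ k

variable {q : ℝ} {s t : Set ℝ}

theorem IsLogDiscrete.mono (hs : IsLogDiscrete q s) (h : t ⊆ s) : IsLogDiscrete q t :=
  let ⟨F, hF, H⟩ := hs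
  ⟨F, hF, fun x hx => H x (h hx)⟩

theorem IsLogDiscrete.div (hq : 0 < q) (hs : IsLogDiscrete q s) (ht : IsLogDiscrete q t) :
    IsLogDiscrete q (Set.image2 (· / ·) s t) := by
  classical
  obtain ⟨F, hF, H⟩ := hs
  obtain ⟨G, hG, H'⟩ := ht
  refine ⟨Finset.image₂ (· / ·) F G, fun x hx => ?_, ?_⟩
  · obtain ⟨f, hf, g, hg, rfl⟩ := Finset.mem_image₂.1 hx
    exact div_pos (hF f hf) (hG g hg)
  · rintro _ ⟨x, hx, y, hy, rfl⟩
    obtain ⟨f, hf, k, rfl⟩ := H x hx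
    obtain ⟨g, hg, l, rfl⟩ := H' y hy
    refine ⟨f / g, Finset.mem_image₂_of_mem hf hg, k - l, ?_⟩
    change f * q ^ k / (g * q ^ l) = _
    rw [zpow_sub₀ hq.ne', mul_div_mul_comm]

/-- On each of the finitely many cosets `f q ^ ℤ` the bounds `c > 0` and `d` confine the exponent to
a bounded interval. -/
theorem IsLogDiscrete.finite_inter_Icc (hq : 1 < q) (hs : IsLogDiscrete q s) {c : ℝ} (hc : 0 < c)
    (d : ℝ) : (s ∩ Set.Icc c d).Finite := by
  obtain ⟨F, hF, H⟩ := hs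
  have hlog : 0 < Real.log q := Real.log_pos hq
  have hq0 : 0 < q := one_pos.trans hq
  have hfin : (⋃ f ∈ (F : Set ℝ), (fun k : ℤ => f * q ^ k) ''
      Set.Icc ⌈(Real.log c - Real.log f) / Real.log q⌉
        ⌊(Real.log d - Real.log f) / Real.log q⌋).Finite :=
    F.finite_toSet.biUnion fun f _ => (Set.finite_Icc _ _).image _
  refine hfin.subset ?_
  rintro x ⟨hx, hcx, hxd⟩
  obtain ⟨f, hf, k, rfl⟩ := H x hx
  have hf0 := hF f hf
  simp only [Set.mem_iUnion]
  have hl : Real.log (f * q ^ k) = Real.log f + k * Real.log q := by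
    rw [Real.log_mul hf0.ne' (zpow_pos hq0 _).ne', Real.log_zpow]
  refine ⟨f, hf, k, ⟨?_, ?_⟩, rfl⟩
  · rw [Int.ceil_le, div_le_iff₀ hlog]
    have := Real.log_le_log hc hcx
    linarith
  · rw [Int.le_floor, le_div_iff₀ hlog]
    have := Real.log_le_log (hc.trans_le hcx) hxd
    linarith

theorem IsLogDiscrete.exists_min (hq : 1 < q) (hs : IsLogDiscrete q s) (hne : s.Nonempty)
    {c : ℝ} (hc : 0 < c) (hcs : ∀ x ∈ s, c ≤ x) : ∃ x ∈ s, ∀ y ∈ s, x ≤ y := by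
  obtain ⟨x₀, hx₀⟩ := hne
  obtain ⟨x, ⟨hx, hx'⟩, H⟩ := Set.exists_min_image _ id (hs.finite_inter_Icc hq hc x₀)
    ⟨x₀, hx₀, hcs _ hx₀, le_rfl⟩
  refine ⟨x, hx, fun y hy => ?_⟩
  by_cases h : y ≤ x₀
  · exact H y ⟨hy, hcs y hy, h⟩
  · exact hx'.2.trans (not_le.1 h).le

theorem IsLogDiscrete.exists_max (hq : 1 < q) (hs : IsLogDiscrete q s) (hne : s.Nonempty)
    (hpos : ∀ x ∈ s, 0 < x) {d : ℝ} (hd : ∀ x ∈ s, x ≤ d) : ∃ x ∈ s, ∀ y ∈ s, y ≤ x := by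
  obtain ⟨x₀, hx₀⟩ := hne
  obtain ⟨x, ⟨hx, hx'⟩, H⟩ := Set.exists_max_image _ id (hs.finite_inter_Icc hq (hpos _ hx₀) d)
    ⟨x₀, hx₀, le_rfl, hd _ hx₀⟩
  refine ⟨x, hx, fun y hy => ?_⟩
  by_cases h : x₀ ≤ y
  · exact H y ⟨hy, h, hd y hy⟩
  · exact (not_le.1 h).le.trans hx'.1

end LogDiscrete

/-! ### Existence of orthogonal bases -/

section Tame
variable (R : Type u) [CommRing R] [IsDomain R] [IsDiscreteValuationRing R]
  [Finite (IsLocalRing.ResidueField R)]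
  (K : Type u) [Field K] [Algebra R K] [IsFractionRing R K]
  {V : Type u} [AddCommGroup V] [Module K V]

/-- Ultrametric norms whose set of values is discrete and for which all linear forms are bounded.
On a finite-dimensional space these are the norms which have an orthogonal basis. -/
structure IsTame (α : V → ℝ) : Prop extends IsUltranorm R K α where
  discrete : IsLogDiscrete (residueCard R) (α '' {0}ᶜ)
  bounded : ∀ φ : V →ₗ[K] K, ∃ C, ∀ v, absVal R K (φ v) ≤ C * α v

variable {R K} {α β : V → ℝ}

theorem IsUltranorm.isTame (hα : IsUltranorm R K α) {ι : Type*} [Fintype ι]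
    {e : Module.Basis ι K V} (he : IsOrthogonal R α e) : IsTame R K α where
  toIsUltranorm := hα
  discrete := by
    classical
    refine ⟨Finset.univ.image fun i => α (e i), fun x hx => ?_, ?_⟩
    · obtain ⟨i, -, rfl⟩ := Finset.mem_image.1 hx
      exact hα.basis_pos e i
    · rintro _ ⟨v, hv, rfl⟩
      obtain ⟨i, hi, h⟩ := hα.exists_eq he hv
      obtain ⟨k, hk⟩ := exists_absVal_eq_zpow R hi
      exact ⟨α (e i), Finset.mem_image_of_mem _ (Finset.mem_univ i), k, by rw [h, hk, mul_comm]⟩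
  bounded φ := by
    refine ⟨∑ i, absVal R K (φ (e i)) / α (e i), fun v => ?_⟩
    have h : φ v = ∑ i, e.repr v i * φ (e i) := by
      conv_lhs => rw [← e.sum_repr v]
      simp only [map_sum, map_smul, smul_eq_mul]
    rw [h, Finset.sum_mul]
    refine ((absVal R K).sum_le _ _).trans (Finset.sum_le_sum fun i _ => ?_)
    rw [map_mul, div_mul_eq_mul_div, le_div_iff₀ (hα.basis_pos e i)]
    calc _ = absVal R K (φ (e i)) * (absVal R K (e.repr v i) * α (e i)) := by ring
      _ ≤ _ := mul_le_mul_of_nonneg_left (he v i) ((absVal R K).nonneg _)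

theorem SplitNorm.isTame (α : SplitNorm R K V) : IsTame R K α.toFun :=
  let ⟨_, he⟩ := α.exists_isSplitBy
  (isSplitBy_iff.1 he).1.isTame (isSplitBy_iff.1 he).2

/-- Tameness, unlike the existence of an orthogonal basis, is visibly inherited by subspaces. This
makes the inductions on the dimension possible. -/
theorem IsTame.restrict (hα : IsTame R K α) (H : Submodule K V) :
    IsTame R K (fun h : H => α h) where
  toIsUltranorm := hα.toIsUltranorm.comp H.subtype H.injective_subtype
  discrete := hα.discrete.mono (by
    rintro _ ⟨h, hh, rfl⟩
    exact ⟨h, fun h0 => hh (Subtype.ext h0), rfl⟩)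
  bounded φ := by
    obtain ⟨ψ, hψ⟩ := φ.exists_extend
    obtain ⟨C, hC⟩ := hα.bounded ψ
    refine ⟨C, fun v => ?_⟩
    rw [← hψ]
    exact hC v

/-- Boundedness of `φ` keeps `α` away from `0` on the affine hyperplane `φ = 1`, and discreteness
then turns the infimum into a minimum. -/
theorem IsTame.exists_min (hα : IsTame R K α) {φ : V →ₗ[K] K} (hφ : φ ≠ 0) :
    ∃ v, φ v = 1 ∧ ∀ w, φ w = 1 → α v ≤ α w := by
  obtain ⟨v₀, hv₀⟩ : ∃ v, φ v = 1 := by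
    obtain ⟨v, hv⟩ : ∃ v, φ v ≠ 0 := by
      by_contra! h
      exact hφ (LinearMap.ext h)
    exact ⟨(φ v)⁻¹ • v, by rw [map_smul, smul_eq_mul, inv_mul_cancel₀ hv]⟩
  obtain ⟨C, hC⟩ := hα.bounded φ
  have h1 : ∀ w, φ w = 1 → 1 ≤ C * α w := fun w hw => by
    have := hC w
    rwa [hw, map_one] at this
  have hne : ∀ w, φ w = 1 → w ≠ 0 := fun w hw h0 => by simp [h0] at hw
  have hC0 : 0 < C := by
    by_contra! h
    have := h1 v₀ hv₀
    nlinarith [hα.nonneg v₀]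
  obtain ⟨_, ⟨v, hv, rfl⟩, H⟩ := (hα.discrete.mono (Set.image_mono
    (show {w | φ w = 1} ⊆ {0}ᶜ from hne))).exists_min (one_lt_residueCard_real R)
    ⟨_, v₀, hv₀, rfl⟩ (inv_pos.2 hC0) (by
      rintro _ ⟨w, hw, rfl⟩
      rw [inv_le_iff_one_le_mul₀' hC0]
      exact h1 w hw)
  exact ⟨v, hv, fun w hw => H _ ⟨w, hw, rfl⟩⟩

/-- A vector `v` and a hyperplane `ker φ` orthogonal to it. -/
theorem isOrthogonal_mkFinCons (hα : IsUltranorm R K α) {φ : V →ₗ[K] K} {v : V} (hφv : φ v = 1)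
    (hφ : ∀ w, absVal R K (φ w) * α v ≤ α w) {n : ℕ}
    {b : Module.Basis (Fin n) K (LinearMap.ker φ)} (hb : IsOrthogonal R (fun h : LinearMap.ker φ => α h) b)
    (hli hsp) : IsOrthogonal R α (Module.Basis.mkFinCons v b hli hsp) := by
  intro w i
  set e := Module.Basis.mkFinCons v b hli hsp with he
  have hb0 : ∀ j, φ (b j) = 0 := fun j => (b j).2
  have hsum : w = e.repr w 0 • v + ∑ j, e.repr w (Fin.succ j) • (b j : V) := by
    conv_lhs => rw [← e.sum_repr w, Fin.sum_univ_succ]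
    simp [he]
  have h0 : φ w = e.repr w 0 := by
    conv_lhs => rw [hsum]
    simp [hφv, hb0]
  refine i.cases ?_ fun j => ?_
  · rw [← h0]
    simpa [he] using hφ w
  · set h : LinearMap.ker φ := ∑ j, e.repr w (Fin.succ j) • b j with hh
    have hw : w - e.repr w 0 • v = (h : V) := by
      rw [sub_eq_iff_eq_add', hh]
      conv_lhs => rw [hsum]
      simp
    have h1 : α (h : V) ≤ α w := by
      rw [← hw]
      refine (hα.sub_le _ _).trans (max_le le_rfl ?_)
      rw [hα.smul, ← h0]
      exact hφ w
    have h2 : b.repr h j = e.repr w (Fin.succ j) := by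
      rw [hh, b.repr_sum_self]
    refine le_trans (le_of_eq ?_) ((hb h j).trans h1)
    rw [h2]
    simp [he]

theorem hyperplane_li {φ : V →ₗ[K] K} {v : V} (hφv : φ v = 1) (c : K) :
    ∀ x ∈ LinearMap.ker φ, c • v + x = 0 → c = 0 := fun x hx h => by
  have := congrArg φ h
  simpa [hφv, LinearMap.mem_ker.1 hx] using this

theorem hyperplane_sp {φ : V →ₗ[K] K} {v : V} (hφv : φ v = 1) (z : V) :
    ∃ c : K, z + c • v ∈ LinearMap.ker φ :=
  ⟨-φ z, by simp [hφv]⟩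

theorem finrank_ker_form [FiniteDimensional K V] {φ : V →ₗ[K] K} {v : V} (hφv : φ v = 1) {n : ℕ}
    (hn : Module.finrank K V = n + 1) : Module.finrank K (LinearMap.ker φ) = n := by
  have h := φ.finrank_range_add_finrank_ker
  have : LinearMap.range φ = ⊤ := LinearMap.range_eq_top.2 fun c => ⟨c • v, by simp [hφv]⟩
  rw [this, finrank_top, Module.finrank_self] at h
  omega

/-- A vector `v` of least norm on `φ = 1` is orthogonal to `ker φ`: scaling `w` to `φ = 1` gives `|φ
w| α(v) ≤ α(w)`. The rest is induction on the dimension. -/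
theorem IsTame.exists_isOrthogonal [FiniteDimensional K V] (hα : IsTame R K α) {n : ℕ}
    (hn : Module.finrank K V = n) : ∃ e : Module.Basis (Fin n) K V, IsOrthogonal R α e := by
  induction n generalizing V with
  | zero =>
    exact ⟨Module.finBasisOfFinrankEq K V hn, fun v i => i.elim0⟩
  | succ n ih =>
    let b := Module.finBasisOfFinrankEq K V hn
    have hφ : b.coord 0 ≠ 0 := fun h => by
      have := LinearMap.congr_fun h (b 0)
      simp at this
    obtain ⟨v, hv, H⟩ := hα.exists_min hφ
    obtain ⟨c, hc⟩ := ih (hα.restrict (LinearMap.ker (b.coord 0))) (finrank_ker_form hv hn)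
    refine ⟨_, isOrthogonal_mkFinCons hα.toIsUltranorm hv (fun w => ?_) hc
      (hyperplane_li hv) (hyperplane_sp hv)⟩
    by_cases h : b.coord 0 w = 0
    · rw [h, map_zero, zero_mul]
      exact hα.nonneg w
    · have := H ((b.coord 0 w)⁻¹ • w) (by rw [map_smul, smul_eq_mul, inv_mul_cancel₀ h])
      rwa [hα.smul, map_inv₀, ← div_eq_inv_mul, le_div_iff₀' ((absVal R K).pos h)] at this

theorem IsTame.exists_le_mul [FiniteDimensional K V] (hα : IsUltranorm R K α)
    (hβ : IsTame R K β) : ∃ C, ∀ v, α v ≤ C * β v := by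
  let e := Module.finBasis K V
  choose C hC using fun i => hβ.bounded (e.coord i)
  refine ⟨∑ i, |C i * α (e i)|, fun v => ?_⟩
  refine hα.le_of_repr e v (mul_nonneg (Finset.sum_nonneg fun i _ => abs_nonneg _)
    (hβ.nonneg v)) fun i => ?_
  calc _ ≤ C i * β v * α (e i) := mul_le_mul_of_nonneg_right (hC i v) (hα.nonneg _)
    _ = (C i * α (e i)) * β v := by ring
    _ ≤ |C i * α (e i)| * β v := mul_le_mul_of_nonneg_right (le_abs_self _) (hβ.nonneg v)
    _ ≤ _ := mul_le_mul_of_nonneg_right (Finset.single_le_sum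
      (f := fun i => |C i * α (e i)|) (fun i _ => abs_nonneg _) (Finset.mem_univ i)) (hβ.nonneg v)

/-- The ratio `α / β` is bounded and its values form a discrete set, so its supremum is attained. -/
theorem IsTame.exists_max_ratio [FiniteDimensional K V] [Nontrivial V] (hα : IsTame R K α)
    (hβ : IsTame R K β) : ∃ v, v ≠ 0 ∧ ∀ w, α w * β v ≤ α v * β w := by
  obtain ⟨C, hC⟩ := IsTame.exists_le_mul hα.toIsUltranorm hβ
  obtain ⟨v₀, hv₀⟩ := exists_ne (0 : V)
  obtain ⟨_, ⟨v, hv, rfl⟩, H⟩ := ((hα.discrete.div (residueCard_pos R) hβ.discrete).mono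
    (show (fun v => α v / β v) '' {0}ᶜ ⊆ _ by
      rintro _ ⟨v, hv, rfl⟩
      exact ⟨α v, ⟨v, hv, rfl⟩, β v, ⟨v, hv, rfl⟩, rfl⟩)).exists_max (one_lt_residueCard_real R)
    ⟨_, v₀, hv₀, rfl⟩ (by
      rintro _ ⟨w, hw, rfl⟩
      exact div_pos (hα.pos w hw) (hβ.pos w hw)) (d := C) (by
      rintro _ ⟨w, hw, rfl⟩
      exact (div_le_iff₀ (hβ.pos w hw)).2 (hC w))
  refine ⟨v, hv, fun w => ?_⟩
  by_cases hw : w = 0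
  · rw [hw, hα.map_zero, hβ.map_zero, zero_mul, mul_zero]
  · have := H _ ⟨w, hw, rfl⟩
    rwa [div_le_div_iff₀ (hβ.pos w hw) (hβ.pos v hv)] at this

/-- Any two norms have a common orthogonal basis. -/
theorem IsTame.exists_common [FiniteDimensional K V] (hα : IsTame R K α) (hβ : IsTame R K β)
    {n : ℕ} (hn : Module.finrank K V = n) :
    ∃ e : Module.Basis (Fin n) K V, IsOrthogonal R α e ∧ IsOrthogonal R β e := by
  induction n generalizing V with
  | zero =>
    exact ⟨Module.finBasisOfFinrankEq K V hn, fun v i => i.elim0, fun v i => i.elim0⟩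
  | succ n ih =>
    have : Nontrivial V := Module.nontrivial_of_finrank_pos (R := K) (by omega)
    obtain ⟨v, hv, H⟩ := hα.exists_max_ratio hβ
    obtain ⟨b, hb⟩ := hα.exists_isOrthogonal hn
    obtain ⟨i, hi, hvi⟩ := hα.exists_eq hb hv
    -- The index `i` is one at which `α v` is attained, so projecting to the line of `v` along `ker
    -- φ` does not increase `α`. Maximality of `α v / β v` carries this over to `β`, so the
    -- hyperplane is orthogonal to `v` for both norms.
    let φ : V →ₗ[K] K := (b.repr v i)⁻¹ • b.coord i
    have hφv : φ v = 1 := by simp [φ, hi]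
    have hφα : ∀ w, absVal R K (φ w) * α v ≤ α w := fun w => by
      have h : absVal R K (φ w) * α v = absVal R K (b.repr w i) * α (b i) := by
        have := (absVal R K).pos hi
        simp only [φ, LinearMap.smul_apply, Module.Basis.coord_apply, smul_eq_mul, map_mul,
          map_inv₀, hvi]
        field_simp
      rw [h]
      exact hb w i
    have hφβ : ∀ w, absVal R K (φ w) * β v ≤ β w := fun w => by
      refine le_of_mul_le_mul_left ?_ (hα.pos v hv)
      calc α v * (absVal R K (φ w) * β v) = absVal R K (φ w) * α v * β v := by ring
        _ ≤ α w * β v := mul_le_mul_of_nonneg_right (hφα w) (hβ.nonneg v)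
        _ ≤ _ := H w
    obtain ⟨c, hc, hc'⟩ := ih (hα.restrict (LinearMap.ker φ)) (hβ.restrict _)
      (finrank_ker_form hφv hn)
    exact ⟨Module.Basis.mkFinCons v c (hyperplane_li hφv) (hyperplane_sp hφv),
      isOrthogonal_mkFinCons hα.toIsUltranorm hφv hφα hc _ _,
      isOrthogonal_mkFinCons hβ.toIsUltranorm hφv hφβ hc' _ _⟩

end Tame

/-! ### The Euclidean norm of an apartment -/

section ApartmentNorm
variable {n : ℕ}

theorem apartmentNorm_perm (x : Fin n → ℝ) (σ : Equiv.Perm (Fin n)) :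
    apartmentNorm (fun i => x (σ i)) = apartmentNorm x := by
  unfold apartmentNorm
  rw [Equiv.sum_comp σ x, Equiv.sum_comp σ (fun i => (x i - (∑ j, x j) / n) ^ 2)]

theorem apartmentNorm_add_const (x : Fin n → ℝ) (c : ℝ) :
    apartmentNorm (fun i => x i + c) = apartmentNorm x := by
  unfold apartmentNorm
  rcases Nat.eq_zero_or_pos n with rfl | hn
  · simp
  congr 1
  refine Finset.sum_congr rfl fun i _ => ?_
  have : (n : ℝ) ≠ 0 := by exact_mod_cast hn.ne'
  rw [Finset.sum_add_distrib, Finset.sum_const, Finset.card_univ, Fintype.card_fin, nsmul_eq_mul]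
  field_simp
  ring

/-- The orthogonal projection along the diagonal. -/
noncomputable def diagProj (x : Fin n → ℝ) : EuclideanSpace ℝ (Fin n) :=
  WithLp.toLp 2 fun i => x i - (∑ j, x j) / n

theorem diagProj_add (x y : Fin n → ℝ) : diagProj (x + y) = diagProj x + diagProj y := by
  ext i
  simp only [diagProj, Pi.add_apply, Finset.sum_add_distrib, PiLp.add_apply]
  ring

theorem diagProj_smul (c : ℝ) (x : Fin n → ℝ) : diagProj (c • x) = c • diagProj x := by
  ext i
  simp only [diagProj, Pi.smul_apply, smul_eq_mul, ← Finset.mul_sum, PiLp.smul_apply]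
  ring

theorem norm_diagProj (x : Fin n → ℝ) : ‖diagProj x‖ = apartmentNorm x := by
  rw [EuclideanSpace.norm_eq, apartmentNorm]
  simp [diagProj]

/-- With its converse below, this compares the Euclidean metric with the largest difference of two
coordinates, which is what `RatioLE` measures. -/
theorem sub_le_two_mul_apartmentNorm (x : Fin n → ℝ) (i j : Fin n) :
    x i - x j ≤ 2 * apartmentNorm x := by
  have h : ∀ k, |x k - (∑ l, x l) / n| ≤ apartmentNorm x := fun k => by
    rw [← norm_diagProj]
    exact PiLp.norm_apply_le (diagProj x) k
  have h1 := (le_abs_self _).trans (h i)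
  have h2 := (neg_le_abs _).trans (h j)
  linarith

theorem apartmentNorm_le_of_sub_le {x : Fin n → ℝ} {C : ℝ} (h : ∀ i j, x i - x j ≤ C) :
    apartmentNorm x ≤ Real.sqrt n * C := by
  rcases Nat.eq_zero_or_pos n with rfl | hn
  · simp [apartmentNorm]
  have hn' : (0 : ℝ) < n := by exact_mod_cast hn
  have hC : 0 ≤ C := by simpa using h ⟨0, hn⟩ ⟨0, hn⟩
  have hle : ∀ i, |x i - (∑ j, x j) / n| ≤ C := fun i => by
    rw [abs_le, neg_le_sub_iff_le_add, sub_le_comm, le_div_iff₀ hn']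
    constructor
    · have : ∑ j, x j ≤ ∑ _j : Fin n, (x i + C) :=
        Finset.sum_le_sum fun j _ => by linarith [h j i]
      rw [Finset.sum_const, Finset.card_univ, Fintype.card_fin, nsmul_eq_mul] at this
      rw [div_le_iff₀ hn']
      linarith
    · have : ∑ _j : Fin n, (x i - C) ≤ ∑ j, x j :=
        Finset.sum_le_sum fun j _ => by linarith [h i j]
      rw [Finset.sum_const, Finset.card_univ, Fintype.card_fin, nsmul_eq_mul] at this
      linarith
  unfold apartmentNorm
  calc _ ≤ Real.sqrt (∑ _i : Fin n, C ^ 2) :=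
        Real.sqrt_le_sqrt (Finset.sum_le_sum fun i _ => sq_le_sq' (abs_le.1 (hle i)).1
          (abs_le.1 (hle i)).2)
    _ = _ := by
      rw [Finset.sum_const, Finset.card_univ, Fintype.card_fin, nsmul_eq_mul,
        Real.sqrt_mul hn'.le, Real.sqrt_sq hC]

end ApartmentNorm

/-! ### Independence of the distance from the apartment -/

section Dist
variable {R : Type u} [CommRing R] [IsDomain R] [IsDiscreteValuationRing R]
  [Finite (IsLocalRing.ResidueField R)]
  {K : Type u} [Field K] [Algebra R K] [IsFractionRing R K]
  {V : Type u} [AddCommGroup V] [Module K V]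

variable (R) in
-- By the ultrametric inequality the Leibniz sum is bounded by its largest term.
theorem exists_absVal_det_le {ι : Type*} [Fintype ι] [DecidableEq ι] (A : Matrix ι ι K) :
    ∃ σ : Equiv.Perm ι, absVal R K A.det ≤ ∏ i, absVal R K (A (σ i) i) := by
  obtain ⟨σ, hσ⟩ := Finite.exists_max fun σ : Equiv.Perm ι => ∏ i, absVal R K (A (σ i) i)
  refine ⟨σ, ?_⟩
  have key : ∀ s : Finset (Equiv.Perm ι), absVal R K
      (∑ τ ∈ s, Equiv.Perm.sign τ • ∏ i, A (τ i) i) ≤ ∏ i, absVal R K (A (σ i) i) := by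
    intro s
    induction s using Finset.induction_on with
    | empty => simpa using Finset.prod_nonneg fun i _ => (absVal R K).nonneg _
    | insert τ s hτ ih =>
      rw [Finset.sum_insert hτ]
      refine (absVal_add_le R _ _).trans (max_le (le_trans (le_of_eq ?_) (hσ τ)) ih)
      rcases Int.units_eq_one_or (Equiv.Perm.sign τ) with h | h <;> simp [h, map_prod]
  rw [Matrix.det_apply]
  exact key _

/-- The vectors of two orthogonal bases correspond to each other up to scalars, in a way that does
not depend on the norm. -/
theorem exists_perm_of_isOrthogonal {ι : Type*} [Fintype ι] (e e' : Module.Basis ι K V) :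
    ∃ σ : Equiv.Perm ι, ∀ α : V → ℝ, IsUltranorm R K α → IsOrthogonal R α e →
      IsOrthogonal R α e' → ∀ i, α (e' i) = absVal R K (e.repr (e' i) (σ i)) * α (e (σ i)) := by
  classical
  obtain ⟨σ, hσ⟩ := exists_absVal_det_le R (e.toMatrix e')
  obtain ⟨τ, hτ⟩ := exists_absVal_det_le R (e'.toMatrix e)
  refine ⟨σ, fun α hα he he' => ?_⟩
  -- The two base change determinants are inverse to each other, so the Leibniz bounds for both give
  -- `h3`, the reverse of the product of the inequalities `h1`. Hence none of the `h1` is strict.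
  -- Note that `σ` was chosen before `α`.
  have hdet : absVal R K (e.toMatrix e').det * absVal R K (e'.toMatrix e).det = 1 := by
    rw [← map_mul, ← Matrix.det_mul, Module.Basis.toMatrix_mul_toMatrix_flip, Matrix.det_one,
      map_one]
  have hpos : ∀ f : Module.Basis ι K V, 0 < ∏ i, α (f i) :=
    fun f => Finset.prod_pos fun i _ => hα.basis_pos f i
  have h1 : ∀ i, absVal R K (e.repr (e' i) (σ i)) * α (e (σ i)) ≤ α (e' i) := fun i => he _ _
  have h2 : absVal R K (e'.toMatrix e).det * ∏ i, α (e' i) ≤ ∏ i, α (e i) := by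
    calc _ ≤ (∏ i, absVal R K (e'.toMatrix e (τ i) i)) * ∏ i, α (e' i) :=
          mul_le_mul_of_nonneg_right hτ (hpos e').le
      _ = ∏ i, (absVal R K (e'.repr (e i) (τ i)) * α (e' (τ i))) := by
          rw [Finset.prod_mul_distrib, Equiv.prod_comp τ fun i => α (e' i)]
          rfl
      _ ≤ _ := Finset.prod_le_prod
          (fun i _ => mul_nonneg ((absVal R K).nonneg _) (hα.nonneg _)) fun i _ => he' _ _
  have h3 : ∏ i, α (e' i) ≤ ∏ i, (absVal R K (e.repr (e' i) (σ i)) * α (e (σ i))) := by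
    calc ∏ i, α (e' i) = absVal R K (e.toMatrix e').det *
          (absVal R K (e'.toMatrix e).det * ∏ i, α (e' i)) := by rw [← mul_assoc, hdet, one_mul]
      _ ≤ absVal R K (e.toMatrix e').det * ∏ i, α (e i) :=
          mul_le_mul_of_nonneg_left h2 ((absVal R K).nonneg _)
      _ ≤ (∏ i, absVal R K (e.toMatrix e' (σ i) i)) * ∏ i, α (e i) :=
          mul_le_mul_of_nonneg_right hσ (hpos e).le
      _ = _ := by
          rw [Finset.prod_mul_distrib, Equiv.prod_comp σ fun i => α (e i)]
          rfl
  have hnn : ∀ i, 0 ≤ absVal R K (e.repr (e' i) (σ i)) * α (e (σ i)) :=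
    fun i => mul_nonneg ((absVal R K).nonneg _) (hα.nonneg _)
  have hp : ∀ i, 0 < absVal R K (e.repr (e' i) (σ i)) * α (e (σ i)) := fun i =>
    (hnn i).lt_of_ne fun h0 => ((hpos e').trans_le h3).ne'
      (Finset.prod_eq_zero (Finset.mem_univ i) h0.symm)
  intro i
  by_contra hne
  exact (Finset.prod_lt_prod (fun i _ => hp i) (fun i _ => h1 i)
    ⟨i, Finset.mem_univ i, (h1 i).lt_of_ne (Ne.symm hne)⟩).not_ge h3

/-- The distance of two points can be computed in any apartment which contains them. -/
theorem Building.dist_mk (α β : SplitNorm R K V) (e : Module.Basis (Fin (Module.finrank K V)) K V)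
    (hα : IsOrthogonal R α.toFun e) (hβ : IsOrthogonal R β.toFun e) :
    (Building.mk α).dist (Building.mk β) = apartmentNorm fun i =>
      Real.logb (residueCard R) (α.toFun (e i)) - Real.logb (residueCard R) (β.toFun (e i)) := by
  have hset : {r | ∃ α' β' : SplitNorm R K V, Building.mk α = .mk α' ∧ Building.mk β = .mk β' ∧
      ∃ e : Module.Basis (Fin (Module.finrank K V)) K V,
        IsSplitBy R α'.toFun e ∧ IsSplitBy R β'.toFun e ∧
        r = apartmentNorm fun i => Real.logb (residueCard R) (α'.toFun (e i)) -
          Real.logb (residueCard R) (β'.toFun (e i))} = {apartmentNorm fun i =>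
      Real.logb (residueCard R) (α.toFun (e i)) - Real.logb (residueCard R) (β.toFun (e i))} := by
    ext r
    constructor
    · rintro ⟨α', β', hα', hβ', e', he1, he2, rfl⟩
      obtain ⟨c, hc, hc'⟩ := Building.mk_eq_mk.1 hα'.symm
      obtain ⟨d, hd, hd'⟩ := Building.mk_eq_mk.1 hβ'.symm
      obtain ⟨σ, hσ⟩ := exists_perm_of_isOrthogonal (R := R) e e'
      have h1 := hσ α'.toFun α'.isUltranorm
      have h2 := hσ β'.toFun β'.isUltranorm
      have hαe : IsOrthogonal R α'.toFun e := fun v i => by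
        have := hα v i
        rw [hc', hc', mul_left_comm] at this
        exact le_of_mul_le_mul_left this hc
      have hβe : IsOrthogonal R β'.toFun e := fun v i => by
        have := hβ v i
        rw [hd', hd', mul_left_comm] at this
        exact le_of_mul_le_mul_left this hd
      have h1 := h1 hαe (isSplitBy_iff.1 he1).2
      have h2 := h2 hβe (isSplitBy_iff.1 he2).2
      -- Passing from `e` to `e'` multiplies the weights of both norms by the same factors, up to
      -- the permutation `σ`, and these cancel in the difference of logarithms. The homothety
      -- constants `c` and `d` only add a constant, which `apartmentNorm` ignores.
      rw [Set.mem_singleton_iff, ← apartmentNorm_perm (fun i => Real.logb (residueCard R)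
          (α.toFun (e i)) - Real.logb (residueCard R) (β.toFun (e i))) σ,
        ← apartmentNorm_add_const (fun i => Real.logb (residueCard R) (α'.toFun (e' i)) -
          Real.logb (residueCard R) (β'.toFun (e' i))) (Real.logb (residueCard R) c - Real.logb (residueCard R) d)]
      congr 1
      ext i
      have ha := α'.isUltranorm.basis_pos e (σ i)
      have hb := β'.isUltranorm.basis_pos e (σ i)
      have hg : absVal R K (e.repr (e' i) (σ i)) ≠ 0 := fun h0 => by
        have := h1 i
        rw [h0, zero_mul] at this
        exact (α'.isUltranorm.basis_pos e' i).ne' this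
      rw [h1, h2, hc', hd', Real.logb_mul hg ha.ne', Real.logb_mul hg hb.ne',
        Real.logb_mul hc.ne' ha.ne', Real.logb_mul hd.ne' hb.ne']
      ring
    · rintro rfl
      exact ⟨α, β, rfl, rfl, e, isSplitBy_iff.2 ⟨α.isUltranorm, hα⟩,
        isSplitBy_iff.2 ⟨β.isUltranorm, hβ⟩, rfl⟩
  rw [Building.dist, hset, csInf_singleton]

theorem SplitNorm.exists_common [FiniteDimensional K V] (α β : SplitNorm R K V) :
    ∃ e : Module.Basis (Fin (Module.finrank K V)) K V,
      IsOrthogonal R α.toFun e ∧ IsOrthogonal R β.toFun e :=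
  α.isTame.exists_common β.isTame rfl

/-! ### Comparison of norms up to homothety -/

/-- The logarithm of the least such `B ≥ 1` is a metric on the set of homothety classes. -/
def RatioLE {X : Type u} (α β : X → ℝ) (B : ℝ) : Prop :=
  ∀ v w, β v * α w ≤ B * (α v * β w)

theorem RatioLE.mono {α β : V → ℝ} {B C : ℝ} (hα : IsUltranorm R K α) (hβ : IsUltranorm R K β)
    (h : RatioLE α β B) (hBC : B ≤ C) : RatioLE α β C := fun v w =>
  (h v w).trans (mul_le_mul_of_nonneg_right hBC (mul_nonneg (hα.nonneg v) (hβ.nonneg w)))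

/-- The vectors `v` and `w` are expanded in different bases: `α v` has to be bounded below, and `e`
is orthogonal for `α`; likewise for `β w` and `f`. That no common orthogonal basis is required is
essential for `IsInterp.ratioLE`. -/
theorem ratioLE_of_basis {ι : Type*} [Fintype ι] {α β : V → ℝ} (hα : IsUltranorm R K α)
    (hβ : IsUltranorm R K β) {e f : Module.Basis ι K V} (he : IsOrthogonal R α e)
    (hf : IsOrthogonal R β f) {B : ℝ}
    (h : ∀ i j, β (e i) * α (f j) ≤ B * (α (e i) * β (f j))) : RatioLE α β B := fun v w => by
  by_cases hv : v = 0
  · simp [hv, hα.map_zero, hβ.map_zero]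
  by_cases hw : w = 0
  · simp [hw, hα.map_zero, hβ.map_zero]
  obtain ⟨i, hi, hi'⟩ := hβ.exists_le_of_ne_zero e hv
  obtain ⟨j, hj, hj'⟩ := hα.exists_le_of_ne_zero f hw
  have hai := (absVal R K).pos hi
  have haj := (absVal R K).pos hj
  have hB : 0 < B := by
    have h1 := (mul_pos (hβ.basis_pos e i) (hα.basis_pos f j)).trans_le (h i j)
    exact pos_of_mul_pos_left h1 (mul_nonneg (hα.nonneg _) (hβ.nonneg _))
  calc β v * α w ≤ (absVal R K (e.repr v i) * β (e i)) * (absVal R K (f.repr w j) * α (f j)) :=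
        mul_le_mul hi' hj' (hα.nonneg _) (mul_nonneg hai.le (hβ.nonneg _))
    _ = absVal R K (e.repr v i) * absVal R K (f.repr w j) * (β (e i) * α (f j)) := by ring
    _ ≤ absVal R K (e.repr v i) * absVal R K (f.repr w j) * (B * (α (e i) * β (f j))) :=
        mul_le_mul_of_nonneg_left (h i j) (mul_pos hai haj).le
    _ = B * ((absVal R K (e.repr v i) * α (e i)) * (absVal R K (f.repr w j) * β (f j))) := by ring
    _ ≤ _ := mul_le_mul_of_nonneg_left (mul_le_mul (he v i) (hf w j)
        (mul_nonneg haj.le (hβ.nonneg _)) (hα.nonneg _)) hB.le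

theorem logb_sub_add_le {q a b c d B : ℝ} (hq : 1 < q) (ha : 0 < a) (hb : 0 < b) (hc : 0 < c)
    (hd : 0 < d) : (Real.logb q a - Real.logb q b) - (Real.logb q c - Real.logb q d) ≤ B ↔
    a * d ≤ q ^ B * (b * c) := by
  have hq0 := one_pos.trans hq
  rw [← Real.logb_le_logb hq (mul_pos ha hd) (by positivity), Real.logb_mul ha.ne' hd.ne',
    Real.logb_mul (Real.rpow_pos_of_pos hq0 _).ne' (mul_pos hb hc).ne',
    Real.logb_mul hb.ne' hc.ne', Real.logb_rpow hq0 hq.ne']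
  constructor <;> intro h <;> linarith

/-- Together with `dist_le_of_ratioLE`, this makes the distance and the logarithm of the ratio bound
equivalent up to constant factors, which suffices for asymptotic statements. -/
theorem ratioLE_of_dist_le [FiniteDimensional K V] {α β : SplitNorm R K V} {C : ℝ}
    (h : (Building.mk α).dist (.mk β) ≤ C) :
    RatioLE α.toFun β.toFun ((residueCard R : ℝ) ^ (2 * C)) := by
  obtain ⟨e, hα, hβ⟩ := α.exists_common β
  rw [Building.dist_mk α β e hα hβ] at h
  refine ratioLE_of_basis α.isUltranorm β.isUltranorm hα hβ fun i j => ?_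
  have := sub_le_two_mul_apartmentNorm (fun i => Real.logb (residueCard R) (α.toFun (e i)) -
    Real.logb (residueCard R) (β.toFun (e i))) j i
  rw [mul_comm (β.toFun (e i)), mul_comm (α.toFun (e i)),
    ← logb_sub_add_le (one_lt_residueCard_real R) (α.isUltranorm.basis_pos e j)
    (β.isUltranorm.basis_pos e j) (α.isUltranorm.basis_pos e i) (β.isUltranorm.basis_pos e i)]
  exact this.trans (by linarith)

theorem dist_le_of_ratioLE [FiniteDimensional K V] {α β : SplitNorm R K V} {C : ℝ}
    (h : RatioLE α.toFun β.toFun ((residueCard R : ℝ) ^ C)) :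
    (Building.mk α).dist (.mk β) ≤ Real.sqrt (Module.finrank K V) * C := by
  obtain ⟨e, hα, hβ⟩ := α.exists_common β
  rw [Building.dist_mk α β e hα hβ]
  refine apartmentNorm_le_of_sub_le fun i j => ?_
  rw [logb_sub_add_le (one_lt_residueCard_real R) (α.isUltranorm.basis_pos e i)
    (β.isUltranorm.basis_pos e i) (α.isUltranorm.basis_pos e j) (β.isUltranorm.basis_pos e j)]
  have := h (e j) (e i)
  rwa [mul_comm (β.toFun (e j)), mul_comm (α.toFun (e j))] at this

theorem mk_eq_mk_of_ratioLE [FiniteDimensional K V] [Nontrivial V] {α β : SplitNorm R K V}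
    (h : ∀ B > 1, RatioLE α.toFun β.toFun B) : Building.mk α = .mk β := by
  obtain ⟨v₀, hv₀⟩ := exists_ne (0 : V)
  have ha := α.isUltranorm.pos v₀ hv₀
  have hb := β.isUltranorm.pos v₀ hv₀
  have h1 : ∀ v w, β.toFun v * α.toFun w ≤ α.toFun v * β.toFun w := fun v w => by
    refine le_of_forall_gt_imp_ge_of_dense fun c hc => ?_
    have hnn := mul_nonneg (α.isUltranorm.nonneg v) (β.isUltranorm.nonneg w)
    rcases hnn.eq_or_lt with h0 | h0
    · have := h 2 (by norm_num) v w
      rw [← h0, mul_zero] at this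
      exact this.trans (hnn.trans hc.le)
    · have := h (c / (α.toFun v * β.toFun w)) ((one_lt_div h0).2 hc) v w
      rwa [div_mul_cancel₀ _ h0.ne'] at this
  refine Building.mk_eq_mk.2 ⟨β.toFun v₀ / α.toFun v₀, div_pos hb ha, fun v => ?_⟩
  rw [div_mul_eq_mul_div, eq_div_iff ha.ne']
  linarith [h1 v v₀, h1 v₀ v, mul_comm (α.toFun v) (β.toFun v₀), mul_comm (α.toFun v₀) (β.toFun v)]

end Dist

/-! ### Segments as weighted geometric means of norms -/

section Interpolation
variable {R : Type u} [CommRing R] [IsDomain R] [IsDiscreteValuationRing R]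
  [Finite (IsLocalRing.ResidueField R)]
  {K : Type u} [Field K] [Algebra R K] [IsFractionRing R K]
  {V : Type u} [AddCommGroup V] [Module K V]

variable (R) in
/-- The norm with given weights on a basis. -/
noncomputable def weightNorm (e : Module.Basis (Fin (Module.finrank K V)) K V)
    (w : Fin (Module.finrank K V) → ℝ) (hw : ∀ i, 0 < w i) : SplitNorm R K V where
  toFun v := ⨆ i, absVal R K (e.repr v i) * w i
  exists_isSplitBy := by
    have h : ∀ j, ⨆ i, absVal R K (e.repr (e j) i) * w i = w j := fun j => by
      refine le_antisymm (Real.iSup_le (fun i => ?_) (hw j).le) ?_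
      · rw [e.repr_self, Finsupp.single_apply]
        split_ifs with hij
        · simp [hij]
        · simpa using (hw j).le
      · refine le_trans (le_of_eq ?_) (le_ciSup (f := fun i => absVal R K (e.repr (e j) i) * w i)
          (Set.finite_range _).bddAbove j)
        simp
    exact ⟨e, fun i => (hw i).trans_eq (h i).symm, fun v => by simp only [h]⟩

theorem weightNorm_basis (e : Module.Basis (Fin (Module.finrank K V)) K V)
    (w : Fin (Module.finrank K V) → ℝ) (hw : ∀ i, 0 < w i) (j) :
    (weightNorm R e w hw).toFun (e j) = w j := by
  refine le_antisymm (Real.iSup_le (fun i => ?_) (hw j).le) ?_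
  · rw [e.repr_self, Finsupp.single_apply]
    split_ifs with hij
    · simp [hij]
    · simpa using (hw j).le
  · refine le_trans (le_of_eq ?_) (le_ciSup (f := fun i => absVal R K (e.repr (e j) i) * w i)
      (Set.finite_range _).bddAbove j)
    simp

theorem isOrthogonal_weightNorm (e : Module.Basis (Fin (Module.finrank K V)) K V)
    (w : Fin (Module.finrank K V) → ℝ) (hw : ∀ i, 0 < w i) :
    IsOrthogonal R (weightNorm R e w hw).toFun e := fun v i => by
  rw [weightNorm_basis]
  exact le_ciSup (f := fun i => absVal R K (e.repr v i) * w i) (Set.finite_range _).bddAbove i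

variable (R K) in
/-- `z` is the point which divides the segment from `x` to `y` in the ratio `s : (1 - s)`, up to the
factor `k`. -/
def IsInterp (x y : V → ℝ) (s k : ℝ) (z : V → ℝ) : Prop :=
  ∃ e : Module.Basis (Fin (Module.finrank K V)) K V, IsOrthogonal R x e ∧ IsOrthogonal R y e ∧
    IsOrthogonal R z e ∧ ∀ i, z (e i) = k * (x (e i) ^ (1 - s) * y (e i) ^ s)

variable {x y z y' z' : V → ℝ} {s k l : ℝ}

/-- Weighted geometric means are compatible with orthogonal expansions, so the formula that defines
`z` on the basis survives as an inequality on all of `V`. -/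
theorem IsInterp.le (hx : IsUltranorm R K x) (hy : IsUltranorm R K y) (hz : IsUltranorm R K z)
    (hk : 0 < k) (hs0 : 0 ≤ s) (hs1 : s ≤ 1) (h : IsInterp R K x y s k z) (v : V) :
    z v ≤ k * (x v ^ (1 - s) * y v ^ s) := by
  obtain ⟨e, hxe, hye, -, he⟩ := h
  have hs1' : 0 ≤ 1 - s := sub_nonneg.2 hs1
  refine hz.le_of_repr e v (mul_nonneg hk.le (mul_nonneg (Real.rpow_nonneg (hx.nonneg v) _)
    (Real.rpow_nonneg (hy.nonneg v) _))) fun i => ?_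
  set c := absVal R K (e.repr v i)
  have hc : 0 ≤ c := (absVal R K).nonneg _
  have h1 : c = c ^ (1 - s) * c ^ s := by
    rw [← Real.rpow_add_of_nonneg hc hs1' hs0, sub_add_cancel, Real.rpow_one]
  calc c * z (e i) = k * ((c ^ (1 - s) * x (e i) ^ (1 - s)) * (c ^ s * y (e i) ^ s)) := by
        rw [he]
        conv_lhs => rw [h1]
        ring
    _ = k * ((c * x (e i)) ^ (1 - s) * (c * y (e i)) ^ s) := by
        rw [Real.mul_rpow hc (hx.nonneg _), Real.mul_rpow hc (hy.nonneg _)]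
    _ ≤ _ := by
        refine mul_le_mul_of_nonneg_left (mul_le_mul
          (Real.rpow_le_rpow (mul_nonneg hc (hx.nonneg _)) (hxe v i) hs1')
          (Real.rpow_le_rpow (mul_nonneg hc (hy.nonneg _)) (hye v i) hs0)
          (Real.rpow_nonneg (mul_nonneg hc (hy.nonneg _)) _)
          (Real.rpow_nonneg (hx.nonneg _) _)) hk.le

/-- Segments which start at the same point converge at most linearly. -/
theorem IsInterp.ratioLE (hx : IsUltranorm R K x) (hy : IsUltranorm R K y)
    (hz : IsUltranorm R K z) (hy' : IsUltranorm R K y') (hz' : IsUltranorm R K z')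
    (hk : 0 < k) (hl : 0 < l) (hs0 : 0 ≤ s) (hs1 : s ≤ 1) (h : IsInterp R K x y s k y')
    (h' : IsInterp R K x z s l z') {B : ℝ} (hB : 0 ≤ B) (hyz : RatioLE y z B) :
    RatioLE y' z' (B ^ s) := by
  have hle := h.le hx hy hy' hk hs0 hs1
  have hle' := h'.le hx hz hz' hl hs0 hs1
  obtain ⟨e, -, -, hye, he⟩ := h
  obtain ⟨f, -, -, hzf, hf⟩ := h'
  refine ratioLE_of_basis hy' hz' hye hzf fun i j => ?_
  have nx := hx.nonneg
  have ny := hy.nonneg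
  have nz := hz.nonneg
  -- On its own basis each interpolated norm is given by the exact formula; on the basis of the
  -- other segment `IsInterp.le` bounds it above. The powers of `x` cancel, and the ratio of `y` and
  -- `z` remains, raised to the power `s`.
  calc z' (e i) * y' (f j) ≤ (l * (x (e i) ^ (1 - s) * z (e i) ^ s)) *
        (k * (x (f j) ^ (1 - s) * y (f j) ^ s)) :=
        mul_le_mul (hle' _) (hle _) (hy'.nonneg _) (mul_nonneg hl.le
          (mul_nonneg (Real.rpow_nonneg (nx _) _) (Real.rpow_nonneg (nz _) _)))
    _ = (k * l * (x (e i) ^ (1 - s) * x (f j) ^ (1 - s))) * (z (e i) * y (f j)) ^ s := by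
        rw [Real.mul_rpow (nz _) (ny _)]
        ring
    _ ≤ (k * l * (x (e i) ^ (1 - s) * x (f j) ^ (1 - s))) * (B * (y (e i) * z (f j))) ^ s :=
        mul_le_mul_of_nonneg_left (Real.rpow_le_rpow (mul_nonneg (nz _) (ny _)) (hyz _ _) hs0)
          (mul_nonneg (mul_nonneg hk.le hl.le)
            (mul_nonneg (Real.rpow_nonneg (nx _) _) (Real.rpow_nonneg (nx _) _)))
    _ = _ := by
        rw [Real.mul_rpow hB (mul_nonneg (ny _) (nz _)), Real.mul_rpow (ny _) (nz _), he, hf]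
        ring

theorem RatioLE.refl {X : Type u} (x : X → ℝ) : RatioLE x x 1 := fun v w => by rw [one_mul]

theorem eq_const_mul_of_ratioLE_one [Nontrivial V] (hx : IsUltranorm R K x)
    (hy : IsUltranorm R K y) (h : RatioLE x y 1) : ∃ c, 0 < c ∧ ∀ v, y v = c * x v := by
  obtain ⟨v₀, hv₀⟩ := exists_ne (0 : V)
  refine ⟨y v₀ / x v₀, div_pos (hy.pos _ hv₀) (hx.pos _ hv₀), fun v => ?_⟩
  rw [div_mul_eq_mul_div, eq_div_iff (hx.pos _ hv₀).ne']
  have h1 := h v v₀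
  have h2 := h v₀ v
  linarith [mul_comm (x v) (y v₀), mul_comm (x v₀) (y v)]

/-- The inner point is rebuilt as `γ` in the basis `f` of the long segment. Both `γ` and `y'` divide
the segment from `x` to `y` in the same ratio, so `IsInterp.ratioLE` with `B = 1` makes them
homothetic. -/
theorem IsInterp.trans [Nontrivial V] {s s' k' : ℝ} (hx : IsUltranorm R K x)
    (hy : IsUltranorm R K y) (hz : IsUltranorm R K z) (hy' : IsUltranorm R K y')
    (hk : 0 < k) (hk' : 0 < k') (hs0 : 0 ≤ s) (hs1 : s ≤ 1)
    (h : IsInterp R K x y s k y') (h' : IsInterp R K x z s' k' y) :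
    ∃ k'', 0 < k'' ∧ IsInterp R K x z (s' * s) k'' y' := by
  obtain ⟨f, hxf, hzf, hyf, hf⟩ := h'
  let w := fun i => x (f i) ^ (1 - s) * y (f i) ^ s
  have hw : ∀ i, 0 < w i := fun i => mul_pos (Real.rpow_pos_of_pos (hx.basis_pos f i) _)
    (Real.rpow_pos_of_pos (hy.basis_pos f i) _)
  set γ := weightNorm R f w hw
  have hγ : IsInterp R K x y s 1 γ.toFun := ⟨f, hxf, hyf, isOrthogonal_weightNorm f w hw,
    fun i => by rw [one_mul, weightNorm_basis]⟩
  have hr := IsInterp.ratioLE hx hy hy γ.isUltranorm hy' one_pos hk hs0 hs1 hγ h one_pos.le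
    (RatioLE.refl y)
  rw [Real.one_rpow] at hr
  obtain ⟨c, hc, hc'⟩ := eq_const_mul_of_ratioLE_one γ.isUltranorm hy' hr
  refine ⟨c * k' ^ s, mul_pos hc (Real.rpow_pos_of_pos hk' _), f, hxf, hzf, ?_, fun i => ?_⟩
  · rw [show y' = fun v => c * γ.toFun v from funext hc']
    exact (isOrthogonal_weightNorm f w hw).const_mul hc
  · have hxi := hx.basis_pos f i
    have hzi := hz.basis_pos f i
    rw [hc', weightNorm_basis]
    simp only [w]
    rw [hf, Real.mul_rpow hk'.le (by positivity), Real.mul_rpow (by positivity) (by positivity),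
      ← Real.rpow_mul hxi.le, ← Real.rpow_mul hzi.le]
    have : x (f i) ^ (1 - s' * s) = x (f i) ^ (1 - s) * x (f i) ^ ((1 - s') * s) := by
      rw [← Real.rpow_add hxi]
      ring_nf
    rw [this]
    ring

/-- Equality in the Euclidean triangle inequality puts the two projected differences on one ray; `c`
is the diagonal component that the projection forgets. -/
theorem interp_of_apartmentNorm {n : ℕ} {p₀ p₁ p₂ : Fin n → ℝ} {t u : ℝ} (hu : 0 < u)
    (h₁ : apartmentNorm (p₀ - p₁) = t) (h₂ : apartmentNorm (p₁ - p₂) = u - t)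
    (h₃ : apartmentNorm (p₀ - p₂) = u) :
    ∃ c, ∀ i, p₁ i = c + ((1 - t / u) * p₀ i + t / u * p₂ i) := by
  have h : SameRay ℝ (diagProj (p₀ - p₁)) (diagProj (p₁ - p₂)) := by
    rw [sameRay_iff_norm_add, ← diagProj_add, sub_add_sub_cancel]
    simp only [norm_diagProj, h₁, h₂, h₃]
    ring
  have h' := h.norm_smul_eq
  rw [norm_diagProj, norm_diagProj, h₁, h₂] at h'
  refine ⟨(t * ((∑ j, (p₁ - p₂) j) / n) - (u - t) * ((∑ j, (p₀ - p₁) j) / n)) / u, fun i => ?_⟩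
  have hi := congrArg (fun f => f i) h'
  simp only [PiLp.smul_apply, diagProj, smul_eq_mul, Pi.sub_apply] at hi
  simp only [Pi.sub_apply]
  generalize (∑ x, (p₁ x - p₂ x)) / (n : ℝ) = A at hi ⊢
  generalize (∑ x, (p₀ x - p₁ x)) / (n : ℝ) = B at hi ⊢
  field_simp
  linarith

/-- The quotients `β w / β v` above `1` form a discrete set, so they have a least element if there
are any. The gap makes orthogonality stable under small changes of the norm. -/
theorem IsTame.exists_gap {β : V → ℝ} (hβ : IsTame R K β) :
    ∃ G, 1 < G ∧ ∀ v w, β v < β w → G * β v ≤ β w := by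
  set s := (fun p : V × V => β p.2 / β p.1) '' {p | p.1 ≠ 0 ∧ p.2 ≠ 0 ∧ β p.1 < β p.2}
  have hs : IsLogDiscrete (residueCard R) s :=
    (hβ.discrete.div (residueCard_pos R) hβ.discrete).mono (by
      rintro _ ⟨p, ⟨h1, h2, -⟩, rfl⟩
      exact ⟨_, ⟨p.2, h2, rfl⟩, _, ⟨p.1, h1, rfl⟩, rfl⟩)
  have h1 : ∀ x ∈ s, 1 < x := by
    rintro _ ⟨p, ⟨h1, -, h2⟩, rfl⟩
    exact (one_lt_div (hβ.pos _ h1)).2 h2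
  have key : ∀ G, (∀ x ∈ s, G ≤ x) → ∀ v w, β v < β w → G * β v ≤ β w := fun G hG v w hvw => by
    by_cases hv : v = 0
    · rw [hv, hβ.map_zero, mul_zero]
      exact hβ.nonneg w
    · have hw : w ≠ 0 := fun hw => by
        rw [hw, hβ.map_zero] at hvw
        exact (hβ.nonneg v).not_gt hvw
      exact (le_div_iff₀ (hβ.pos v hv)).1 (hG _ ⟨(v, w), ⟨hv, hw, hvw⟩, rfl⟩)
  rcases s.eq_empty_or_nonempty with h0 | hne
  · exact ⟨2, by norm_num, key 2 (by simp [h0])⟩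
  · obtain ⟨G, hG, hmin⟩ := hs.exists_min (one_lt_residueCard_real R) hne one_pos
      fun x hx => (h1 x hx).le
    exact ⟨G, h1 G hG, key G hmin⟩

/-- A basis which is orthogonal for a norm close to `β` is orthogonal for `β`. -/
theorem IsOrthogonal.of_ratioLE {ι : Type*} {β β' : V → ℝ} (hβ : IsUltranorm R K β)
    (hβ' : IsUltranorm R K β') {G B : ℝ} (hG : ∀ v w, β v < β w → G * β v ≤ β w)
    (h : RatioLE β β' B) (hB : B < G) {e : Module.Basis ι K V} (he : IsOrthogonal R β' e) :
    IsOrthogonal R β e := by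
  intro v i
  by_contra! hlt
  have h1 := he v i
  rw [← hβ.smul] at hlt
  rw [← hβ'.smul] at h1
  set w := e.repr v i • e i
  have hv : v ≠ 0 := fun hv => by simp [hv, w, hβ.map_zero] at hlt
  have hv' := hβ'.pos v hv
  have hvp := hβ.pos v hv
  have h2 := hG _ _ hlt
  have hw' : 0 < β' w := hβ'.pos w fun hw => by
    rw [hw, hβ.map_zero] at hlt
    exact (hβ.nonneg v).not_gt hlt
  have h3 := h v w
  have hBpos : 0 < B := by
    have : 0 < β' v * β w := mul_pos hv' (hvp.trans hlt)
    exact pos_of_mul_pos_left (this.trans_le h3) (mul_pos hvp hw').le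
  -- Orthogonality for `β'` turns the ratio bound into `β w ≤ B β v`, which contradicts the gap `G β
  -- v ≤ β w`.
  have h4 : β' v * β w ≤ β' v * (B * β v) := h3.trans (by
    calc B * (β v * β' w) ≤ B * (β v * β' v) := by gcongr
      _ = _ := by ring)
  have h5 := le_of_mul_le_mul_left h4 hv'
  nlinarith

end Interpolation

/-! ### Straightness of half-geodesics and uniqueness in an asymptotic class -/

section Straight
variable {R : Type u} [CommRing R] [IsDomain R] [IsDiscreteValuationRing R]
  [Finite (IsLocalRing.ResidueField R)]
  {K : Type u} [Field K] [Algebra R K] [IsFractionRing R K]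
  {V : Type u} [AddCommGroup V] [Module K V]

theorem interp_of_dist {α₀ α₁ α₂ : SplitNorm R K V}
    {e : Module.Basis (Fin (Module.finrank K V)) K V} (h₀ : IsOrthogonal R α₀.toFun e)
    (h₁ : IsOrthogonal R α₁.toFun e) (h₂ : IsOrthogonal R α₂.toFun e) {t u : ℝ}
    (hu : 0 < u) (d₁ : (Building.mk α₀).dist (.mk α₁) = t)
    (d₂ : (Building.mk α₁).dist (.mk α₂) = u - t) (d₃ : (Building.mk α₀).dist (.mk α₂) = u) :
    ∃ k, 0 < k ∧ IsInterp R K α₀.toFun α₂.toFun (t / u) k α₁.toFun := by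
  rw [Building.dist_mk _ _ e h₀ h₁] at d₁
  rw [Building.dist_mk _ _ e h₁ h₂] at d₂
  rw [Building.dist_mk _ _ e h₀ h₂] at d₃
  have hq := one_lt_residueCard_real R
  have hq0 := residueCard_pos R
  obtain ⟨c, hc⟩ := interp_of_apartmentNorm
    (p₀ := fun i => Real.logb (residueCard R) (α₀.toFun (e i)))
    (p₁ := fun i => Real.logb (residueCard R) (α₁.toFun (e i)))
    (p₂ := fun i => Real.logb (residueCard R) (α₂.toFun (e i))) hu d₁ d₂ d₃
  refine ⟨(residueCard R : ℝ) ^ c, Real.rpow_pos_of_pos hq0 _, e, h₀, h₂, h₁, fun i => ?_⟩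
  have p0 := α₀.isUltranorm.basis_pos e i
  have p1 := α₁.isUltranorm.basis_pos e i
  have p2 := α₂.isUltranorm.basis_pos e i
  refine Real.logb_injOn_pos hq p1 ?_ ?_
  · exact mul_pos (Real.rpow_pos_of_pos hq0 _)
      (mul_pos (Real.rpow_pos_of_pos p0 _) (Real.rpow_pos_of_pos p2 _))
  · rw [hc, Real.logb_mul (Real.rpow_pos_of_pos hq0 _).ne' (mul_pos (Real.rpow_pos_of_pos p0 _)
      (Real.rpow_pos_of_pos p2 _)).ne', Real.logb_mul (Real.rpow_pos_of_pos p0 _).ne'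
      (Real.rpow_pos_of_pos p2 _).ne', Real.logb_rpow hq0 hq.ne', Real.logb_rpow_eq_mul_logb_of_pos
      p0, Real.logb_rpow_eq_mul_logb_of_pos p2]

/-- Continuous induction: the set of `u` such that `P t v` for all `v ∈ [t, u]` is closed and can be
prolonged at each of its points. Reflexivity of `P` is contained in `hloc`, with `u = T`. -/
theorem forall_rel_of_local {P : ℝ≥0 → ℝ≥0 → Prop}
    (htrans : ∀ t u v, t ≤ u → u ≤ v → P t u → P u v → P t v)
    (hloc : ∀ T : ℝ≥0, ∃ ε > 0, ∀ u : ℝ≥0, |(u : ℝ) - T| < ε →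
      (u ≤ T → P u T) ∧ (T ≤ u → P T u)) : ∀ t u, t ≤ u → P t u := by
  intro t b htb
  have key : b ∈ {u : ℝ≥0 | ∀ v, t ≤ v → v ≤ u → P t v} := by
    refine IsClosed.mem_of_ge_of_forall_exists_gt (a := t) ?_ ?_ htb ?_
    · rw [← isSeqClosed_iff_isClosed]
      intro f T hf hT
      obtain ⟨ε, hε, H⟩ := hloc T
      have htT : t ≤ T := ge_of_tendsto' hT fun n => (hf n).2.1
      refine ⟨fun v htv hvT => ?_, htT, le_of_tendsto' hT fun n => (hf n).2.2⟩
      by_cases hex : ∃ n, v ≤ f n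
      · obtain ⟨n, hn⟩ := hex
        exact (hf n).1 v htv hn
      · push Not at hex
        have hv : v = T := le_antisymm hvT (le_of_tendsto' hT fun n => (hex n).le)
        subst hv
        obtain ⟨n, hn⟩ := (Metric.tendsto_atTop.1 hT ε hε)
        have hn := hn n le_rfl
        rw [NNReal.dist_eq] at hn
        exact htrans _ _ _ (hf n).2.1 (hex n).le ((hf n).1 _ (hf n).2.1 le_rfl)
          ((H _ hn).1 (hex n).le)
    · intro v htv hvt
      obtain rfl := le_antisymm htv hvt
      obtain ⟨ε, hε, H⟩ := hloc t
      exact (H t (by simpa using hε)).1 le_rfl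
    · rintro x ⟨hx, htx, hxb⟩
      obtain ⟨ε, hε, H⟩ := hloc x
      lift ε to ℝ≥0 using hε.le
      have hε' : (0 : ℝ≥0) < ε := by exact_mod_cast hε
      refine ⟨min b (x + ε / 2), fun v htv hvy => ?_, ?_, min_le_left _ _⟩
      · rcases le_total v x with hvx | hxv
        · exact hx v htv hvx
        · refine htrans _ _ _ htx hxv (hx x htx le_rfl) ((H v ?_).2 hxv)
          have h1 : v ≤ x + ε / 2 := hvy.trans (min_le_right _ _)
          have h2 : (v : ℝ) ≤ x + ε / 2 := by exact_mod_cast h1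
          have h3 : (x : ℝ) ≤ v := by exact_mod_cast hxv
          rw [abs_of_nonneg (by linarith)]
          linarith
      · exact lt_min hxb (lt_add_of_pos_right _ (half_pos hε'))
  exact key b htb le_rfl

/-- Half-geodesics are straight. -/
theorem IsHalfGeodesic.isInterp [FiniteDimensional K V] [Nontrivial V]
    {c : ℝ≥0 → Building R K V} (hc : IsHalfGeodesic c) {α : ℝ≥0 → SplitNorm R K V}
    (hα : ∀ t, c t = .mk (α t)) : ∀ t u : ℝ≥0, t ≤ u →
      ∃ k, 0 < k ∧ IsInterp R K (α 0).toFun (α u).toFun (t / u) k (α t).toFun := by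
  have hq := one_lt_residueCard_real R
  have hd : ∀ s t : ℝ≥0, (Building.mk (α s)).dist (.mk (α t)) = |(s : ℝ) - t| := fun s t => by
    rw [← hα, ← hα]
    exact hc s t
  refine forall_rel_of_local ?_ ?_
  · rintro t u v htu huv ⟨k, hk, h⟩ ⟨l, hl, h'⟩
    have htu' : (t : ℝ) ≤ u := by exact_mod_cast htu
    obtain ⟨m, hm, h''⟩ := IsInterp.trans (α 0).isUltranorm (α u).isUltranorm (α v).isUltranorm
      (α t).isUltranorm hk hl (by positivity) (div_le_one_of_le₀ htu' u.2) h h'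
    refine ⟨m, hm, ?_⟩
    rcases eq_or_ne (u : ℝ) 0 with h0 | h0
    · have ht0 : (t : ℝ) = 0 := le_antisymm (htu'.trans h0.le) t.2
      simpa [h0, ht0] using h''
    · rwa [mul_comm, div_mul_div_cancel₀ h0] at h''
  · intro T
    obtain ⟨G, hG1, hG⟩ := (α T).isTame.exists_gap
    -- At distance less than `ε` the ratio bound is less than `q ^ (2 ε) = G`. Then a common
    -- orthogonal basis of `α 0` and `α u` is orthogonal for `α T` too, and the three points lie in
    -- one apartment.
    refine ⟨Real.logb (residueCard R) G / 2, half_pos (Real.logb_pos hq hG1), fun u hu => ?_⟩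
    obtain ⟨e, h0, hue⟩ := (α 0).exists_common (α u)
    have hTe : IsOrthogonal R (α T).toFun e := by
      refine hue.of_ratioLE (α T).isUltranorm (α u).isUltranorm hG
        (ratioLE_of_dist_le (hd T u).le) ?_
      rw [← Real.lt_logb_iff_rpow_lt hq (one_pos.trans hG1), abs_sub_comm]
      linarith
    have key : ∀ a b : ℝ≥0, a ≤ b → IsOrthogonal R (α a).toFun e → IsOrthogonal R (α b).toFun e →
        ∃ k, 0 < k ∧ IsInterp R K (α 0).toFun (α b).toFun (a / b) k (α a).toFun := by
      intro a b hab ha hb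
      have hab' : (a : ℝ) ≤ b := by exact_mod_cast hab
      -- For `b = 0` the ratio is `0 / 0 = 0`, and the interpolation is constant.
      rcases eq_or_ne b 0 with rfl | hb0
      · obtain rfl : a = 0 := le_antisymm hab zero_le
        refine ⟨1, one_pos, e, h0, h0, h0, fun i => ?_⟩
        simp
      · have hb' : (0 : ℝ) < b := by exact_mod_cast pos_iff_ne_zero.2 hb0
        refine interp_of_dist h0 ha hb hb' ?_ ?_ ?_
        · rw [hd, NNReal.coe_zero, zero_sub, abs_neg, NNReal.abs_eq]
        · rw [hd, abs_sub_comm, abs_of_nonneg (sub_nonneg.2 hab')]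
        · rw [hd, NNReal.coe_zero, zero_sub, abs_neg, NNReal.abs_eq]
    exact ⟨fun h => key _ _ h hue hTe, fun h => key _ _ h hTe hue⟩

/-- Asymptotic half-geodesics with the same origin coincide. -/
theorem IsHalfGeodesic.eq_of_asymptotic [FiniteDimensional K V] [Nontrivial V]
    {c c' : ℝ≥0 → Building R K V} (hc : IsHalfGeodesic c) (hc' : IsHalfGeodesic c')
    (h0 : c 0 = c' 0) (h : Asymptotic c c') : c = c' := by
  obtain ⟨C, hC⟩ := h
  have hq0 := residueCard_pos R
  choose α hα using fun t => (c t).exists_eq_mk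
  choose β' hβ' using fun t => (c' t).exists_eq_mk
  -- `IsInterp.ratioLE` needs the same norm at the origin of both segments, not merely the same
  -- homothety class.
  let β : ℝ≥0 → SplitNorm R K V := fun t => if t = 0 then α 0 else β' t
  have hβ : ∀ t, c' t = .mk (β t) := fun t => by
    by_cases ht : t = 0
    · simp [β, ht, ← hα, h0]
    · simp [β, ht, hβ']
  have hβ0 : β 0 = α 0 := by simp [β]
  ext t
  rw [hα, hβ]
  refine mk_eq_mk_of_ratioLE fun B hB => ?_
  -- At time `n` the ratio bound is `q ^ (2 C)`. Pulled back to time `t` it is raised to the power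
  -- `t / n`, and so tends to `1`.
  have hlim : Filter.Tendsto (fun n : ℕ => ((residueCard R : ℝ) ^ (2 * C)) ^ ((t : ℝ) / n))
      Filter.atTop (nhds 1) := by
    have h1 : Filter.Tendsto (fun n : ℕ => (t : ℝ) / n) Filter.atTop (nhds 0) :=
      tendsto_const_div_atTop_nhds_zero_nat _
    have h2 := (Real.continuousAt_const_rpow (b := 0)
      (Real.rpow_pos_of_pos hq0 (2 * C)).ne').tendsto.comp h1
    rwa [Real.rpow_zero] at h2
  obtain ⟨n, hn, hnt⟩ := ((hlim.eventually_lt_const hB).and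
    (Filter.eventually_ge_atTop (⌈t⌉₊))).exists
  have htn : t ≤ (n : ℝ≥0) := (Nat.le_ceil t).trans (by exact_mod_cast hnt)
  obtain ⟨k, hk, h1⟩ := hc.isInterp hα t n htn
  obtain ⟨l, hl, h2⟩ := hc'.isInterp hβ t n htn
  rw [hβ0] at h2
  have hd : (Building.mk (α n)).dist (.mk (β n)) ≤ C := by
    rw [← hα, ← hβ]
    exact hC n
  have htn' : (t : ℝ) ≤ n := by exact_mod_cast htn
  refine (IsInterp.ratioLE (α 0).isUltranorm (α n).isUltranorm (β n).isUltranorm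
    (α t).isUltranorm (β t).isUltranorm hk hl (by positivity) ?_ h1 h2
    (Real.rpow_nonneg hq0.le _) (ratioLE_of_dist_le hd)).mono (α t).isUltranorm
    (β t).isUltranorm ?_
  · exact div_le_one_of_le₀ htn' (by positivity)
  · exact hn.le

end Straight

/-! ### Standard rays -/

section StdNorm
variable {R : Type u} [CommRing R] [IsDomain R] [IsDiscreteValuationRing R]
  [Finite (IsLocalRing.ResidueField R)]
  {K : Type u} [Field K] [Algebra R K] [IsFractionRing R K]
  {V : Type u} [AddCommGroup V] [Module K V]

variable (R) in
/-- The norm with weight `1` on the basis vectors in `S` and weight `q ^ τ` on the others. -/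
noncomputable def stdNorm (e : Module.Basis (Fin (Module.finrank K V)) K V)
    (S : Finset (Fin (Module.finrank K V))) (τ : ℝ) : SplitNorm R K V :=
  weightNorm R e (fun i => (residueCard R : ℝ) ^ (if i ∈ S then 0 else τ))
    fun _ => Real.rpow_pos_of_pos (residueCard_pos R) _

variable (e e' : Module.Basis (Fin (Module.finrank K V)) K V)
  (S S' : Finset (Fin (Module.finrank K V)))

theorem stdNorm_basis (τ : ℝ) (i) : (stdNorm R e S τ).toFun (e i) =
    (residueCard R : ℝ) ^ (if i ∈ S then 0 else τ) :=
  weightNorm_basis _ _ _ _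

variable {S} in
theorem stdNorm_basis_mem (τ : ℝ) {i} (hi : i ∈ S) : (stdNorm R e S τ).toFun (e i) = 1 := by
  rw [stdNorm_basis, if_pos hi, Real.rpow_zero]

variable {S} in
theorem stdNorm_basis_not_mem (τ : ℝ) {i} (hi : i ∉ S) :
    (stdNorm R e S τ).toFun (e i) = (residueCard R : ℝ) ^ τ := by
  rw [stdNorm_basis, if_neg hi]

theorem stdNorm_zero_basis (i) : (stdNorm R e S 0).toFun (e i) = 1 := by
  rw [stdNorm_basis, ite_self, Real.rpow_zero]

theorem isOrthogonal_stdNorm (τ : ℝ) : IsOrthogonal R (stdNorm R e S τ).toFun e :=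
  isOrthogonal_weightNorm _ _ _

theorem stdNorm_zero_le {τ : ℝ} (hτ : 0 ≤ τ) (v : V) :
    (stdNorm R e S 0).toFun v ≤ (stdNorm R e S τ).toFun v := by
  refine (stdNorm R e S 0).isUltranorm.le_of_repr e v ((stdNorm R e S τ).isUltranorm.nonneg v)
    fun i => le_trans (mul_le_mul_of_nonneg_left ?_ ((absVal R K).nonneg _))
      (isOrthogonal_stdNorm e S τ v i)
  rw [stdNorm_zero_basis, stdNorm_basis]
  refine Real.one_le_rpow (one_lt_residueCard_real R).le ?_
  split_ifs <;> simp [hτ]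

theorem stdNorm_le {τ : ℝ} (hτ : 0 ≤ τ) (v : V) :
    (stdNorm R e S τ).toFun v ≤ (residueCard R : ℝ) ^ τ * (stdNorm R e S 0).toFun v := by
  have hq := Real.rpow_pos_of_pos (residueCard_pos R) τ
  refine (stdNorm R e S τ).isUltranorm.le_of_repr e v
    (mul_nonneg hq.le ((stdNorm R e S 0).isUltranorm.nonneg v)) fun i => ?_
  have h := isOrthogonal_stdNorm (R := R) e S 0 v i
  rw [stdNorm_zero_basis, mul_one] at h
  rw [mul_comm, stdNorm_basis]
  refine mul_le_mul (Real.rpow_le_rpow_of_exponent_le (one_lt_residueCard_real R).le ?_) h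
    ((absVal R K).nonneg _) hq.le
  split_ifs <;> simp [hτ]

theorem mem_span_image_iff (v : V) :
    v ∈ Submodule.span K (e '' (S : Set (Fin (Module.finrank K V)))) ↔ ∀ i ∉ S, e.repr v i = 0 := by
  rw [e.mem_span_image]
  constructor
  · intro h i hi
    by_contra h0
    exact hi (h (Finsupp.mem_support_iff.2 h0))
  · intro h i hi
    by_contra h0
    exact Finsupp.mem_support_iff.1 hi (h i h0)

theorem stdNorm_of_mem_span (τ : ℝ) {v : V}
    (hv : v ∈ Submodule.span K (e '' (S : Set (Fin (Module.finrank K V))))) :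
    (stdNorm R e S τ).toFun v = (stdNorm R e S 0).toFun v := by
  rw [mem_span_image_iff] at hv
  have key : ∀ τ τ', (stdNorm R e S τ).toFun v ≤ (stdNorm R e S τ').toFun v := fun τ τ' => by
    refine (stdNorm R e S τ).isUltranorm.le_of_repr e v
      ((stdNorm R e S τ').isUltranorm.nonneg v) fun i => ?_
    by_cases hi : i ∈ S
    · refine le_trans (le_of_eq ?_) (isOrthogonal_stdNorm e S τ' v i)
      rw [stdNorm_basis_mem e _ hi, stdNorm_basis_mem e _ hi]
    · rw [hv i hi, map_zero, zero_mul]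
      exact (stdNorm R e S τ').isUltranorm.nonneg v
  exact le_antisymm (key _ _) (key _ _)

/-- The length of the edges of the ray `τ ↦ stdNorm e S τ`. -/
noncomputable def stdSpeed {n : ℕ} (S : Finset (Fin n)) : ℝ :=
  apartmentNorm fun i => if i ∈ S then 0 else 1

variable {S} in
theorem stdSpeed_pos {n : ℕ} {S : Finset (Fin n)} (h₁ : S.Nonempty) (h₂ : S ≠ Finset.univ) :
    0 < stdSpeed S := by
  obtain ⟨i, hi⟩ := h₁
  obtain ⟨j, hj⟩ : ∃ j, j ∉ S := by
    by_contra! h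
    exact h₂ (Finset.eq_univ_iff_forall.2 h)
  have := sub_le_two_mul_apartmentNorm (fun i => if i ∈ S then (0 : ℝ) else 1) j i
  rw [if_neg hj, if_pos hi] at this
  unfold stdSpeed
  linarith

theorem dist_stdNorm (τ τ' : ℝ) : (Building.mk (stdNorm R e S τ)).dist (.mk (stdNorm R e S τ')) =
    |τ - τ'| * stdSpeed S := by
  have hq := one_lt_residueCard_real R
  rw [Building.dist_mk _ _ e (isOrthogonal_stdNorm e S τ) (isOrthogonal_stdNorm e S τ'), stdSpeed,
    ← norm_diagProj, ← norm_diagProj, ← Real.norm_eq_abs, ← norm_smul, ← diagProj_smul]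
  congr 2
  ext i
  rw [stdNorm_basis, stdNorm_basis, Real.logb_rpow (residueCard_pos R) hq.ne',
    Real.logb_rpow (residueCard_pos R) hq.ne', Pi.smul_apply, smul_eq_mul]
  split_ifs <;> simp

variable (R) in
/-- The standard half-geodesic from the lattice spanned by `e` to the vertex at infinity of the
span of `e '' S`. -/
noncomputable def stdRay (t : ℝ≥0) : Building R K V := .mk (stdNorm R e S (t / stdSpeed S))

variable {S}

theorem isHalfGeodesic_stdRay (h₁ : S.Nonempty) (h₂ : S ≠ Finset.univ) :
    IsHalfGeodesic (stdRay R e S) := fun s t => by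
  have h := stdSpeed_pos h₁ h₂
  rw [stdRay, stdRay, dist_stdNorm, ← sub_div, abs_div, abs_of_pos h, div_mul_cancel₀ _ h.ne']

/-- The point is that `C` does not depend on `τ`: norms on the span of `S` are independent of `τ`,
and for `i ∉ S` the left side grows at most by `q ^ τ`, the right side exactly so. -/
theorem exists_stdNorm_map_le (h : V →ₗ[K] V)
    (hS : ∀ i ∈ S, h (e i) ∈ Submodule.span K (e '' (S : Set (Fin (Module.finrank K V))))) :
    ∃ C, 0 < C ∧ ∀ τ, 0 ≤ τ → ∀ v,
      (stdNorm R e S τ).toFun (h v) ≤ C * (stdNorm R e S τ).toFun v := by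
  have nn := (stdNorm R e S 0).isUltranorm.nonneg
  set C := 1 + ∑ i, (stdNorm R e S 0).toFun (h (e i))
  have hC : 0 < C := add_pos_of_pos_of_nonneg one_pos (Finset.sum_nonneg fun i _ => nn _)
  have hCi : ∀ i, (stdNorm R e S 0).toFun (h (e i)) ≤ C := fun i =>
    (Finset.single_le_sum (f := fun i => (stdNorm R e S 0).toFun (h (e i))) (fun i _ => nn _)
      (Finset.mem_univ i)).trans (le_add_of_nonneg_left zero_le_one)
  refine ⟨C, hC, fun τ hτ v => ?_⟩
  have nnτ := (stdNorm R e S τ).isUltranorm.nonneg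
  have key : ∀ i, (stdNorm R e S τ).toFun (h (e i)) ≤ C * (stdNorm R e S τ).toFun (e i) := by
    intro i
    by_cases hi : i ∈ S
    · rw [stdNorm_of_mem_span e S τ (hS i hi), stdNorm_basis_mem e _ hi, mul_one]
      exact hCi i
    · rw [stdNorm_basis_not_mem e _ hi, mul_comm]
      exact (stdNorm_le e S hτ _).trans (mul_le_mul_of_nonneg_left (hCi i)
        (Real.rpow_nonneg (residueCard_pos R).le _))
  conv_lhs => rw [← e.sum_repr v, map_sum]
  refine (stdNorm R e S τ).isUltranorm.sum_le _ _ (mul_nonneg hC.le (nnτ v)) fun i _ => ?_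
  rw [map_smul, (stdNorm R e S τ).isUltranorm.smul]
  calc _ ≤ absVal R K (e.repr v i) * (C * (stdNorm R e S τ).toFun (e i)) :=
        mul_le_mul_of_nonneg_left (key i) ((absVal R K).nonneg _)
    _ = C * (absVal R K (e.repr v i) * (stdNorm R e S τ).toFun (e i)) := by ring
    _ ≤ _ := mul_le_mul_of_nonneg_left (isOrthogonal_stdNorm e S τ v i) hC.le

theorem map_span_eq_of_forall_mem [FiniteDimensional K V] (g : V ≃ₗ[K] V)
    (hS : ∀ i ∈ S, g (e i) ∈ Submodule.span K (e '' (S : Set (Fin (Module.finrank K V))))) :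
    (Submodule.span K (e '' (S : Set (Fin (Module.finrank K V))))).map (g : V →ₗ[K] V) =
      Submodule.span K (e '' (S : Set (Fin (Module.finrank K V)))) := by
  refine Submodule.eq_of_le_of_finrank_eq ?_ (LinearEquiv.finrank_map_eq g _)
  rw [Submodule.map_span_le]
  rintro _ ⟨i, hi, rfl⟩
  exact hS i hi

theorem convergesTo_stdRay [FiniteDimensional K V] (h₁ : S.Nonempty) (h₂ : S ≠ Finset.univ) :
    ConvergesTo (stdRay R e S)
      (Submodule.span K (e '' (S : Set (Fin (Module.finrank K V))))) := by
  have hκ := stdSpeed_pos h₁ h₂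
  have hq := one_lt_residueCard_real R
  have hq0 := residueCard_pos R
  intro g
  constructor
  · rintro ⟨C, hC⟩
    refine map_span_eq_of_forall_mem e g fun i hi => ?_
    rw [mem_span_image_iff]
    intro j hj
    by_contra hne
    have hc := (absVal R K).pos hne
    set c := absVal R K (e.repr (g (e i)) j)
    -- If `g (e i)` has a non-zero coordinate at some `j ∉ S`, its norm grows like `q ^ τ`, while
    -- that of `e i` stays `1`. Testing the bounded distance on `g (e i)` and `g (e j)` yields `q ^
    -- τ ≤ A` for all `τ ≥ 0`, which is absurd.
    set A := (residueCard R : ℝ) ^ (2 * C) * (stdNorm R e S 0).toFun (g (e j)) / c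
    have hbound : ∀ τ : ℝ, 0 ≤ τ → (residueCard R : ℝ) ^ τ ≤ A := fun τ hτ => by
      have hd := hC ⟨τ * stdSpeed S, mul_nonneg hτ hκ.le⟩
      change (Building.mk ((stdNorm R e S (τ * stdSpeed S / stdSpeed S)).act g)).dist
        (.mk (stdNorm R e S (τ * stdSpeed S / stdSpeed S))) ≤ C at hd
      rw [mul_div_cancel_right₀ _ hκ.ne'] at hd
      have hd := ratioLE_of_dist_le (α := (stdNorm R e S τ).act g) hd (g (e i)) (g (e j))
      simp only [SplitNorm.act, LinearEquiv.symm_apply_apply] at hd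
      rw [stdNorm_basis_mem e _ hi, stdNorm_basis_not_mem e _ hj, one_mul] at hd
      have h1 := isOrthogonal_stdNorm (R := R) e S τ (g (e i)) j
      rw [stdNorm_basis_not_mem e _ hj] at h1
      have hqτ := Real.rpow_pos_of_pos hq0 τ
      have h2 := stdNorm_le (R := R) e S hτ (g (e j))
      rw [le_div_iff₀ hc]
      refine le_of_mul_le_mul_right ?_ hqτ
      calc (residueCard R : ℝ) ^ τ * c * (residueCard R : ℝ) ^ τ
          = c * (residueCard R : ℝ) ^ τ * (residueCard R : ℝ) ^ τ := by ring
        _ ≤ (stdNorm R e S τ).toFun (g (e i)) * (residueCard R : ℝ) ^ τ :=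
            mul_le_mul_of_nonneg_right h1 hqτ.le
        _ ≤ _ := hd
        _ ≤ (residueCard R : ℝ) ^ (2 * C) *
            ((residueCard R : ℝ) ^ τ * (stdNorm R e S 0).toFun (g (e j))) :=
            mul_le_mul_of_nonneg_left h2 (Real.rpow_nonneg hq0.le _)
        _ = _ := by ring
    have hA := hbound 0 le_rfl
    rw [Real.rpow_zero] at hA
    have h3 := hbound (Real.logb (residueCard R) A + 1)
      (add_nonneg (Real.logb_nonneg hq hA) zero_le_one)
    rw [Real.rpow_add hq0, Real.rpow_logb hq0 hq.ne' (one_pos.trans_le hA), Real.rpow_one] at h3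
    nlinarith
  · intro hg
    have hmem : ∀ i ∈ S, e i ∈ Submodule.span K (e '' (S : Set (Fin (Module.finrank K V)))) :=
      fun i hi => Submodule.subset_span ⟨i, hi, rfl⟩
    obtain ⟨C, hC, h⟩ := exists_stdNorm_map_le (R := R) e (g : V →ₗ[K] V) (S := S) fun i hi => by
      rw [← hg]
      exact Submodule.mem_map_of_mem (hmem i hi)
    obtain ⟨D, hD, h'⟩ := exists_stdNorm_map_le (R := R) e (g.symm : V →ₗ[K] V) (S := S)
      fun i hi => by
        have := hmem i hi
        rw [← hg] at this
        obtain ⟨w, hw, hw'⟩ := this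
        rw [← hw']
        simpa using hw
    refine ⟨Real.sqrt (Module.finrank K V) * Real.logb (residueCard R) (C * D), fun t => ?_⟩
    have hτ : 0 ≤ (t : ℝ) / stdSpeed S := div_nonneg t.2 hκ.le
    refine dist_le_of_ratioLE (α := (stdNorm R e S (t / stdSpeed S)).act g) ?_
    rw [Real.rpow_logb hq0 hq.ne' (mul_pos hC hD)]
    intro v w
    have nn := (stdNorm R e S (t / stdSpeed S)).isUltranorm.nonneg
    simp only [SplitNorm.act]
    have e1 := h _ hτ (g.symm v)
    have e2 := h' _ hτ w
    simp only [LinearEquiv.coe_coe, LinearEquiv.apply_symm_apply] at e1 e2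
    calc _ ≤ (C * (stdNorm R e S (t / stdSpeed S)).toFun (g.symm v)) *
          (D * (stdNorm R e S (t / stdSpeed S)).toFun w) :=
          mul_le_mul e1 e2 (nn _) (mul_nonneg hC.le (nn _))
      _ = _ := by ring

end StdNorm

/-! ### Lattices and vertices -/

section Vertices
variable {R : Type u} [CommRing R] [IsDomain R] [IsDiscreteValuationRing R]
  [Finite (IsLocalRing.ResidueField R)]
  {K : Type u} [Field K] [Algebra R K] [IsFractionRing R K]
  {V : Type u} [AddCommGroup V] [Module K V]
  [Module R V] [IsScalarTower R K V]

theorem latticeNorm_toFun {M : Submodule R V} [M.IsLattice K] {n : ℕ}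
    (b : Module.Basis (Fin n) R M) (v : V) : (latticeNorm (K := K) M).toFun v =
      ⨆ i, absVal R K ((b.extendOfIsLattice K).repr v i) :=
  (isLeast_latticeNorm b v).csInf_eq

theorem latticeNorm_eq_stdNorm {M : Submodule R V} [M.IsLattice K]
    (b : Module.Basis (Fin (Module.finrank K V)) R M) (S : Finset (Fin (Module.finrank K V))) :
    (latticeNorm (K := K) M).toFun = (stdNorm R (b.extendOfIsLattice K) S 0).toFun := by
  ext v
  rw [latticeNorm_toFun b]
  simp [stdNorm, weightNorm]

theorem vertex_eq_stdNorm {M : Submodule R V} [M.IsLattice K]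
    (b : Module.Basis (Fin (Module.finrank K V)) R M) (S : Finset (Fin (Module.finrank K V))) :
    vertex (K := K) M = .mk (stdNorm R (b.extendOfIsLattice K) S 0) :=
  Building.mk_eq_mk.2 ⟨1, one_pos, fun v => by rw [one_mul, latticeNorm_eq_stdNorm b S]⟩

theorem exists_latticeNorm_eq_zpow [FiniteDimensional K V] (L : Submodule R V) [L.IsLattice K]
    {v : V} (hv : v ≠ 0) : ∃ k : ℤ, (latticeNorm (K := K) L).toFun v = (residueCard R : ℝ) ^ k := by
  have hpos := (latticeNorm (K := K) L).isUltranorm.pos v hv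
  have : Module.Finite R L := inferInstance
  have h : Module.finrank R L = Module.finrank K V := by
    rw [Module.finrank, Submodule.IsLattice.rank' K L, Module.finrank]
  let b := Module.finBasisOfFinrankEq R L h
  obtain ⟨c, hc, -⟩ := (isLeast_latticeNorm (K := K) b v).1
  have hc' : (latticeNorm (K := K) L).toFun v = absVal R K c := by rw [latticeNorm_toFun b, hc]
  rw [hc'] at hpos ⊢
  exact exists_absVal_eq_zpow R ((absVal R K).pos_iff.1 hpos)

/-- Lattice norms take values in `q ^ ℤ`, and the homothety factor cancels in the quotient of the
values at `e j` and `e i`, which is `q ^ τ`. -/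
theorem isVertex_stdNorm_iff [FiniteDimensional K V]
    (e : Module.Basis (Fin (Module.finrank K V)) K V) {S : Finset (Fin (Module.finrank K V))}
    (h₁ : S.Nonempty) (h₂ : S ≠ Finset.univ) (τ : ℝ) :
    IsVertex (Building.mk (stdNorm R e S τ)) ↔ ∃ k : ℤ, τ = k := by
  have hq := one_lt_residueCard_real R
  have hq0 := residueCard_pos R
  constructor
  · rintro ⟨L, hL, h⟩
    obtain ⟨c, hc, hc'⟩ := Building.mk_eq_mk.1 h
    obtain ⟨i, hi⟩ := h₁
    obtain ⟨j, hj⟩ : ∃ j, j ∉ S := by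
      by_contra! h
      exact h₂ (Finset.eq_univ_iff_forall.2 h)
    obtain ⟨a, ha⟩ := exists_latticeNorm_eq_zpow (K := K) L (e.ne_zero i)
    obtain ⟨b, hb⟩ := exists_latticeNorm_eq_zpow (K := K) L (e.ne_zero j)
    rw [hc', stdNorm_basis_mem e _ hi, mul_one] at ha
    rw [hc', stdNorm_basis_not_mem e _ hj, ha, ← Real.rpow_intCast, ← Real.rpow_intCast,
      ← Real.rpow_add hq0] at hb
    refine ⟨b - a, ?_⟩
    have := congrArg (Real.logb (residueCard R)) hb
    rw [Real.logb_rpow hq0 hq.ne', Real.logb_rpow hq0 hq.ne'] at this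
    push_cast
    linarith
  · rintro ⟨k, rfl⟩
    -- Scaling the `e i` with `i ∉ S` by an element of absolute value `q ^ (-k)` brings all weights
    -- to `1`, so the scaled basis spans the required lattice.
    obtain ⟨y, hy0, hy⟩ := exists_absVal_eq R (K := K) (-k)
    let w : Fin (Module.finrank K V) → Kˣ := fun i => if i ∈ S then 1 else Units.mk0 y hy0
    let f := e.unitsSMul w
    let L : Submodule R V := Submodule.span R (Set.range f)
    let b : Module.Basis (Fin (Module.finrank K V)) R L := f.restrictScalars R
    have hL : L.IsLattice K := by
      refine ⟨(Submodule.fg_span (Set.finite_range f)), ?_⟩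
      rw [_root_.eq_top_iff, ← f.span_eq]
      exact Submodule.span_mono Submodule.subset_span
    refine ⟨L, hL, Building.mk_eq_mk.2 ⟨1, one_pos, fun v => ?_⟩⟩
    have hbf : b.extendOfIsLattice K = f := by
      refine Module.Basis.eq_of_apply_eq fun i => ?_
      rw [Module.Basis.extendOfIsLattice_apply]
      exact f.restrictScalars_apply R i
    rw [one_mul, latticeNorm_toFun b, hbf]
    simp only [stdNorm, weightNorm]
    congr 1
    ext i
    simp only [f, Module.Basis.repr_unitsSMul, w]
    by_cases hi : i ∈ S
    · simp [hi]
    · simp [hi, Units.smul_def, hy, mul_comm]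

theorem isVertex_stdRay_iff [FiniteDimensional K V]
    (e : Module.Basis (Fin (Module.finrank K V)) K V) {S : Finset (Fin (Module.finrank K V))}
    (h₁ : S.Nonempty) (h₂ : S ≠ Finset.univ) (t : ℝ≥0) :
    IsVertex (stdRay R e S t) ↔ ∃ k : ℕ, (t : ℝ) = k * stdSpeed S := by
  have hκ := stdSpeed_pos h₁ h₂
  rw [stdRay, isVertex_stdNorm_iff e h₁ h₂]
  constructor
  · rintro ⟨k, hk⟩
    lift k to ℕ using by
      have : (0 : ℝ) ≤ k := hk ▸ div_nonneg t.2 hκ.le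
      exact_mod_cast this
    exact ⟨k, (div_eq_iff hκ.ne').1 (by exact_mod_cast hk)⟩
  · rintro ⟨k, hk⟩
    exact ⟨k, by rw [hk, mul_div_cancel_right₀ _ hκ.ne']; simp⟩

end Vertices

/-! ### Automorphisms which preserve a lattice and a subspace -/

section Stabilizes
variable {R : Type u} [CommRing R] [IsDomain R] [IsDiscreteValuationRing R]
  [Finite (IsLocalRing.ResidueField R)]
  {K : Type u} [Field K] [Algebra R K] [IsFractionRing R K]
  {V : Type u} [AddCommGroup V] [Module K V]

variable (e : Module.Basis (Fin (Module.finrank K V)) K V)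
  (S : Finset (Fin (Module.finrank K V)))

variable (R) in
/-- A linear automorphism which preserves the lattice spanned by `e` and the span of `e '' S`. -/
structure Stabilizes (g : V ≃ₗ[K] V) : Prop where
  le_one : ∀ i, (stdNorm R e S 0).toFun (g (e i)) ≤ 1
  symm_le_one : ∀ i, (stdNorm R e S 0).toFun (g.symm (e i)) ≤ 1
  mem : ∀ i ∈ S, g (e i) ∈ Submodule.span K (e '' (S : Set (Fin (Module.finrank K V))))

variable {e S}

theorem stdNorm_map_le_of_le_one {h : V →ₗ[K] V}
    (hh : ∀ i, (stdNorm R e S 0).toFun (h (e i)) ≤ 1) (v : V) :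
    (stdNorm R e S 0).toFun (h v) ≤ (stdNorm R e S 0).toFun v := by
  conv_lhs => rw [← e.sum_repr v, map_sum]
  refine (stdNorm R e S 0).isUltranorm.sum_le _ _ ((stdNorm R e S 0).isUltranorm.nonneg v)
    fun i _ => ?_
  rw [map_smul, (stdNorm R e S 0).isUltranorm.smul]
  refine le_trans ?_ (isOrthogonal_stdNorm e S 0 v i)
  rw [stdNorm_zero_basis]
  exact mul_le_mul_of_nonneg_left (hh i) ((absVal R K).nonneg _)

theorem Stabilizes.stdNorm_eq {g : V ≃ₗ[K] V} (hg : Stabilizes R e S g) (v : V) :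
    (stdNorm R e S 0).toFun (g v) = (stdNorm R e S 0).toFun v := by
  refine le_antisymm (stdNorm_map_le_of_le_one (h := (g : V →ₗ[K] V)) hg.le_one v) ?_
  have := stdNorm_map_le_of_le_one (h := (g.symm : V →ₗ[K] V)) hg.symm_le_one (g v)
  simpa using this

theorem stabilizes_swap {i j : Fin (Module.finrank K V)} (hij : i ∈ S ↔ j ∈ S) :
    Stabilizes R e S (e.equiv e (Equiv.swap i j)) where
  le_one k := by rw [Module.Basis.equiv_apply, stdNorm_zero_basis]
  symm_le_one k := by
    rw [Module.Basis.equiv_symm, Module.Basis.equiv_apply, stdNorm_zero_basis]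
  mem k hk := by
    rw [Module.Basis.equiv_apply]
    refine Submodule.subset_span ⟨_, ?_, rfl⟩
    rw [Finset.mem_coe, Equiv.swap_apply_def]
    split_ifs with h1 h2
    · exact hij.1 (h1 ▸ hk)
    · exact hij.2 (h2 ▸ hk)
    · exact hk

theorem stabilizes_unitsSMul (w : Fin (Module.finrank K V) → Rˣ) :
    Stabilizes R e S (e.equiv (e.unitsSMul fun i => Units.map (algebraMap R K) (w i))
      (Equiv.refl _)) where
  le_one k := by
    rw [Module.Basis.equiv_apply, Module.Basis.unitsSMul_apply, Units.smul_def,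
      (stdNorm R e S 0).isUltranorm.smul, Equiv.refl_apply, stdNorm_zero_basis, mul_one]
    exact absVal_algebraMap_le_one R _
  symm_le_one k := by
    have h : (e.equiv (e.unitsSMul fun i => Units.map (algebraMap R K) (w i))
        (Equiv.refl _)).symm (e k) = algebraMap R K ((w k)⁻¹ : Rˣ) • e k := by
      rw [LinearEquiv.symm_apply_eq, map_smul, Module.Basis.equiv_apply,
        Module.Basis.unitsSMul_apply, Units.smul_def, smul_smul, Equiv.refl_apply]
      simp
    rw [h, (stdNorm R e S 0).isUltranorm.smul, stdNorm_zero_basis, mul_one]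
    exact absVal_algebraMap_le_one R _
  mem k hk := by
    rw [Module.Basis.equiv_apply, Module.Basis.unitsSMul_apply, Units.smul_def]
    exact Submodule.smul_mem _ _ (Submodule.subset_span ⟨k, hk, rfl⟩)

theorem exists_stabilizes_transvection {i j : Fin (Module.finrank K V)} (hi : i ∈ S)
    (hj : j ∉ S) : ∃ g, Stabilizes R e S g ∧ g (e j) = e j + e i := by
  classical
  have hij : i ≠ j := fun h => hj (h ▸ hi)
  let f : K → V →ₗ[K] V := fun c => e.constr K fun k => if k = j then e j + c • e i else e k
  have hfk : ∀ c k, k ≠ j → f c (e k) = e k := fun c k hk =>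
    (e.constr_basis K _ k).trans (if_neg hk)
  have hfj : ∀ c, f c (e j) = e j + c • e i := fun c =>
    (e.constr_basis K _ j).trans (if_pos rfl)
  have hinv : ∀ c, f c ∘ₗ f (-c) = LinearMap.id := fun c => e.ext fun k => by
    by_cases hk : k = j
    · subst hk
      simp only [LinearMap.comp_apply, hfj, map_add, map_smul, hfk _ _ hij, LinearMap.id_apply]
      module
    · simp only [LinearMap.comp_apply, hfk _ _ hk, LinearMap.id_apply]
  have hinv' := hinv (-1)
  rw [neg_neg] at hinv'
  let g : V ≃ₗ[K] V := LinearEquiv.ofLinearMap (f 1) (f (-1)) (hinv 1) hinv'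
  have hle : ∀ c : K, absVal R K c ≤ 1 → ∀ k, (stdNorm R e S 0).toFun (f c (e k)) ≤ 1 := by
    intro c hc k
    by_cases hk : k = j
    · subst hk
      rw [hfj]
      refine ((stdNorm R e S 0).isUltranorm.add_le _ _).trans (max_le ?_ ?_)
      · rw [stdNorm_zero_basis]
      · rw [(stdNorm R e S 0).isUltranorm.smul, stdNorm_zero_basis, mul_one]
        exact hc
    · rw [hfk _ _ hk, stdNorm_zero_basis]
  refine ⟨g, ⟨fun k => hle 1 (by simp) k, fun k => hle (-1) (by simp) k, fun k hk => ?_⟩, ?_⟩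
  · change f 1 (e k) ∈ _
    rw [hfk _ _ fun h => hj (h ▸ hk)]
    exact Submodule.subset_span ⟨k, hk, rfl⟩
  · change f 1 (e j) = _
    rw [hfj, one_smul]

end Stabilizes

/-! ### Uniqueness of the half-geodesic towards a vertex at infinity -/

section Uniqueness
variable {R : Type u} [CommRing R] [IsDomain R] [IsDiscreteValuationRing R]
  [Finite (IsLocalRing.ResidueField R)]
  {K : Type u} [Field K] [Algebra R K] [IsFractionRing R K]
  {V : Type u} [AddCommGroup V] [Module K V] [FiniteDimensional K V]

theorem Building.dist_act (g : V ≃ₗ[K] V) (x y : Building R K V) :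
    (x.act g).dist (y.act g) = x.dist y := by
  obtain ⟨α, rfl⟩ := x.exists_eq_mk
  obtain ⟨β, rfl⟩ := y.exists_eq_mk
  obtain ⟨e, hα, hβ⟩ := α.exists_common β
  rw [Building.dist_mk α β e hα hβ]
  change (Building.mk (α.act g)).dist (.mk (β.act g)) = _
  rw [Building.dist_mk (α.act g) (β.act g) (e.map g) (hα.comp g.symm) (hβ.comp g.symm)]
  simp [SplitNorm.act]

/-- The translate of `c` by `g` is a half-geodesic with the same origin and asymptotic to `c`, hence
equal to `c`. -/
theorem act_eq_of_convergesTo [Nontrivial V] {c : ℝ≥0 → Building R K V} (hc : IsHalfGeodesic c)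
    {W : Submodule K V} (hW : ConvergesTo c W) {g : V ≃ₗ[K] V}
    (hg : W.map (g : V →ₗ[K] V) = W) (h0 : (c 0).act g = c 0) (t : ℝ≥0) : (c t).act g = c t := by
  have h : IsHalfGeodesic fun t => (c t).act g := fun s t => by
    rw [Building.dist_act]
    exact hc s t
  exact congrFun (h.eq_of_asymptotic hc h0 ((hW g).2 hg)) t

/-- A priori `g` scales `α` by some factor `k`. But `g` preserves `μ`, so it cannot change the
maximum of `α / μ`, which forces `k = 1`. -/
theorem apply_eq_of_act_eq [Nontrivial V] {α μ : SplitNorm R K V} {g : V ≃ₗ[K] V}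
    (hα : (Building.mk α).act g = .mk α) (hμ : ∀ v, μ.toFun (g v) = μ.toFun v) (v : V) :
    α.toFun (g v) = α.toFun v := by
  have h : Building.mk (α.act g) = .mk α := hα
  obtain ⟨k, hk, hk'⟩ := Building.mk_eq_mk.1 h
  have hk' : ∀ v, α.toFun (g v) = k * α.toFun v := fun v => by
    rw [hk' (g v)]
    simp [SplitNorm.act]
  obtain ⟨w, hw, H⟩ := α.isTame.exists_max_ratio μ.isTame
  have ha := α.isUltranorm.pos w hw
  have hm := μ.isUltranorm.pos w hw
  have h1 : k ≤ 1 := by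
    have h2 := H (g w)
    rw [hk', hμ] at h2
    have := le_of_mul_le_mul_right h2 hm
    nlinarith
  have h1' : 1 ≤ k := by
    have h2 := H (g.symm w)
    have h3 := hk' (g.symm w)
    have h4 := hμ (g.symm w)
    rw [g.apply_symm_apply] at h3 h4
    rw [← h4] at h2
    have h5 := le_of_mul_le_mul_right h2 hm
    rw [h3] at h5
    have h6 : 0 < α.toFun (g.symm w) := α.isUltranorm.pos _ (by simpa using hw)
    nlinarith
  rw [hk', le_antisymm h1 h1', one_mul]

variable {e : Module.Basis (Fin (Module.finrank K V)) K V}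
  {S : Finset (Fin (Module.finrank K V))}

section
variable [Nontrivial V] {c : ℝ≥0 → Building R K V} (hc : IsHalfGeodesic c)
  (hW : ConvergesTo c (Submodule.span K (e '' (S : Set (Fin (Module.finrank K V))))))
  (h0 : c 0 = .mk (stdNorm R e S 0))
include hc hW h0

theorem invariant_of_stabilizes {g : V ≃ₗ[K] V} (hg : Stabilizes R e S g) {t : ℝ≥0}
    {α : SplitNorm R K V} (hα : c t = .mk α) (v : V) : α.toFun (g v) = α.toFun v := by
  refine apply_eq_of_act_eq ?_ hg.stdNorm_eq v
  rw [← hα]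
  refine act_eq_of_convergesTo hc hW (map_span_eq_of_forall_mem e g hg.mem) ?_ t
  rw [h0]
  refine Building.mk_eq_mk.2 ⟨1, one_pos, fun v => ?_⟩
  rw [one_mul, SplitNorm.act]
  have := hg.stdNorm_eq (g.symm v)
  rwa [g.apply_symm_apply] at this

/-- Invariance is applied to the diagonal matrix `g` with entry `1 + π` at `i` and `1` elsewhere: `g
v - v` is `π` times the `i`-th component of `v`, and its norm is at most that of `v`. The unit `1 +
π` exists for every residue field; its price is the factor `q`. -/
theorem le_residueCard_mul {t : ℝ≥0} {α : SplitNorm R K V} (hα : c t = .mk α) (v : V) (i) :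
    absVal R K (e.repr v i) * α.toFun (e i) ≤ residueCard R * α.toFun v := by
  obtain ⟨π, hπ⟩ := IsDiscreteValuationRing.exists_irreducible R
  have hu : IsUnit (1 + π) := by
    have hm : π ∈ IsLocalRing.maximalIdeal R := hπ.not_isUnit
    by_contra h
    have h1 : 1 + π ∈ IsLocalRing.maximalIdeal R := h
    have h2 := (Ideal.add_mem_iff_left _ hm).1 h1
    exact h2 isUnit_one
  let w : Fin (Module.finrank K V) → Rˣ := fun k => if k = i then hu.unit else 1
  set g := e.equiv (e.unitsSMul fun i => Units.map (algebraMap R K) (w i)) (Equiv.refl _)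
  have hgk : ∀ k, k ≠ i → g (e k) = e k := fun k hk => by
    rw [Module.Basis.equiv_apply, Module.Basis.unitsSMul_apply]
    simp [w, hk]
  have hgi : g (e i) = e i + algebraMap R K π • e i := by
    rw [Module.Basis.equiv_apply, Module.Basis.unitsSMul_apply]
    simp [w, Units.smul_def, add_smul]
  have hg : g v - v = algebraMap R K π • e.repr v i • e i := by
    have h : ∀ x, g x - x = algebraMap R K π • e.coord i x • e i := fun x => by
      have : (g : V →ₗ[K] V) - LinearMap.id =
          algebraMap R K π • (e.coord i).smulRight (e i) := e.ext fun k => by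
        by_cases hk : k = i
        · subst hk
          simp [hgi]
        · simp [hgk k hk, hk]
      exact LinearMap.congr_fun this x
    exact h v
  have hinv := invariant_of_stabilizes hc hW h0 (stabilizes_unitsSMul w) hα v
  have h1 := α.isUltranorm.sub_le (g v) v
  rw [hinv, max_self, hg, α.isUltranorm.smul, α.isUltranorm.smul, absVal_irreducible R hπ,
    inv_mul_le_iff₀ (residueCard_pos R)] at h1
  exact h1

/-- At a late time `n` the norm agrees, up to the factor `q`, with a norm `σ` of the apartment of
`e`. Interpolation with the origin reduces this factor at time `t` to `q ^ (t / n)`, and `n → ∞`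
removes it. -/
theorem isOrthogonal_of_convergesTo {t : ℝ≥0} {α : SplitNorm R K V} (hα : c t = .mk α) :
    IsOrthogonal R α.toFun e := by
  have hq := one_lt_residueCard_real R
  have hq0 := residueCard_pos R
  choose β' hβ' using fun t => (c t).exists_eq_mk
  let β : ℝ≥0 → SplitNorm R K V := fun u =>
    if u = 0 then stdNorm R e S 0 else if u = t then α else β' u
  have hβ : ∀ u, c u = .mk (β u) := fun u => by
    simp only [β]
    split_ifs with h1 h2
    · rw [h1, h0]
    · rw [h2, hα]
    · exact hβ' u
  rcases eq_or_ne t 0 with rfl | ht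
  · rw [hα] at h0
    obtain ⟨k, hk, hk'⟩ := Building.mk_eq_mk.1 h0.symm
    rw [show α.toFun = fun v => k * (stdNorm R e S 0).toFun v from funext hk']
    exact (isOrthogonal_stdNorm e S 0).const_mul hk
  have hβ0 : β 0 = stdNorm R e S 0 := by simp [β]
  have hβt : β t = α := by simp [β, ht]
  intro v i
  by_cases hv : v = 0
  · simp [hv, α.isUltranorm.map_zero]
  have key : ∀ n : ℕ, t ≤ (n : ℝ≥0) → absVal R K (e.repr v i) * α.toFun (e i) ≤
      (residueCard R : ℝ) ^ ((t : ℝ) / n) * α.toFun v := by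
    intro n hn
    have hn' : (t : ℝ) ≤ n := by exact_mod_cast hn
    obtain ⟨k, hk, h1⟩ := hc.isInterp hβ t n hn
    rw [hβ0, hβt] at h1
    set y := β n
    let σ := weightNorm R e (fun i => y.toFun (e i)) (y.isUltranorm.basis_pos e)
    have hyσ : RatioLE y.toFun σ.toFun (residueCard R) := fun v w => by
      have e1 : σ.toFun v ≤ residueCard R * y.toFun v := by
        refine σ.isUltranorm.le_of_repr e v (mul_nonneg hq0.le (y.isUltranorm.nonneg v)) fun j => ?_
        rw [weightNorm_basis]
        exact le_residueCard_mul hc hW h0 (hβ n) v j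
      have e2 : y.toFun w ≤ σ.toFun w := by
        refine y.isUltranorm.le_of_repr e w (σ.isUltranorm.nonneg w) fun j => ?_
        rw [← weightNorm_basis (R := R) e (fun i => y.toFun (e i)) (y.isUltranorm.basis_pos e) j]
        exact isOrthogonal_weightNorm (R := R) e _ _ w j
      calc _ ≤ (residueCard R * y.toFun v) * σ.toFun w :=
            mul_le_mul e1 e2 (y.isUltranorm.nonneg w) (mul_nonneg hq0.le (y.isUltranorm.nonneg v))
        _ = _ := by ring
    let z := weightNorm R e (fun i => (stdNorm R e S 0).toFun (e i) ^ (1 - (t : ℝ) / n) *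
        σ.toFun (e i) ^ ((t : ℝ) / n)) fun i => mul_pos
          (Real.rpow_pos_of_pos ((stdNorm R e S 0).isUltranorm.basis_pos e i) _)
          (Real.rpow_pos_of_pos (σ.isUltranorm.basis_pos e i) _)
    have hze : IsOrthogonal R z.toFun e := isOrthogonal_weightNorm e _ _
    have hz : IsInterp R K (stdNorm R e S 0).toFun σ.toFun ((t : ℝ) / n) 1 z.toFun :=
      ⟨e, isOrthogonal_stdNorm e S 0, isOrthogonal_weightNorm e _ _, hze, fun i => by
        rw [weightNorm_basis, one_mul]⟩
    have hr := IsInterp.ratioLE (stdNorm R e S 0).isUltranorm y.isUltranorm σ.isUltranorm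
      α.isUltranorm z.isUltranorm hk one_pos (by positivity)
      (div_le_one_of_le₀ hn' (by positivity)) h1 hz hq0.le hyσ v (e.repr v i • e i)
    rw [← α.isUltranorm.smul]
    have hzi : z.toFun (e.repr v i • e i) ≤ z.toFun v := by
      rw [z.isUltranorm.smul]
      exact hze v i
    have hzv := z.isUltranorm.pos v hv
    refine le_of_mul_le_mul_left (hr.trans ?_) hzv
    calc _ ≤ (residueCard R : ℝ) ^ ((t : ℝ) / n) * (α.toFun v * z.toFun v) :=
          mul_le_mul_of_nonneg_left (mul_le_mul_of_nonneg_left hzi (α.isUltranorm.nonneg v))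
            (Real.rpow_nonneg hq0.le _)
      _ = _ := by ring
  have hlim : Filter.Tendsto (fun n : ℕ => (residueCard R : ℝ) ^ ((t : ℝ) / n) * α.toFun v)
      Filter.atTop (nhds (1 * α.toFun v)) := by
    have h2 := (Real.continuousAt_const_rpow (b := 0) hq0.ne').tendsto.comp
      (tendsto_const_div_atTop_nhds_zero_nat (t : ℝ))
    rw [Real.rpow_zero] at h2
    exact h2.mul_const _
  rw [one_mul] at hlim
  refine ge_of_tendsto hlim ?_
  filter_upwards [Filter.eventually_ge_atTop ⌈t⌉₊] with n hn
  exact key n ((Nat.le_ceil t).trans (by exact_mod_cast hn))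

/-- There is only one half-geodesic with a given origin which converges to a given vertex at
infinity. -/
theorem eq_stdRay_of_convergesTo (h₁ : S.Nonempty) (h₂ : S ≠ Finset.univ) : c = stdRay R e S := by
  have hq := one_lt_residueCard_real R
  have hq0 := residueCard_pos R
  have hκ := stdSpeed_pos h₁ h₂
  obtain ⟨i₀, hi₀⟩ := h₁
  obtain ⟨j₀, hj₀⟩ : ∃ j, j ∉ S := by
    by_contra! h
    exact h₂ (Finset.eq_univ_iff_forall.2 h)
  ext t
  obtain ⟨α, hα⟩ := (c t).exists_eq_mk
  have hinv : ∀ {g}, Stabilizes R e S g → ∀ v, α.toFun (g v) = α.toFun v :=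
    fun hg => invariant_of_stabilizes hc hW h0 hg hα
  -- Permutations make the weights constant on `S` and on its complement; the transvection `e j₀ ↦ e
  -- j₀ + e i₀` shows which of the two is larger, and so gives the sign of `τ`.
  have hswap : ∀ i j, (i ∈ S ↔ j ∈ S) → α.toFun (e i) = α.toFun (e j) := fun i j hij => by
    have := hinv (stabilizes_swap hij) (e j)
    rwa [Module.Basis.equiv_apply, Equiv.swap_apply_right] at this
  have ha := α.isUltranorm.basis_pos e i₀
  have hb := α.isUltranorm.basis_pos e j₀
  have hab : α.toFun (e i₀) ≤ α.toFun (e j₀) := by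
    obtain ⟨g, hg, hgj⟩ := exists_stabilizes_transvection (R := R) (e := e) hi₀ hj₀
    have h1 := hinv hg (e j₀)
    rw [hgj] at h1
    have h2 := α.isUltranorm.sub_le (e j₀ + e i₀) (e j₀)
    rwa [add_sub_cancel_left, h1, max_self] at h2
  set τ := Real.logb (residueCard R) (α.toFun (e j₀) / α.toFun (e i₀)) with hτ
  have hτ0 : 0 ≤ τ := Real.logb_nonneg hq ((one_le_div ha).2 hab)
  have hstd : c t = .mk (stdNorm R e S τ) := by
    rw [hα]
    refine (Building.mk_eq_mk.2 ⟨α.toFun (e i₀), ha, fun v => ?_⟩).symm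
    have := α.isUltranorm.congr_of_orthogonal ((stdNorm R e S τ).isUltranorm.const_mul ha)
      (isOrthogonal_of_convergesTo hc hW h0 hα) ((isOrthogonal_stdNorm e S τ).const_mul ha)
      fun i => ?_
    · exact congrFun this v
    · by_cases hi : i ∈ S
      · rw [stdNorm_basis_mem e _ hi, mul_one, hswap i i₀ (by simp [hi, hi₀])]
      · rw [stdNorm_basis_not_mem e _ hi, hτ, Real.rpow_logb hq0 hq.ne' (div_pos hb ha),
          mul_div_cancel₀ _ ha.ne', hswap i j₀ (by simp [hi, hj₀])]
  have hd := hc 0 t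
  rw [h0, hstd, dist_stdNorm, zero_sub, abs_neg, abs_of_nonneg hτ0, NNReal.coe_zero, zero_sub,
    abs_neg, NNReal.abs_eq] at hd
  rw [hstd, stdRay, ← hd, mul_div_cancel_right₀ _ hκ.ne']

end

/-- The range of `j` is downward closed with `m + 1` elements, hence `{0, …, m}`, and the increasing
enumeration of a finite set is unique. -/
theorem strictMono_eq_of_initial {m : ℕ} {j : Fin (m + 1) → ℕ} (hj : StrictMono j)
    (h : ∀ k ≤ j (Fin.last m), k ∈ Set.range j) (i) : j i = i := by
  have him : Finset.univ.image j = Finset.range (j (Fin.last m) + 1) := by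
    ext k
    simp only [Finset.mem_image, Finset.mem_univ, true_and, Finset.mem_range, Nat.lt_succ_iff]
    exact ⟨fun ⟨i, hi⟩ => hi ▸ hj.monotone (Fin.le_last i), fun hk => h k hk⟩
  have hcard := congrArg Finset.card him
  rw [Finset.card_image_of_injective _ hj.injective, Finset.card_univ, Fintype.card_fin,
    Finset.card_range] at hcard
  have hr : (Finset.range (m + 1)).card = m + 1 := Finset.card_range _
  have h1 := Finset.orderEmbOfFin_unique hr (f := j) (fun x => by
    rw [hcard, ← him]
    exact Finset.mem_image_of_mem _ (Finset.mem_univ x)) hj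
  have h2 := Finset.orderEmbOfFin_unique hr (f := fun x : Fin (m + 1) => (x : ℕ))
    (fun x => Finset.mem_range.2 x.2) (fun _ _ h => h)
  rw [h1, ← h2]

/-- By uniqueness `c` is the standard ray, whose vertices sit at the multiples of `stdSpeed S`. The
parameters `t i` run through all multiples up to the last one, so `t i` is `i` times `stdSpeed S`.
-/
theorem isInitialSegment_iff {x : Building R K V} (hx : x = .mk (stdNorm R e S 0))
    (h₁ : S.Nonempty) (h₂ : S ≠ Finset.univ) {m : ℕ} {s : Fin (m + 1) → Building R K V}
    [Module R V] [IsScalarTower R K V] :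
    IsInitialSegment x (Submodule.span K (e '' (S : Set (Fin (Module.finrank K V))))) m s ↔
      ∀ i, s i = .mk (stdNorm R e S (i : ℕ)) := by
  have hκ := stdSpeed_pos h₁ h₂
  have : Nontrivial V := by
    obtain ⟨i, -⟩ := h₁
    exact ⟨e i, 0, e.ne_zero i⟩
  have hray : ∀ k : ℕ, ∀ t : ℝ≥0, (t : ℝ) = k * stdSpeed S →
      stdRay R e S t = .mk (stdNorm R e S k) := fun k t ht => by
    rw [stdRay, ht, mul_div_cancel_right₀ _ hκ.ne']
  constructor
  · rintro ⟨c, hc, hc0, hcW, t, ht, hs, hv⟩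
    obtain rfl := eq_stdRay_of_convergesTo hc hcW (hc0.trans hx) h₁ h₂
    have hj : ∀ i, ∃ k : ℕ, (t i : ℝ) = k * stdSpeed S := fun i =>
      (isVertex_stdRay_iff e h₁ h₂ _).1 ((hv _ (ht.monotone (Fin.le_last i))).2 ⟨i, rfl⟩)
    choose j hj using hj
    have hjm : StrictMono j := fun a b hab => by
      have h : (t a : ℝ) < t b := by exact_mod_cast ht hab
      rw [hj, hj] at h
      exact_mod_cast lt_of_mul_lt_mul_right h hκ.le
    intro i
    rw [hs, hray (j i) _ (hj i), strictMono_eq_of_initial hjm _ i]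
    intro k hk
    have hk' : (k : ℝ) * stdSpeed S ≤ t (Fin.last m) := by
      rw [hj]
      exact mul_le_mul_of_nonneg_right (by exact_mod_cast hk) hκ.le
    obtain ⟨i, hi⟩ := (hv ⟨k * stdSpeed S, by positivity⟩ hk').1
      ((isVertex_stdRay_iff e h₁ h₂ _).2 ⟨k, rfl⟩)
    refine ⟨i, ?_⟩
    have := hj i
    rw [hi] at this
    exact_mod_cast (mul_right_cancel₀ hκ.ne' this).symm
  · intro hs
    have hmono : StrictMono fun i : Fin (m + 1) =>
        (⟨(i : ℕ) * stdSpeed S, by positivity⟩ : ℝ≥0) := fun a b hab => by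
      change ((a : ℕ) : ℝ) * stdSpeed S < ((b : ℕ) : ℝ) * stdSpeed S
      exact mul_lt_mul_of_pos_right (by exact_mod_cast hab) hκ
    refine ⟨stdRay R e S, isHalfGeodesic_stdRay e h₁ h₂, ?_, convergesTo_stdRay e h₁ h₂, _, hmono,
      fun i => ?_, fun u hu => ?_⟩
    · rw [hray 0 0 (by simp), hx, Nat.cast_zero]
    · rw [hs]
      exact (hray i _ rfl).symm
    · rw [isVertex_stdRay_iff e h₁ h₂]
      constructor
      · rintro ⟨k, hk⟩
        have h : (u : ℝ) ≤ (m : ℕ) * stdSpeed S := by exact_mod_cast hu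
        rw [hk] at h
        have hkm : k ≤ m := by exact_mod_cast le_of_mul_le_mul_right h hκ
        exact ⟨⟨k, Nat.lt_succ_of_le hkm⟩, NNReal.eq hk.symm⟩
      · rintro ⟨i, rfl⟩
        exact ⟨i, rfl⟩

end Uniqueness

open scoped TensorProduct

/-! ### Bases of the lattice adapted to a subspace -/

section Adapted
variable {R : Type u} [CommRing R]
  {K : Type u} [Field K] [Algebra R K] [IsFractionRing R K]
  {V : Type u} [AddCommGroup V] [Module K V] [Module R V] [IsScalarTower R K V]
  {M : Submodule R V} [M.IsLattice K] {n : ℕ}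

theorem extendOfIsLattice_repr (b : Module.Basis (Fin n) R M) (x : M) (i : Fin n) :
    (b.extendOfIsLattice K).repr (x : V) i = algebraMap R K (b.repr x i) := by
  have : (x : V) = ∑ j, algebraMap R K (b.repr x j) • b.extendOfIsLattice K j := by
    have := congrArg M.subtype (b.sum_repr x)
    simp only [map_sum, map_smul, Submodule.subtype_apply] at this
    refine this.symm.trans ?_
    simp
  conv_lhs => rw [this]
  rw [Module.Basis.repr_sum_self]

variable (K) in
/-- The subspace of `V` which is spanned by the vectors with index in `S` of a basis of `M`. -/
def basisSpan (b : Module.Basis (Fin n) R M) (S : Finset (Fin n)) : Submodule K V :=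
  Submodule.span K (b.extendOfIsLattice K '' (S : Set (Fin n)))

theorem exists_smul_mem_lattice [IsDomain R] (v : V) : ∃ r : R, algebraMap R K r ≠ 0 ∧ r • v ∈ M := by
  have hv : v ∈ Submodule.span K (M : Set V) := by
    rw [Submodule.IsLattice.span_eq_top]
    trivial
  induction hv using Submodule.span_induction with
  | mem x hx => exact ⟨1, by simp, by rwa [one_smul]⟩
  | zero => exact ⟨1, by simp, by rw [smul_zero]; exact M.zero_mem⟩
  | add x y _ _ hx hy =>
    obtain ⟨r, hr, hx⟩ := hx
    obtain ⟨s, hs, hy⟩ := hy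
    refine ⟨r * s, by rw [map_mul]; exact mul_ne_zero hr hs, ?_⟩
    rw [smul_add]
    refine M.add_mem ?_ ?_
    · rw [mul_comm, mul_smul]
      exact M.smul_mem _ hx
    · rw [mul_smul]
      exact M.smul_mem _ hy
  | smul c x _ hx =>
    obtain ⟨r, hr, hx⟩ := hx
    obtain ⟨a, d, hd, rfl⟩ := IsFractionRing.div_surjective (A := R) c
    have hd0 : algebraMap R K d ≠ 0 := IsFractionRing.to_map_ne_zero_of_mem_nonZeroDivisors hd
    refine ⟨d * r, by rw [map_mul]; exact mul_ne_zero hd0 hr, ?_⟩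
    have : (d * r) • (algebraMap R K a / algebraMap R K d) • x = a • r • x := by
      rw [← algebraMap_smul K, ← algebraMap_smul K a, ← algebraMap_smul K r, smul_smul, smul_smul,
        map_mul]
      congr 1
      field_simp
    rw [this]
    exact M.smul_mem _ hx

/-- Every subspace of `V` is spanned by a part of some basis of `M`. -/
theorem exists_basisSpan_eq [IsDomain R] [IsPrincipalIdealRing R] (hn : Module.finrank R M = n)
    (W : Submodule K V) : ∃ (b : Module.Basis (Fin n) R M) (S : Finset (Fin n)),
      W = basisSpan K b S := by
  classical
  -- `M ∩ W` is saturated, so the quotient of `M` by it is torsion-free, hence free over a principal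
  -- ideal domain. Bases of `M ∩ W` and of the quotient combine to a basis of `M`.
  let N : Submodule R M := (W.restrictScalars R).comap M.subtype
  have htf : Module.IsTorsionFree R (M ⧸ N) := by
    rw [Module.isTorsionFree_iff_smul_eq_zero]
    intro r x h
    obtain ⟨x, rfl⟩ := N.mkQ_surjective x
    rw [← map_smul, Submodule.mkQ_apply, Submodule.Quotient.mk_eq_zero] at h
    rw [Submodule.mkQ_apply, Submodule.Quotient.mk_eq_zero]
    by_cases hr : r = 0
    · exact Or.inl hr
    · right
      change (x : V) ∈ W
      have h' : r • (x : V) ∈ W := h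
      rw [← algebraMap_smul K] at h'
      exact (W.smul_mem_iff (by simpa using hr)).1 h'
  let bN := Module.Free.chooseBasis R N
  let bQ := Module.Free.chooseBasis R (M ⧸ N)
  let b₀ := Module.Basis.sumQuot bN bQ
  let f := Fintype.equivFinOfCardEq ((Module.finrank_eq_card_basis b₀).symm.trans hn)
  refine ⟨b₀.reindex f, Finset.univ.image fun i => f (Sum.inl i), le_antisymm ?_ ?_⟩
  · intro w hw
    obtain ⟨r, hr, hrw⟩ := exists_smul_mem_lattice (K := K) (M := M) w
    have hN : (⟨r • w, hrw⟩ : M) ∈ N := by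
      change r • w ∈ W
      rw [← algebraMap_smul K]
      exact W.smul_mem _ hw
    refine (Submodule.smul_mem_iff _ hr).1 ?_
    rw [algebraMap_smul]
    have hsum := congrArg (fun x : N => ((x : M) : V)) (bN.sum_repr ⟨_, hN⟩)
    simp only [Submodule.coe_sum, Submodule.coe_smul] at hsum
    rw [← hsum]
    refine Submodule.sum_mem _ fun i _ => ?_
    rw [← algebraMap_smul K]
    refine Submodule.smul_mem _ _ (Submodule.subset_span ⟨f (Sum.inl i), by simp, ?_⟩)
    simp [b₀]
  · rw [basisSpan, Submodule.span_le]
    rintro _ ⟨j, hj, rfl⟩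
    obtain ⟨i, -, rfl⟩ := Finset.mem_image.1 (Finset.mem_coe.1 hj)
    have : ((bN i : M) : V) ∈ W := (bN i).2
    simpa [b₀] using this

theorem nonempty_of_basisSpan_ne_bot {b : Module.Basis (Fin n) R M} {S : Finset (Fin n)}
    (h : basisSpan K b S ≠ ⊥) : S.Nonempty := by
  by_contra hS
  rw [Finset.not_nonempty_iff_eq_empty] at hS
  exact h (by simp [basisSpan, hS])

theorem ne_univ_of_basisSpan_ne_top {b : Module.Basis (Fin n) R M} {S : Finset (Fin n)}
    (h : basisSpan K b S ≠ ⊤) : S ≠ Finset.univ := by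
  rintro rfl
  exact h (by rw [basisSpan, Finset.coe_univ, Set.image_univ, Module.Basis.span_eq])

theorem basisSpan_ne_bot {b : Module.Basis (Fin n) R M} {S : Finset (Fin n)}
    (h : S.Nonempty) : basisSpan K b S ≠ ⊥ := by
  obtain ⟨i, hi⟩ := h
  intro h0
  have : b.extendOfIsLattice K i ∈ basisSpan K b S := Submodule.subset_span ⟨i, hi, rfl⟩
  rw [h0, Submodule.mem_bot] at this
  exact Module.Basis.ne_zero _ i this

theorem basisSpan_ne_top {b : Module.Basis (Fin n) R M} {S : Finset (Fin n)}
    (h : S ≠ Finset.univ) : basisSpan K b S ≠ ⊤ := by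
  obtain ⟨j, hj⟩ : ∃ j, j ∉ S := by
    by_contra! h'
    exact h (Finset.eq_univ_iff_forall.2 h')
  intro h0
  have : b.extendOfIsLattice K j ∈ basisSpan K b S := h0 ▸ Submodule.mem_top
  rw [basisSpan, Module.Basis.mem_span_image] at this
  exact hj (this (by rw [Module.Basis.repr_self]; simp))

end Adapted

/-! ### Reduction of adapted bases -/

section Reduction
variable {R : Type u} [CommRing R] {M : Type u} [AddCommGroup M] [Module R M] {n : ℕ} (I : Ideal R)

/-- The submodule of `M ⊗ R/I` which is spanned by the vectors with index in `S` of a basis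
of `M`. -/
def redSpan (b : Module.Basis (Fin n) R M) (S : Finset (Fin n)) :
    Submodule (R ⧸ I) ((R ⧸ I) ⊗[R] M) :=
  Submodule.span (R ⧸ I) (b.baseChange (R ⧸ I) '' (S : Set (Fin n)))

variable {I}

theorem mem_redSpan_iff {b : Module.Basis (Fin n) R M} {S : Finset (Fin n)}
    {x : (R ⧸ I) ⊗[R] M} :
    x ∈ redSpan I b S ↔ ∀ i ∉ S, (b.baseChange (R ⧸ I)).repr x i = 0 := by
  rw [redSpan, Module.Basis.mem_span_image]
  constructor
  · intro h i hi
    by_contra h0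
    exact hi (h (Finsupp.mem_support_iff.2 h0))
  · intro h i hi
    by_contra h0
    exact Finsupp.mem_support_iff.1 hi (h i h0)

theorem tmul_mem_redSpan_iff {b : Module.Basis (Fin n) R M} {S : Finset (Fin n)} {x : M} :
    1 ⊗ₜ[R] x ∈ redSpan I b S ↔ ∀ i ∉ S, b.repr x i ∈ I := by
  rw [mem_redSpan_iff]
  refine forall₂_congr fun i _ => ?_
  rw [Module.Basis.baseChange_repr_tmul, Algebra.smul_def, mul_one]
  exact Ideal.Quotient.eq_zero_iff_mem

end Reduction

/-! ### Segments of the ray and reductions determine each other -/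

section Segments
variable {R : Type u} [CommRing R] [IsDomain R] [IsDiscreteValuationRing R]
  [Finite (IsLocalRing.ResidueField R)]
  {K : Type u} [Field K] [Algebra R K] [IsFractionRing R K]
  {V : Type u} [AddCommGroup V] [Module K V] [Module R V] [IsScalarTower R K V]
  {M : Submodule R V} [M.IsLattice K]
  {b b' : Module.Basis (Fin (Module.finrank K V)) R M}
  {S S' : Finset (Fin (Module.finrank K V))} {π : R}

/-- The unit ball at time `k` meets `M` in `(M ∩ W) + π ^ k M`, where `W` is spanned by the basis
vectors in `S`. This links the ray with reduction modulo `π ^ k`. -/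
theorem stdNorm_le_one_iff (hπ : Irreducible π) (k : ℕ) (x : M) :
    (stdNorm R (b.extendOfIsLattice K) S k).toFun (x : V) ≤ 1 ↔ ∀ i ∉ S, π ^ k ∣ b.repr x i := by
  constructor
  · intro h i hi
    have h1 := (isOrthogonal_stdNorm (b.extendOfIsLattice K) S k (x : V) i).trans h
    rw [stdNorm_basis_not_mem _ _ hi, extendOfIsLattice_repr, Real.rpow_natCast] at h1
    exact (absVal_le_pow_iff R hπ _ k).1 h1
  · intro h
    refine (stdNorm R _ S k).isUltranorm.le_of_repr (b.extendOfIsLattice K) _ zero_le_one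
      fun i => ?_
    rw [extendOfIsLattice_repr]
    by_cases hi : i ∈ S
    · rw [stdNorm_basis_mem _ _ hi, mul_one]
      exact absVal_algebraMap_le_one R _
    · rw [stdNorm_basis_not_mem _ _ hi, Real.rpow_natCast]
      exact (absVal_le_pow_iff R hπ _ k).2 (h i hi)

theorem stdNorm_zero_eq : (stdNorm R (b.extendOfIsLattice K) S 0).toFun =
    (stdNorm R (b'.extendOfIsLattice K) S' 0).toFun := by
  rw [← latticeNorm_eq_stdNorm, ← latticeNorm_eq_stdNorm]

/-- Testing on `b'` suffices. For `i ∈ S'` the vector `b' i` lies in the span of `S` modulo `π ^ m`,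
hence modulo `π ^ k`, so its norm is at most `1`; for the others `q ^ k` bounds the norm of every
vector of `M`. -/
theorem stdNorm_le_of_redSpan_le (hπ : Irreducible π) {k m : ℕ} (hkm : k ≤ m)
    (h : redSpan (Ideal.span {π ^ m}) b' S' ≤ redSpan (Ideal.span {π ^ m}) b S) (v : V) :
    (stdNorm R (b.extendOfIsLattice K) S k).toFun v ≤
      (stdNorm R (b'.extendOfIsLattice K) S' k).toFun v := by
  set α := stdNorm R (b.extendOfIsLattice K) S k
  set β := stdNorm R (b'.extendOfIsLattice K) S' k
  refine α.isUltranorm.le_of_repr (b'.extendOfIsLattice K) v (β.isUltranorm.nonneg v) fun i =>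
    le_trans (mul_le_mul_of_nonneg_left ?_ ((absVal R K).nonneg _))
      (isOrthogonal_stdNorm (b'.extendOfIsLattice K) S' k v i)
  by_cases hi : i ∈ S'
  · rw [stdNorm_basis_mem _ _ hi, Module.Basis.extendOfIsLattice_apply, stdNorm_le_one_iff hπ]
    intro j hj
    have h1 : (1 : R ⧸ Ideal.span {π ^ m}) ⊗ₜ[R] b' i ∈ redSpan (Ideal.span {π ^ m}) b S :=
      h (Submodule.subset_span ⟨i, hi, by simp⟩)
    exact (pow_dvd_pow π hkm).trans
      (Ideal.mem_span_singleton.1 (tmul_mem_redSpan_iff.1 h1 j hj))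
  · rw [stdNorm_basis_not_mem _ _ hi]
    refine (stdNorm_le _ S (Nat.cast_nonneg k) _).trans (le_of_eq ?_)
    rw [stdNorm_zero_eq (b := b) (b' := b') (S' := S'), stdNorm_zero_basis, mul_one]

/-- On vectors of norm `1` for `M` both norms are at least `1`, with equality on the basis vectors
in `S`, respectively `S'`. This normalization leaves no room for a homothety factor. -/
theorem stdNorm_eq_of_mk_eq {k : ℕ} (hS : S.Nonempty) (hS' : S'.Nonempty)
    (h : Building.mk (stdNorm R (b.extendOfIsLattice K) S k) =
      .mk (stdNorm R (b'.extendOfIsLattice K) S' k)) :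
    (stdNorm R (b.extendOfIsLattice K) S k).toFun =
      (stdNorm R (b'.extendOfIsLattice K) S' k).toFun := by
  obtain ⟨c, hc, hc'⟩ := Building.mk_eq_mk.1 h
  obtain ⟨i, hi⟩ := hS
  obtain ⟨j, hj⟩ := hS'
  have h1 : 1 ≤ c := by
    have := hc' (b.extendOfIsLattice K i)
    rw [stdNorm_basis_mem _ _ hi, mul_one] at this
    rw [← this]
    refine le_trans (le_of_eq ?_) (stdNorm_zero_le _ S' (Nat.cast_nonneg k) _)
    rw [stdNorm_zero_eq (b := b') (b' := b) (S' := S), stdNorm_zero_basis]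
  have h2 : c ≤ 1 := by
    have := hc' (b'.extendOfIsLattice K j)
    rw [stdNorm_basis_mem _ _ hj] at this
    rw [this]
    refine le_mul_of_one_le_right hc.le (le_trans (le_of_eq ?_)
      (stdNorm_zero_le _ S (Nat.cast_nonneg k) _))
    rw [stdNorm_zero_eq (b := b) (b' := b') (S' := S'), stdNorm_zero_basis]
  ext v
  rw [hc', le_antisymm h2 h1, one_mul]

theorem redSpan_le_of_stdNorm_eq (hπ : Irreducible π) {m : ℕ}
    (h : (stdNorm R (b.extendOfIsLattice K) S m).toFun =
      (stdNorm R (b'.extendOfIsLattice K) S' m).toFun) :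
    redSpan (Ideal.span {π ^ m}) b' S' ≤ redSpan (Ideal.span {π ^ m}) b S := by
  rw [redSpan, Submodule.span_le]
  rintro _ ⟨i, hi, rfl⟩
  rw [Module.Basis.baseChange_apply, SetLike.mem_coe, tmul_mem_redSpan_iff]
  intro j hj
  rw [Ideal.mem_span_singleton]
  refine (stdNorm_le_one_iff hπ m (b' i)).1 ?_ j hj
  rw [h, ← Module.Basis.extendOfIsLattice_apply (K := K), stdNorm_basis_mem _ _ hi]

/-- The last vertex alone determines the reduction. Conversely, the reduction modulo `π ^ m`
determines those modulo smaller powers, and with them the earlier vertices. -/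
theorem forall_mk_eq_iff (hπ : Irreducible π) (m : ℕ) (hS : S.Nonempty) (hS' : S'.Nonempty) :
    (∀ i : Fin (m + 1), Building.mk (stdNorm R (b.extendOfIsLattice K) S (i : ℕ)) =
      .mk (stdNorm R (b'.extendOfIsLattice K) S' (i : ℕ))) ↔
    redSpan (Ideal.span {π ^ m}) b S = redSpan (Ideal.span {π ^ m}) b' S' := by
  constructor
  · intro h
    have h1 := stdNorm_eq_of_mk_eq hS hS' (h (Fin.last m))
    exact le_antisymm (redSpan_le_of_stdNorm_eq hπ h1.symm) (redSpan_le_of_stdNorm_eq hπ h1)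
  · intro h i
    have hi : (i : ℕ) ≤ m := Nat.le_of_lt_succ i.2
    refine Building.mk_eq_mk.2 ⟨1, one_pos, fun v => ?_⟩
    rw [one_mul]
    exact le_antisymm (stdNorm_le_of_redSpan_le hπ hi h.le v)
      (stdNorm_le_of_redSpan_le hπ hi h.ge v)

end Segments

end LinearCycles

namespace LinearCycles

open CategoryTheory AlgebraicGeometry HomogeneousIdeal Limits
open scoped TensorProduct

/-! ### Ideal sheaves and scalars under base change -/

section ClosedImmersion
variable {X Y : Scheme.{u}}

/-- A closed immersion is a monomorphism, so the base change of `L.subschemeι ≫ f` along `f` is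
`L.subschemeι` again. Ideals on `ℙ(M) ⊗ R/I` can thus be handled after pushing them into `ℙ(M)`. -/
theorem comap_map_of_isClosedImmersion (L : X.IdealSheafData) (f : X ⟶ Y) [IsClosedImmersion f] :
    (L.map f).comap f = L := by
  rw [Scheme.IdealSheafData.map, ← Scheme.IdealSheafData.ker_fst_of_isClosedImmersion]
  have h : pullback.snd f (L.subschemeι ≫ f) ≫ L.subschemeι = pullback.fst f _ := by
    rw [← cancel_mono f, Category.assoc, pullback.condition]
  rw [← h, Scheme.Hom.ker_comp_of_isIso, Scheme.IdealSheafData.ker_subschemeι]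

theorem appLE_top_comp_app {P Z T : Scheme.{u}} {p : P ⟶ X} {f : X ⟶ Z} {q : P ⟶ T} {h : T ⟶ Z}
    (w : p ≫ f = q ≫ h) (U : X.Opens) (e : U ≤ f ⁻¹ᵁ ⊤) (e' : p ⁻¹ᵁ U ≤ q ⁻¹ᵁ ⊤) :
    f.appLE ⊤ U e ≫ p.app U = h.appTop ≫ q.appLE ⊤ (p ⁻¹ᵁ U) e' := by
  rw [Scheme.Hom.app_eq_appLE, Scheme.Hom.appLE_comp_appLE]
  have h1 : p ⁻¹ᵁ U ≤ (q ≫ h) ⁻¹ᵁ ⊤ := fun _ _ => trivial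
  have h2 : ∀ (k : P ⟶ Z) (hk : k = q ≫ h) (e₁ : p ⁻¹ᵁ U ≤ k ⁻¹ᵁ ⊤),
      k.appLE ⊤ (p ⁻¹ᵁ U) e₁ = (q ≫ h).appLE ⊤ (p ⁻¹ᵁ U) h1 := by
    rintro _ rfl _
    rfl
  rw [h2 _ w, Scheme.Hom.comp_appLE q h ⊤ (p ⁻¹ᵁ U) h1]
  rfl

theorem app_appLE_top_eq_zero {A B : CommRingCat.{u}} {g : A ⟶ B} {P : Scheme.{u}} {p : P ⟶ X}
    {f : X ⟶ Spec A} {q : P ⟶ Spec B} (w : p ≫ f = q ≫ Spec.map g) {r : A} (hr : g.hom r = 0)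
    (U : X.Opens) (e : U ≤ f ⁻¹ᵁ ⊤) :
    (p.app U).hom ((f.appLE ⊤ U e).hom ((Scheme.ΓSpecIso A).inv.hom r)) = 0 := by
  have e' : p ⁻¹ᵁ U ≤ q ⁻¹ᵁ ⊤ := fun _ _ => trivial
  have h2 : (Scheme.ΓSpecIso A).inv ≫ f.appLE ⊤ U e ≫ p.app U =
      g ≫ (Scheme.ΓSpecIso B).inv ≫ q.appLE ⊤ _ e' := by
    rw [appLE_top_comp_app w U e e', ← Scheme.ΓSpecIso_inv_naturality_assoc]
  have h3 := congr($(h2).hom r)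
  simp only [CommRingCat.hom_comp, RingHom.comp_apply] at h3
  rw [h3, hr, map_zero, map_zero]

theorem ΓSpecIso_inv_comp_appLE {A : CommRingCat.{u}} {f : X ⟶ Spec A} {U : X.Opens}
    {g : A ⟶ Γ(X, U)} (h : U.ι ≫ f = U.toSpecΓ ≫ Spec.map g) (e : U ≤ f ⁻¹ᵁ ⊤) :
    (Scheme.ΓSpecIso A).inv ≫ f.appLE ⊤ U e = g := by
  have h1 := congr(Scheme.Hom.appTop $h)
  rw [Scheme.Hom.comp_appTop, Scheme.Hom.comp_appTop, Scheme.Opens.toSpecΓ_appTop,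
    Scheme.ΓSpecIso_naturality_assoc, ← Iso.inv_comp_eq, ← Category.assoc,
    Iso.eq_comp_inv] at h1
  rw [← h1]
  simp only [Category.assoc]
  congr 1
  simp only [Scheme.Hom.appLE, Scheme.Opens.ι_appTop, Scheme.Opens.topIso]
  refine congrArg (Scheme.Hom.app f ⊤ ≫ ·) (Eq.trans ?_ (X.presheaf.map_comp _ _))
  rfl

end ClosedImmersion

/-! ### Sections and kernels on the charts of `Proj Sym` -/

section Charts
variable {A B : Type u} [CommRing A] [CommRing B] [Algebra A B]
  {E : Type u} [AddCommGroup E] [Module A E]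
  {F : Type u} [AddCommGroup F] [Module A F] [Module B F] [IsScalarTower A B F]

theorem ι_mem_symGrading (f : E) : SymmetricAlgebra.ι A E f ∈ symGrading A E 1 := by
  simp only [symGrading, pow_one]
  exact LinearMap.mem_range_self _ f

variable (A) in
/-- The affine chart `D₊(f)` of `Proj Sym_A E`. -/
noncomputable def chart (f : E) : (projSym A E).affineOpens :=
  ⟨Proj.basicOpen (symGrading A E) (SymmetricAlgebra.ι A E f),
    Proj.isAffineOpen_basicOpen _ _ (ι_mem_symGrading f) one_pos⟩

theorem irrelevant_le_span_ι : (irrelevant (symGrading A E)).toIdeal ≤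
    Ideal.span (Set.range (SymmetricAlgebra.ι A E)) := by
  rw [toIdeal_irrelevant_le]
  intro d hd x hx
  obtain ⟨d, rfl⟩ := Nat.exists_eq_succ_of_ne_zero hd.ne'
  change x ∈ symGrading A E _ at hx
  rw [symGrading, Nat.succ_eq_add_one, pow_succ'] at hx
  change x ∈ Ideal.span _
  induction hx using Submodule.mul_induction_on' with
  | mem_mul_mem m hm n hn => exact Ideal.mul_mem_right _ _ (Ideal.subset_span hm)
  | add x _ y _ hx hy => exact Ideal.add_mem _ hx hy

theorem iSup_chart : ⨆ f : E, (chart A f).1 = ⊤ :=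
  Proj.iSup_basicOpen_eq_top _ _ irrelevant_le_span_ι

variable (φ : E →ₗ[A] F) (hφ : Submodule.span B (Set.range φ) = ⊤)

theorem projSymMap_preimage_chart (f : E) :
    projSymMap φ hφ ⁻¹ᵁ (chart A f).1 = (chart B (φ f)).1 := by
  change Proj.map (symHom φ) (irrelevant_le_map_symHom φ hφ) ⁻¹ᵁ Proj.basicOpen _ _ = _
  rw [Proj.map_preimage_basicOpen, symHom_ι]
  rfl

/-- An affine morphism is quasi-compact, which allows its kernel to be computed chart by chart. -/
instance : IsAffineHom (projSymMap φ hφ) := by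
  apply isAffineHom_of_forall_exists_isAffineOpen
  intro x
  have hx : x ∈ ⨆ f : E, (chart A f).1 := by rw [iSup_chart]; trivial
  obtain ⟨f, hf⟩ := TopologicalSpace.Opens.mem_iSup.1 hx
  refine ⟨(chart A f).1, hf, (chart A f).2, ?_⟩
  rw [projSymMap_preimage_chart]
  exact (chart B (φ f)).2

/-- The section `a / f ^ k` on the chart `D₊(f)`. -/
noncomputable def fracSection (f : E) (k : ℕ) (a : SymmetricAlgebra A E)
    (ha : a ∈ symGrading A E k) : Γ(projSym A E, (chart A f).1) :=
  (Proj.awayToSection (symGrading A E) (SymmetricAlgebra.ι A E f)).hom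
    (HomogeneousLocalization.Away.mk (symGrading A E) (ι_mem_symGrading f) k a
      (by rwa [smul_eq_mul, mul_one]))

theorem exists_eq_fracSection (f : E) (s : Γ(projSym A E, (chart A f).1)) :
    ∃ k a ha, s = fracSection f k a ha := by
  let e := Proj.basicOpenIsoAway (symGrading A E) _ (ι_mem_symGrading f) one_pos
  obtain ⟨k, a, ha, h⟩ := HomogeneousLocalization.Away.mk_surjective (symGrading A E)
    (ι_mem_symGrading f) (e.inv.hom s)
  refine ⟨k, a, by rwa [smul_eq_mul, mul_one] at ha, ?_⟩
  change s = e.hom.hom _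
  rw [h]
  exact congr($(e.inv_hom_id).hom s).symm

theorem awayToSection_injective {t : SymmetricAlgebra A E} (ht : t ∈ symGrading A E 1) :
    Function.Injective (Proj.awayToSection (symGrading A E) t).hom := by
  let e := Proj.basicOpenIsoAway (symGrading A E) _ ht one_pos
  intro x y h
  have h' : e.hom.hom x = e.hom.hom y := h
  have h2 := congrArg e.inv.hom h'
  have h3 := fun x => congr($(e.hom_inv_id).hom x)
  simp only [CommRingCat.hom_comp, RingHom.comp_apply] at h3
  rwa [h3, h3] at h2

theorem awayToSection_mk_eq_zero_iff {t : SymmetricAlgebra A E} (ht : t ∈ symGrading A E 1) (k : ℕ)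
    (a : SymmetricAlgebra A E) (ha : a ∈ symGrading A E (k • 1)) :
    (Proj.awayToSection (symGrading A E) t).hom
      (HomogeneousLocalization.Away.mk (symGrading A E) ht k a ha) = 0 ↔ ∃ j, t ^ j * a = 0 := by
  rw [map_eq_zero_iff _ (awayToSection_injective ht),
    ← (HomogeneousLocalization.val_injective _).eq_iff, HomogeneousLocalization.val_zero,
    HomogeneousLocalization.Away.val_mk, Localization.mk_eq_mk', IsLocalization.mk'_eq_zero_iff]
  exact ⟨fun ⟨⟨_, j, rfl⟩, h⟩ => ⟨j, h⟩, fun ⟨j, h⟩ => ⟨⟨_, j, rfl⟩, h⟩⟩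

theorem app_fracSection (f : E) (k : ℕ) (a : SymmetricAlgebra A E)
    (ha : a ∈ symGrading A E k) :
    ((projSymMap φ hφ).app (chart A f).1).hom (fracSection f k a ha) =
      (Proj.awayToSection (symGrading B F) (symHom φ (SymmetricAlgebra.ι A E f))).hom
        (HomogeneousLocalization.Away.mk (symGrading B F)
          ((symHom (B := B) φ).map_mem (ι_mem_symGrading f)) k (symHom φ a)
          ((symHom (B := B) φ).map_mem (by rwa [smul_eq_mul, mul_one]))) := by
  have key := congr($(Proj.awayToSection_comp_appLE (symHom (B := B) φ)
    (irrelevant_le_map_symHom φ hφ) (ι_mem_symGrading f)).hom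
      (HomogeneousLocalization.Away.mk (symGrading A E) (ι_mem_symGrading f) k a
        (by rwa [smul_eq_mul, mul_one])))
  simp only [CommRingCat.hom_comp, RingHom.comp_apply, CommRingCat.hom_ofHom,
    HomogeneousLocalization.Away.map_mk] at key
  rw [Scheme.Hom.app_eq_appLE]
  exact key

/-- The power `j` comes from the localization at the image of `f`;
`exists_eq_fracSection_of_mem_ker` absorbs it by expanding the fraction. -/
theorem fracSection_mem_ker (f : E) (k : ℕ) (a : SymmetricAlgebra A E)
    (ha : a ∈ symGrading A E k) :
    fracSection f k a ha ∈ (projSymMap φ hφ).ker.ideal (chart A f) ↔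
      ∃ j, symHom (B := B) φ (SymmetricAlgebra.ι A E f ^ j * a) = 0 := by
  rw [Scheme.Hom.ker_apply, RingHom.mem_ker, app_fracSection]
  simp only [map_mul, map_pow]
  exact awayToSection_mk_eq_zero_iff _ k _ _

theorem exists_eq_fracSection_of_mem_ker {f : E} {s : Γ(projSym A E, (chart A f).1)}
    (hs : s ∈ (projSymMap φ hφ).ker.ideal (chart A f)) :
    ∃ k a ha, s = fracSection f k a ha ∧ symHom (B := B) φ a = 0 := by
  obtain ⟨k, a, ha, rfl⟩ := exists_eq_fracSection f s
  obtain ⟨j, hj⟩ := (fracSection_mem_ker φ hφ f k a ha).1 hs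
  have hm : SymmetricAlgebra.ι A E f ^ j * a ∈ symGrading A E (j + k) := by
    have := SetLike.pow_mem_graded j (ι_mem_symGrading (A := A) f)
    rw [smul_eq_mul, mul_one] at this
    exact SetLike.mul_mem_graded this ha
  refine ⟨j + k, _, hm, ?_, hj⟩
  unfold fracSection
  congr 1
  ext
  rw [HomogeneousLocalization.Away.val_mk, HomogeneousLocalization.Away.val_mk,
    Localization.mk_eq_mk_iff, Localization.r_iff_exists]
  exact ⟨1, by simp only [OneMemClass.coe_one, one_mul, pow_add]; ring⟩

theorem fracSection_add (f : E) (k : ℕ) (a b : SymmetricAlgebra A E)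
    (ha : a ∈ symGrading A E k) (hb : b ∈ symGrading A E k) :
    fracSection f k (a + b) (add_mem ha hb) = fracSection f k a ha + fracSection f k b hb := by
  have h : HomogeneousLocalization.Away.mk (symGrading A E) (ι_mem_symGrading (A := A) f) k (a + b)
      (by rw [smul_eq_mul, mul_one]; exact add_mem ha hb) =
      HomogeneousLocalization.Away.mk (symGrading A E) (ι_mem_symGrading f) k a
        (by rwa [smul_eq_mul, mul_one]) +
      HomogeneousLocalization.Away.mk (symGrading A E) (ι_mem_symGrading f) k b
        (by rwa [smul_eq_mul, mul_one]) := by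
    ext
    rw [HomogeneousLocalization.val_add]
    simp only [HomogeneousLocalization.Away.val_mk]
    rw [Localization.add_mk_self]
  exact (congrArg (Proj.awayToSection (symGrading A E) _).hom h).trans (map_add _ _ _)

/-- The image of a scalar among the sections on a chart. -/
noncomputable def scalarSection (f : E) (r : A) : Γ(projSym A E, (chart A f).1) :=
  ((projSymToSpec A E).appLE ⊤ (chart A f).1 (fun _ _ => trivial)).hom
    ((Scheme.ΓSpecIso (.of A)).inv.hom r)

theorem scalarSection_eq (f : E) (r : A) :
    scalarSection f r = (Proj.awayToSection (symGrading A E) (SymmetricAlgebra.ι A E f)).hom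
      (HomogeneousLocalization.fromZeroRingHom (symGrading A E) _
        (algebraMap A (symGrading A E 0) r)) := by
  have h : (Proj.basicOpen (symGrading A E) (SymmetricAlgebra.ι A E f)).ι ≫
      Proj.toSpecZero (symGrading A E) ≫
        Spec.map (CommRingCat.ofHom (algebraMap A (symGrading A E 0))) =
      (Proj.basicOpen (symGrading A E) (SymmetricAlgebra.ι A E f)).toSpecΓ ≫
        Spec.map (CommRingCat.ofHom (algebraMap A (symGrading A E 0)) ≫
          CommRingCat.ofHom (HomogeneousLocalization.fromZeroRingHom (symGrading A E) _) ≫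
          Proj.awayToSection (symGrading A E) (SymmetricAlgebra.ι A E f)) := by
    have h1 := Proj.awayι_toSpecZero (symGrading A E) _ (ι_mem_symGrading (A := A) f) one_pos
    rw [Proj.awayι, Category.assoc, Iso.inv_comp_eq, Proj.basicOpenIsoSpec_hom,
      Proj.basicOpenToSpec, Category.assoc] at h1
    rw [reassoc_of% h1, Spec.map_comp, Spec.map_comp, Category.assoc]
  exact congr($(ΓSpecIso_inv_comp_appLE h (fun _ _ => trivial)).hom r)

theorem fracSection_smul (f : E) (k : ℕ) (r : A) (a : SymmetricAlgebra A E)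
    (ha : a ∈ symGrading A E k) :
    fracSection f k (r • a) (Submodule.smul_mem _ r ha) =
      scalarSection f r * fracSection f k a ha := by
  rw [scalarSection_eq]
  have h : HomogeneousLocalization.Away.mk (symGrading A E) (ι_mem_symGrading (A := A) f) k (r • a)
      (by rw [smul_eq_mul, mul_one]; exact Submodule.smul_mem _ r ha) =
      HomogeneousLocalization.fromZeroRingHom (symGrading A E) _
        (algebraMap A (symGrading A E 0) r) *
      HomogeneousLocalization.Away.mk (symGrading A E) (ι_mem_symGrading f) k a
        (by rwa [smul_eq_mul, mul_one]) := by
    ext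
    rw [HomogeneousLocalization.val_mul]
    simp only [HomogeneousLocalization.Away.val_mk]
    exact (congrArg₂ Localization.mk (Algebra.smul_def r a) (Subtype.ext (one_mul _).symm)).trans
      (Localization.mk_mul _ _ _ _).symm
  exact (congrArg (Proj.awayToSection (symGrading A E) _).hom h).trans (map_mul _ _ _)

end Charts
open scoped DirectSum Graded

/-! ### Symmetric algebras in adapted coordinates -/

section Coordinates
variable {A : Type u} [CommRing A] {E : Type u} [AddCommGroup E] [Module A E]
  {n : Type*} [DecidableEq n] (c : Module.Basis n A E) (S : Finset n)

/-- The homomorphism from `Sym_A E` to a polynomial ring which sends the basis vectors with index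
in `S` to the variables and the others to zero. -/
noncomputable def coordHom : SymmetricAlgebra A E →ₐ[A] MvPolynomial S A :=
  SymmetricAlgebra.lift (c.constr A fun i => if h : i ∈ S then MvPolynomial.X ⟨i, h⟩ else 0)

/-- The section of `coordHom` which sends the variables to the basis vectors. -/
noncomputable def coordSection : MvPolynomial S A →ₐ[A] SymmetricAlgebra A E :=
  MvPolynomial.aeval fun i => SymmetricAlgebra.ι A E (c i)

theorem coordHom_ι (i : n) : coordHom c S (SymmetricAlgebra.ι A E (c i)) =
    if h : i ∈ S then MvPolynomial.X ⟨i, h⟩ else 0 := by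
  simp [coordHom]

theorem coordHom_coordSection (p : MvPolynomial S A) : coordHom c S (coordSection c S p) = p := by
  have : (coordHom c S).comp (coordSection c S) = AlgHom.id A _ := by
    ext i
    simp [coordSection, coordHom_ι]
  exact congr($this p)

/-- The composite is induced by the projection `q` of `E` onto the span of the `c i` with `i ∈ S`,
so it preserves degrees. -/
theorem coordSection_coordHom_mem {k : ℕ} {x : SymmetricAlgebra A E} (hx : x ∈ symGrading A E k) :
    coordSection c S (coordHom c S x) ∈ symGrading A E k := by
  let q : E →ₗ[A] E := c.constr A fun i => if i ∈ S then c i else 0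
  have h : (coordSection c S).comp (coordHom c S) =
      SymmetricAlgebra.lift ((SymmetricAlgebra.ι A E).comp q) := by
    refine SymmetricAlgebra.algHom_ext (c.ext fun i => ?_)
    by_cases hi : i ∈ S <;> simp [coordHom_ι, coordSection, q, hi]
  have h' : coordSection c S (coordHom c S x) = symHom (B := A) q x := congr($h x)
  rw [h']
  exact (symHom (B := A) q).map_mem hx

variable {B : Type u} [CommRing B] [Algebra A B]
  {F : Type u} [AddCommGroup F] [Module A F] [Module B F] [IsScalarTower A B F]
  {c S} {φ : E →ₗ[A] F} {d : Module.Basis S B F}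

theorem equivMvPolynomial_symHom (hφ : ∀ i, φ (c i) = if h : i ∈ S then d ⟨i, h⟩ else 0)
    (x : SymmetricAlgebra A E) :
    SymmetricAlgebra.equivMvPolynomial d (symHom (B := B) φ x) =
      MvPolynomial.map (algebraMap A B) (coordHom c S x) := by
  have h : ((SymmetricAlgebra.equivMvPolynomial d).toAlgHom.restrictScalars A).comp
      (SymmetricAlgebra.lift (((SymmetricAlgebra.ι B F).restrictScalars A).comp φ)) =
      (MvPolynomial.mapAlgHom (Algebra.ofId A B)).comp (coordHom c S) := by
    refine SymmetricAlgebra.algHom_ext (c.ext fun i => ?_)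
    by_cases hi : i ∈ S <;> simp [coordHom_ι, hφ, hi]
  exact congr($h x)

/-- In coordinates `symHom φ` is `coordHom` followed by `A → B` on coefficients, whose kernel is
`(r)`. With `r = 0` this covers `K`, with `r = π ^ m` it covers `R / π ^ m`. -/
theorem symHom_eq_zero_iff (hφ : ∀ i, φ (c i) = if h : i ∈ S then d ⟨i, h⟩ else 0)
    {r : A} (hr : ∀ a, algebraMap A B a = 0 ↔ r ∣ a) (x : SymmetricAlgebra A E) :
    symHom (B := B) φ x = 0 ↔ MvPolynomial.C r ∣ coordHom c S x := by
  rw [MvPolynomial.C_dvd_iff_map_hom_eq_zero _ _ hr, ← equivMvPolynomial_symHom hφ]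
  exact (EmbeddingLike.map_eq_zero_iff (f := SymmetricAlgebra.equivMvPolynomial d)).symm

/-- `y` is `x` minus its part in the variables of `S`, and that part is divisible by `r`. The
quotient `p` is not known to be homogeneous, so `z` is its component of degree `k`. -/
theorem exists_eq_add_smul {r : A} {k : ℕ} {x : SymmetricAlgebra A E} (hx : x ∈ symGrading A E k)
    (h : MvPolynomial.C r ∣ coordHom c S x) :
    ∃ y ∈ symGrading A E k, ∃ z ∈ symGrading A E k, x = y + r • z ∧ coordHom c S y = 0 := by
  obtain ⟨p, hp⟩ := h
  have h1 : coordSection c S (coordHom c S x) = r • coordSection c S p := by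
    rw [hp, MvPolynomial.C_mul', map_smul]
  have hm := coordSection_coordHom_mem c S hx
  refine ⟨x - coordSection c S (coordHom c S x), sub_mem hx hm,
    DirectSum.decompose (symGrading A E) (coordSection c S p) k, SetLike.coe_mem _, ?_, ?_⟩
  · have h2 := DirectSum.decompose_of_mem_same _ hm
    rw [h1, DirectSum.decompose_smul, DirectSum.smul_apply, Submodule.coe_smul] at h2
    rw [h1, h2, sub_add_cancel]
  · rw [map_sub, coordHom_coordSection, sub_self]

end Coordinates

/-! ### Comparison of kernels over different base rings -/

section Kernels
variable {A : Type u} [CommRing A] {E : Type u} [AddCommGroup E] [Module A E]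
  {n : Type*} [DecidableEq n] {c : Module.Basis n A E} {S : Finset n}
  {B : Type u} [CommRing B] [Algebra A B]
  {F : Type u} [AddCommGroup F] [Module A F] [Module B F] [IsScalarTower A B F]
  {φ : E →ₗ[A] F} {d : Module.Basis S B F}
  {C : Type u} [CommRing C] [Algebra A C]
  {G : Type u} [AddCommGroup G] [Module A G] [Module C G] [IsScalarTower A C G]
  {ψ : E →ₗ[A] G} {d' : Module.Basis S C G}

theorem ker_projSymMap_le_ker (hφ : ∀ i, φ (c i) = if h : i ∈ S then d ⟨i, h⟩ else 0)
    (hψ : ∀ i, ψ (c i) = if h : i ∈ S then d' ⟨i, h⟩ else 0)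
    {r s : A} (hr : ∀ a, algebraMap A B a = 0 ↔ r ∣ a) (hs : ∀ a, algebraMap A C a = 0 ↔ s ∣ a)
    (hsr : s ∣ r) (hφ' hψ') :
    (projSymMap (B := B) φ hφ').ker ≤ (projSymMap (B := C) ψ hψ').ker := by
  refine Scheme.IdealSheafData.le_of_iSup_eq_top (chart A) iSup_chart fun f x hx => ?_
  obtain ⟨k, a, ha, rfl, h⟩ := exists_eq_fracSection_of_mem_ker φ hφ' hx
  rw [fracSection_mem_ker]
  refine ⟨0, ?_⟩
  rw [pow_zero, one_mul, symHom_eq_zero_iff hψ hs]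
  rw [symHom_eq_zero_iff hφ hr] at h
  exact (map_dvd MvPolynomial.C hsr).trans h

/-- A numerator whose relevant coefficients are divisible by `s` is `y + s z`, with `y` in the
kernel for `φ` whatever `r` is; and `s` vanishes on `P`. So modulo `s` the subscheme of `φ` is
contained in that of `ψ`. -/
theorem ker_projSymMap_le_sup (hφ : ∀ i, φ (c i) = if h : i ∈ S then d ⟨i, h⟩ else 0)
    (hψ : ∀ i, ψ (c i) = if h : i ∈ S then d' ⟨i, h⟩ else 0)
    {r s : A} (hr : ∀ a, algebraMap A B a = 0 ↔ r ∣ a) (hs : ∀ a, algebraMap A C a = 0 ↔ s ∣ a)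
    {D : CommRingCat.{u}} {g : .of A ⟶ D} (hg : g.hom s = 0) {P : Scheme.{u}}
    {p : P ⟶ projSym A E} [QuasiCompact p] {q : P ⟶ Spec D}
    (w : p ≫ projSymToSpec A E = q ≫ Spec.map g) (hφ' hψ') :
    (projSymMap (B := C) ψ hψ').ker ≤ (projSymMap (B := B) φ hφ').ker ⊔ p.ker := by
  refine Scheme.IdealSheafData.le_of_iSup_eq_top (chart A) iSup_chart fun f x hx => ?_
  obtain ⟨k, a, ha, rfl, h⟩ := exists_eq_fracSection_of_mem_ker ψ hψ' hx
  rw [symHom_eq_zero_iff hψ hs] at h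
  obtain ⟨y, hy, z, hz, rfl, h0⟩ := exists_eq_add_smul ha h
  rw [fracSection_add f k y (s • z) hy (Submodule.smul_mem _ s hz), fracSection_smul f k s z hz,
    Scheme.IdealSheafData.ideal_sup]
  refine Submodule.add_mem_sup ?_ ?_
  · rw [fracSection_mem_ker]
    refine ⟨0, ?_⟩
    rw [pow_zero, one_mul, symHom_eq_zero_iff hφ hr, h0]
    exact dvd_zero _
  · refine Ideal.mul_mem_right _ _ ?_
    rw [Scheme.Hom.ker_apply, RingHom.mem_ker]
    exact app_appLE_top_eq_zero w hg _ _

end Kernels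
-- Dual bases of coordinate subspaces
section SpanBasis
variable {B : Type*} [CommRing B] {V : Type*} [AddCommGroup V] [Module B V]
  {n : Type*}

/-- A part of a basis, as a basis of its span. -/
noncomputable def spanBasis (e : Module.Basis n B V) (S : Finset n) :
    Module.Basis S B (Submodule.span B (e '' (S : Set n))) :=
  (Module.Basis.span (e.linearIndependent.comp _ (Subtype.val_injective (p := (· ∈ S))))).map
    (LinearEquiv.ofEq _ _ (by rw [Set.range_comp]; simp))

theorem spanBasis_apply (e : Module.Basis n B V) (S : Finset n) (i : S) :
    (spanBasis e S i : V) = e i := by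
  simp [spanBasis, Module.Basis.span_apply]

theorem eq_dite_dualBasis [DecidableEq n] {e : Module.Basis n B V} {S : Finset n} {i : n}
    {f : Module.Dual B (Submodule.span B (e '' (S : Set n)))}
    (h : ∀ j, f (spanBasis e S j) = if (j : n) = i then 1 else 0) :
    f = if h : i ∈ S then (spanBasis e S).dualBasis ⟨i, h⟩ else 0 := by
  refine (spanBasis e S).ext fun j => ?_
  rw [h]
  by_cases hi : i ∈ S
  · rw [dif_pos hi, Module.Basis.dualBasis_apply_self]
    simp only [Subtype.ext_iff]
  · rw [dif_neg hi, if_neg]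
    · rfl
    · rintro rfl
      exact hi j.2

/-- The ring `B` may have zero divisors, as `R / π ^ m` does, but a power of a variable is regular
in any polynomial ring. -/
theorem eq_zero_of_ι_pow_mul_ι_eq_zero (d : Module.Basis n B V) (i : n) (j : ℕ) {f : V}
    (h : SymmetricAlgebra.ι B V (d i) ^ j * SymmetricAlgebra.ι B V f = 0) : f = 0 := by
  classical
  have h1 := congrArg (SymmetricAlgebra.equivMvPolynomial d) h
  rw [map_mul, map_pow, map_zero, SymmetricAlgebra.equivMvPolynomial_ι_apply] at h1
  have h2 : SymmetricAlgebra.equivMvPolynomial d (SymmetricAlgebra.ι B V f) = 0 :=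
    (MvPolynomial.isRegular_X_pow j).left (h1.trans (mul_zero _).symm)
  refine d.repr.map_eq_zero_iff.1 (Finsupp.ext fun k => ?_)
  have h3 : (MvPolynomial.lcoeff B (Finsupp.single k 1)).comp
      ((SymmetricAlgebra.equivMvPolynomial d).toLinearMap.comp (SymmetricAlgebra.ι B V)) =
      d.coord k := by
    refine d.ext fun m => ?_
    simp [MvPolynomial.coeff_X, Finsupp.single_left_inj, Finsupp.single_apply, eq_comm]
  rw [← Module.Basis.coord_apply, ← h3]
  simp [h2]

end SpanBasis

/-! ### Recovering a split submodule from its linear cycle -/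

section Reduction
variable {R : Type u} [CommRing R] {M : Type u} [AddCommGroup M] [Module R M] {n : ℕ} {I : Ideal R}
  {b : Module.Basis (Fin n) R M} {S : Finset (Fin n)}

theorem dualRestrictMod_dualBasis (i : Fin n) :
    dualRestrictMod (redSpan I b S) (b.dualBasis i) =
      if h : i ∈ S then (spanBasis (b.baseChange (R ⧸ I)) S).dualBasis ⟨i, h⟩ else 0 := by
  refine eq_dite_dualBasis fun j => ?_
  change Module.Dual.baseChange (R ⧸ I) (b.dualBasis i) (spanBasis (b.baseChange (R ⧸ I)) S j) = _
  rw [spanBasis_apply]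
  simp [Module.Dual.baseChange, Finsupp.single_apply]

theorem exists_isCompl_redSpan : ∃ N', IsCompl (redSpan I b S) N' := by
  refine ⟨redSpan I b Sᶜ, ?_⟩
  unfold redSpan
  rw [Finset.coe_compl]
  refine ⟨(b.baseChange (R ⧸ I)).linearIndependent.disjoint_span_image disjoint_compl_right, ?_⟩
  rw [codisjoint_iff, ← Submodule.span_union, ← Set.image_union, Set.union_compl_self,
    Set.image_univ, Module.Basis.span_eq]

theorem redSpan_ne_bot [Nontrivial (R ⧸ I)] (hS : S.Nonempty) : redSpan I b S ≠ ⊥ := by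
  obtain ⟨i, hi⟩ := hS
  intro h0
  have : b.baseChange (R ⧸ I) i ∈ redSpan I b S := Submodule.subset_span ⟨i, hi, rfl⟩
  rw [h0, Submodule.mem_bot] at this
  exact Module.Basis.ne_zero _ i this

theorem redSpan_ne_top [Nontrivial (R ⧸ I)] (hS : S ≠ Finset.univ) : redSpan I b S ≠ ⊤ := by
  obtain ⟨j, hj⟩ : ∃ j, j ∉ S := by
    by_contra! h'
    exact hS (Finset.eq_univ_iff_forall.2 h')
  intro h0
  have : b.baseChange (R ⧸ I) j ∈ redSpan I b S := h0 ▸ Submodule.mem_top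
  rw [mem_redSpan_iff] at this
  have := this j hj
  rw [Module.Basis.repr_self, Finsupp.single_eq_same] at this
  exact one_ne_zero this

theorem nonempty_of_redSpan_ne_bot (h : redSpan I b S ≠ ⊥) : S.Nonempty := by
  by_contra hS
  rw [Finset.not_nonempty_iff_eq_empty] at hS
  exact h (by simp [redSpan, hS])

theorem ne_univ_of_redSpan_ne_top (h : redSpan I b S ≠ ⊤) : S ≠ Finset.univ := by
  rintro rfl
  exact h (by rw [redSpan, Finset.coe_univ, Set.image_univ, Module.Basis.span_eq])

variable [Module.Free R M] [Module.Finite R M]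

theorem map_linearCycleMod {N : Submodule (R ⧸ I) ((R ⧸ I) ⊗[R] M)} (hN : ∃ N', IsCompl N N') :
    (linearCycleMod N hN).map (pullback.fst _ _) =
      (projSymMap (dualRestrictMod N) (span_range_dualRestrictMod hN)).ker := by
  rw [linearCycleMod, Scheme.IdealSheafData.map_ker, pullback.lift_fst]

/-- A linear form on `M` which vanishes on `N₁` vanishes on every `N₂` with the same linear
cycle. -/
theorem dualRestrictMod_eq_zero_of_linearCycleMod_eq
    {N : Submodule (R ⧸ I) ((R ⧸ I) ⊗[R] M)} (hN : ∃ N', IsCompl N N')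
    (h : linearCycleMod N hN = linearCycleMod (redSpan I b S) exists_isCompl_redSpan)
    (hS : S.Nonempty) {l : Module.Dual R M} (hl : dualRestrictMod N l = 0) :
    dualRestrictMod (redSpan I b S) l = 0 := by
  obtain ⟨i, hi⟩ := hS
  have hk := congrArg (fun L => Scheme.IdealSheafData.map L (pullback.fst _ _)) h
  simp only [map_linearCycleMod] at hk
  -- On the chart of a coordinate with `i ∈ S`, the quotient of `l` by this coordinate lies in the
  -- ideal of the first cycle, hence of the second, where the coordinate restricts to a variable.
  have h1 : fracSection (b.dualBasis i) 1 (SymmetricAlgebra.ι R _ l) (ι_mem_symGrading l) ∈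
      (projSymMap (dualRestrictMod N) (span_range_dualRestrictMod hN)).ker.ideal
        (chart R (b.dualBasis i)) := by
    rw [fracSection_mem_ker]
    exact ⟨0, by rw [pow_zero, one_mul, symHom_ι, hl, map_zero]⟩
  rw [hk, fracSection_mem_ker] at h1
  obtain ⟨j, hj⟩ := h1
  rw [map_mul, map_pow, symHom_ι, symHom_ι, dualRestrictMod_dualBasis, dif_pos hi] at hj
  exact eq_zero_of_ι_pow_mul_ι_eq_zero (spanBasis (b.baseChange (R ⧸ I)) S).dualBasis _ j hj

variable {b' : Module.Basis (Fin n) R M} {S' : Finset (Fin n)}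

/-- `redSpan I b' S'` is cut out by the coordinates of `b'` outside `S'`, and these forms vanish on
`redSpan I b S` as well. -/
theorem redSpan_le_of_linearCycleMod_eq
    (h : linearCycleMod (redSpan I b' S') exists_isCompl_redSpan =
      linearCycleMod (redSpan I b S) exists_isCompl_redSpan)
    (hS : S.Nonempty) : redSpan I b S ≤ redSpan I b' S' := by
  intro v hv
  rw [mem_redSpan_iff]
  intro i hi
  have h1 : dualRestrictMod (redSpan I b' S') (b'.dualBasis i) = 0 := by
    rw [dualRestrictMod_dualBasis, dif_neg hi]
    rfl
  have h2 := congr($(dualRestrictMod_eq_zero_of_linearCycleMod_eq _ h hS h1) ⟨v, hv⟩)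
  have h3 : Module.Dual.baseChange (R ⧸ I) (b'.dualBasis i) = (b'.baseChange (R ⧸ I)).coord i := by
    refine (b'.baseChange (R ⧸ I)).ext fun j => ?_
    simp [Module.Dual.baseChange, Finsupp.single_apply]
  have h4 : Module.Dual.baseChange (R ⧸ I) (b'.dualBasis i) v = 0 := h2
  rwa [h3] at h4

theorem linearCycleMod_redSpan_inj (hS : S.Nonempty) (hS' : S'.Nonempty) :
    linearCycleMod (redSpan I b S) exists_isCompl_redSpan =
      linearCycleMod (redSpan I b' S') exists_isCompl_redSpan ↔
    redSpan I b S = redSpan I b' S' := by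
  constructor
  · intro h
    exact le_antisymm (redSpan_le_of_linearCycleMod_eq h.symm hS)
      (redSpan_le_of_linearCycleMod_eq h hS')
  · intro h
    simp only [h]

end Reduction
-- The reduction of the closure
section Closure
variable {R : Type u} [CommRing R] [IsDomain R] [IsPrincipalIdealRing R]
  {K : Type u} [Field K] [Algebra R K] [IsFractionRing R K]
  {V : Type u} [AddCommGroup V] [Module K V] [Module R V] [IsScalarTower R K V]
  {M : Submodule R V} [M.IsLattice K]

/-- The map `M^* → W^*` which restricts the `K`-linear extension of a linear form on `M` to `W`. -/
noncomputable def restrictExtendDual (M : Submodule R V) [M.IsLattice K] (W : Submodule K V) :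
    Module.Dual R M →ₗ[R] Module.Dual K W :=
  (W.dualRestrict.restrictScalars R).comp (extendDual K M)

theorem span_range_restrictExtendDual (W : Submodule K V) :
    Submodule.span K (Set.range (restrictExtendDual M W)) = ⊤ := by
  have : Set.range (restrictExtendDual M W) = W.dualRestrict '' Set.range (extendDual K M) := by
    rw [← Set.range_comp]
    rfl
  rw [this, Submodule.span_image, span_range_extendDual, Submodule.map_top, LinearMap.range_eq_top]
  exact Subspace.dualRestrict_surjective

/-- By functoriality of `Proj` the composite `ℙ(W) ⟶ ℙ(V) ⟶ ℙ(M)` comes from a single graded ring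
map, to which the chart computations apply. -/
theorem cycleClosure_eq_ker (W : Submodule K V) : cycleClosure M W =
    (projSymMap (restrictExtendDual M W) (span_range_restrictExtendDual W)).ker := by
  rw [cycleClosure]
  congr 1
  have h : symHom (B := K) (restrictExtendDual M W) =
      (symHom (B := K) W.dualRestrict).comp (symHom (B := K) (extendDual K M)) := by
    have h' : SymmetricAlgebra.lift (((SymmetricAlgebra.ι K (Module.Dual K W)).restrictScalars R).comp
        (restrictExtendDual M W)) =
        ((SymmetricAlgebra.lift (((SymmetricAlgebra.ι K (Module.Dual K W)).restrictScalars K).comp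
          W.dualRestrict)).restrictScalars R).comp
        (SymmetricAlgebra.lift (((SymmetricAlgebra.ι K (Module.Dual K V)).restrictScalars R).comp
          (extendDual K M))) := by
      refine SymmetricAlgebra.algHom_ext (LinearMap.ext fun l => ?_)
      simp [restrictExtendDual]
    exact GradedRingHom.ext fun x => congr($h' x)
  have := Proj.map_comp (symHom (B := K) (extendDual K M)) (symHom (B := K) W.dualRestrict)
    (irrelevant_le_map_symHom _ (span_range_extendDual K M))
    (irrelevant_le_map_symHom _ (by
      rw [Set.range_eq_univ.2 (Subspace.dualRestrict_surjective), Submodule.span_univ]))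
  refine this.symm.trans ?_
  unfold projSymMap
  simp only [h]

variable {n : ℕ} {b : Module.Basis (Fin n) R M} {S : Finset (Fin n)}

theorem restrictExtendDual_dualBasis (i : Fin n) :
    restrictExtendDual M (basisSpan K b S) (b.dualBasis i) =
      if h : i ∈ S then (spanBasis (b.extendOfIsLattice K) S).dualBasis ⟨i, h⟩ else 0 := by
  refine eq_dite_dualBasis fun j => ?_
  change extendDual K M (b.dualBasis i) (spanBasis (b.extendOfIsLattice K) S j) = _
  rw [spanBasis_apply, Module.Basis.extendOfIsLattice_apply, extendDual_apply]
  simp [Finsupp.single_apply]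

/-- The reduction of the closure of a linear cycle is a linear cycle. -/
theorem cycleReduction_basisSpan (r : R) : cycleReduction M (basisSpan K b S) (Ideal.span {r}) =
    linearCycleMod (redSpan (Ideal.span {r}) b S) exists_isCompl_redSpan := by
  set I := Ideal.span {r}
  set p := pullback.fst (projSymToSpec R (Module.Dual R M))
    (Spec.map (CommRingCat.ofHom (algebraMap R (R ⧸ I))))
  have : IsClosedImmersion (Spec.map (CommRingCat.ofHom (algebraMap R (R ⧸ I)))) :=
    IsClosedImmersion.spec_of_surjective _ Ideal.Quotient.mk_surjective
  have hK : ∀ a : R, algebraMap R K a = 0 ↔ (0 : R) ∣ a := fun a => by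
    rw [zero_dvd_iff, FaithfulSMul.algebraMap_eq_zero_iff]
  have hI : ∀ a : R, algebraMap R (R ⧸ I) a = 0 ↔ r ∣ a := fun a => by
    rw [Ideal.Quotient.algebraMap_eq, Ideal.Quotient.eq_zero_iff_mem, Ideal.mem_span_singleton]
  rw [← comap_map_of_isClosedImmersion (linearCycleMod _ _) p, map_linearCycleMod, cycleReduction,
    cycleClosure_eq_ker]
  refine le_antisymm (Scheme.IdealSheafData.comap_mono _ ?_) ?_
  · exact ker_projSymMap_le_ker restrictExtendDual_dualBasis dualRestrictMod_dualBasis hK hI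
      (dvd_zero r) _ _
  -- The ideal of the cycle lies in the sum of the ideal of the closure and that of `p`, and the
  -- latter pulls back to zero along `p`.
  · have h : (projSymMap (dualRestrictMod (redSpan I b S))
        (span_range_dualRestrictMod exists_isCompl_redSpan)).ker ≤
        (projSymMap (restrictExtendDual M (basisSpan K b S))
          (span_range_restrictExtendDual _)).ker ⊔ p.ker :=
      ker_projSymMap_le_sup restrictExtendDual_dualBasis dualRestrictMod_dualBasis hK hI
        (g := CommRingCat.ofHom (algebraMap R (R ⧸ I))) ((hI r).2 dvd_rfl) pullback.condition _ _
    refine (Scheme.IdealSheafData.comap_mono p h).trans ?_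
    simp only [Scheme.IdealSheafData.comap_sup]
    refine sup_le le_rfl ?_
    rw [← Scheme.IdealSheafData.map_bot]
    exact (Scheme.IdealSheafData.comap_map_le _ _).trans bot_le

end Closure
end LinearCycles

namespace LinearCycles

open scoped TensorProduct

/-! ### Lifting split submodules over local rings -/

section Split
variable {B : Type*} [CommRing B] [IsLocalRing B] {E : Type*} [AddCommGroup E] [Module B E]

theorem finite_and_free_of_isCompl [Module.Finite B E] [Module.Free B E] {P Q : Submodule B E}
    (h : IsCompl P Q) : Module.Finite B P ∧ Module.Free B P := by
  have h1 : (P.projectionOnto Q h).comp P.subtype = LinearMap.id := by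
    ext x
    simp
  have : Module.Finite B P := .of_surjective (P.projectionOnto Q h) fun x => ⟨x, congr($h1 x)⟩
  have : Module.Projective B P := .of_split _ _ h1
  exact ⟨inferInstance, Module.free_of_flat_of_isLocalRing⟩

/-- Over a local ring every split submodule of a free module is spanned by a part of some basis. -/
theorem exists_basis_eq_span_image {n : ℕ} (b₀ : Module.Basis (Fin n) B E) {N N' : Submodule B E}
    (hN : IsCompl N N') : ∃ (β : Module.Basis (Fin n) B E) (S : Finset (Fin n)),
      N = Submodule.span B (β '' (S : Set (Fin n))) := by
  classical
  have : Module.Free B E := .of_basis b₀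
  have : Module.Finite B E := .of_basis b₀
  obtain ⟨_, _⟩ := finite_and_free_of_isCompl hN
  obtain ⟨_, _⟩ := finite_and_free_of_isCompl hN.symm
  let e := ((Module.Free.chooseBasis B N).prod (Module.Free.chooseBasis B N')).map
    (Submodule.prodEquivOfIsCompl N N' hN)
  let f := Fintype.equivFinOfCardEq ((Module.finrank_eq_card_basis e).symm.trans
    ((Module.finrank_eq_card_basis b₀).trans (Fintype.card_fin n)))
  refine ⟨e.reindex f, Finset.univ.image fun i => f (Sum.inl i), ?_⟩
  have h2 : (e.reindex f) '' ((Finset.univ.image fun i => f (Sum.inl i) : Finset (Fin n)) : Set _) =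
      N.subtype '' Set.range (Module.Free.chooseBasis B N) := by
    rw [Finset.coe_image, ← Set.image_comp, ← Set.range_comp, Finset.coe_univ, Set.image_univ]
    congr 1
    ext i
    simp [e]
  rw [h2, Submodule.span_image, Module.Basis.span_eq, Submodule.map_top, Submodule.range_subtype]

end Split

section Lifting
variable {R : Type u} [CommRing R] [IsLocalRing R] {M : Type u} [AddCommGroup M] [Module R M] {n : ℕ}
  {I : Ideal R}

/-- Over a local ring a basis of `M ⊗ R/I` lifts to a basis of `M`. -/
theorem exists_baseChange_eq [Nontrivial (R ⧸ I)] (b₀ : Module.Basis (Fin n) R M)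
    (β : Module.Basis (Fin n) (R ⧸ I) ((R ⧸ I) ⊗[R] M)) :
    ∃ b : Module.Basis (Fin n) R M, b.baseChange (R ⧸ I) = β := by
  choose v hv using fun i =>
    TensorProduct.mk_surjective R M (R ⧸ I) Ideal.Quotient.mk_surjective (β i)
  -- The determinant of the lifted vectors reduces to that of `β`, which is a unit, and `R → R / I`
  -- reflects units because `R` is local.
  have hdet : IsUnit (b₀.det v) := by
    have := IsLocalHom.of_surjective (Ideal.Quotient.mk I) Ideal.Quotient.mk_surjective
    refine isUnit_of_map_unit (Ideal.Quotient.mk I) _ ?_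
    have h := (b₀.baseChange (R ⧸ I)).isUnit_det β
    rw [Module.Basis.det_apply] at h ⊢
    rw [RingHom.map_det]
    convert h using 2
    ext i j
    rw [RingHom.mapMatrix_apply, Matrix.map_apply, Module.Basis.toMatrix_apply,
      Module.Basis.toMatrix_apply, ← hv, TensorProduct.mk_apply,
      Module.Basis.baseChange_repr_tmul, Algebra.smul_def, mul_one]
    rfl
  have hb := (Module.Basis.is_basis_iff_det b₀).2 hdet
  refine ⟨Module.Basis.mk hb.1 hb.2.ge, Module.Basis.eq_of_apply_eq fun i => ?_⟩
  rw [Module.Basis.baseChange_apply, Module.Basis.mk_apply]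
  exact hv i

/-- Over a local ring every split submodule of `M ⊗ R/I` is spanned by a part of some basis
of `M`. -/
theorem exists_redSpan_eq [Nontrivial (R ⧸ I)] (b₀ : Module.Basis (Fin n) R M)
    {N : Submodule (R ⧸ I) ((R ⧸ I) ⊗[R] M)} (hN : ∃ N', IsCompl N N') :
    ∃ (b : Module.Basis (Fin n) R M) (S : Finset (Fin n)), N = redSpan I b S := by
  obtain ⟨N', hN⟩ := hN
  have : IsLocalRing (R ⧸ I) :=
    IsLocalRing.of_surjective' (Ideal.Quotient.mk I) Ideal.Quotient.mk_surjective
  obtain ⟨β, S, h⟩ := exists_basis_eq_span_image (b₀.baseChange (R ⧸ I)) hN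
  obtain ⟨b, hb⟩ := exists_baseChange_eq b₀ β
  exact ⟨b, S, by rw [redSpan, hb, h]⟩

end Lifting
end LinearCycles

/-! ### The bijection -/

open LinearCycles

theorem proposition2p5 {R : Type u} [CommRing R] [IsDomain R] [IsDiscreteValuationRing R]
    [IsAdicComplete (IsLocalRing.maximalIdeal R) R] [Finite (IsLocalRing.ResidueField R)]
    {K : Type u} [Field K] [Algebra R K] [IsFractionRing R K]
    {V : Type u} [AddCommGroup V] [Module K V] [FiniteDimensional K V]
    [Module R V] [IsScalarTower R K V]
    (M : Submodule R V) [M.IsLattice K] (π : R) (hπ : Irreducible π) (m : ℕ) (hm : 1 ≤ m) :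
    -- the segment `[x, y_W]_m` is well defined
    (∀ W : Submodule K V, W ≠ ⊥ → W ≠ ⊤ →
      ∃! s, LinearCycles.IsInitialSegment (LinearCycles.vertex M) W m s) ∧
    -- the bijection
    (∃ Φ : LinearCycles.initialSegments (LinearCycles.vertex M) m →
        LinearCycles.linearCyclesMod R M (Ideal.span {π ^ m}),
      Function.Bijective Φ ∧
      ∀ (s : LinearCycles.initialSegments (LinearCycles.vertex M) m) (W : Submodule K V),
        W ≠ ⊥ → W ≠ ⊤ → LinearCycles.IsInitialSegment (LinearCycles.vertex M) W m s.1 →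
        (Φ s).1 = LinearCycles.cycleReduction M W (Ideal.span {π ^ m})) ∧
    -- segments coincide iff the reductions coincide
    (∀ W₁ W₂ : Submodule K V, W₁ ≠ ⊥ → W₁ ≠ ⊤ → W₂ ≠ ⊥ → W₂ ≠ ⊤ → ∀ s₁ s₂,
      LinearCycles.IsInitialSegment (LinearCycles.vertex M) W₁ m s₁ →
      LinearCycles.IsInitialSegment (LinearCycles.vertex M) W₂ m s₂ →
      (s₁ = s₂ ↔ LinearCycles.cycleReduction M W₁ (Ideal.span {π ^ m}) =
        LinearCycles.cycleReduction M W₂ (Ideal.span {π ^ m}))) := by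
  have hn : Module.finrank R M = Module.finrank K V := by
    rw [Module.finrank, Submodule.IsLattice.rank' K M, Module.finrank]
  -- Here `m ≥ 1` enters: `π ^ m` must not be a unit.
  have : Nontrivial (R ⧸ Ideal.span {π ^ m}) := by
    rw [Ideal.Quotient.nontrivial_iff, Ne, Ideal.span_singleton_eq_top, isUnit_pow_iff (by omega)]
    exact hπ.not_isUnit
  have hseg : ∀ (b : Module.Basis (Fin (Module.finrank K V)) R M) S, S.Nonempty →
      S ≠ Finset.univ → ∀ s, IsInitialSegment (vertex M) (basisSpan K b S) m s ↔
        ∀ i, s i = .mk (stdNorm R (b.extendOfIsLattice K) S (i : ℕ)) :=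
    fun b S h₁ h₂ s => isInitialSegment_iff (vertex_eq_stdNorm b S) h₁ h₂
  have hex : ∀ W : Submodule K V, W ≠ ⊥ → W ≠ ⊤ → ∃ (b : Module.Basis (Fin (Module.finrank K V)) R M) (S : Finset _),
      W = basisSpan K b S ∧ S.Nonempty ∧ S ≠ Finset.univ := by
    intro W h₁ h₂
    obtain ⟨b, S, rfl⟩ := exists_basisSpan_eq hn W
    exact ⟨b, S, rfl, nonempty_of_basisSpan_ne_bot h₁, ne_univ_of_basisSpan_ne_top h₂⟩
  have hwd : ∀ W : Submodule K V, W ≠ ⊥ → W ≠ ⊤ → ∃! s, IsInitialSegment (vertex M) W m s := by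
    intro W h₁ h₂
    obtain ⟨b, S, rfl, hS, hS'⟩ := hex W h₁ h₂
    refine ⟨fun i => .mk (stdNorm R (b.extendOfIsLattice K) S (i : ℕ)),
      (hseg b S hS hS' _).2 fun _ => rfl, fun s hs => funext ((hseg b S hS hS' s).1 hs)⟩
  have hiff : ∀ W₁ W₂ : Submodule K V, W₁ ≠ ⊥ → W₁ ≠ ⊤ → W₂ ≠ ⊥ → W₂ ≠ ⊤ → ∀ s₁ s₂,
      IsInitialSegment (vertex M) W₁ m s₁ → IsInitialSegment (vertex M) W₂ m s₂ →
      (s₁ = s₂ ↔ cycleReduction M W₁ (Ideal.span {π ^ m}) =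
        cycleReduction M W₂ (Ideal.span {π ^ m})) := by
    intro W₁ W₂ h₁ h₁' h₂ h₂' s₁ s₂ hs₁ hs₂
    obtain ⟨b₁, S₁, rfl, hS₁, hS₁'⟩ := hex W₁ h₁ h₁'
    obtain ⟨b₂, S₂, rfl, hS₂, hS₂'⟩ := hex W₂ h₂ h₂'
    rw [cycleReduction_basisSpan, cycleReduction_basisSpan, linearCycleMod_redSpan_inj hS₁ hS₂,
      ← forall_mk_eq_iff (K := K) hπ m hS₁ hS₂, funext_iff]
    refine forall_congr' fun i => ?_
    rw [(hseg b₁ S₁ hS₁ hS₁' s₁).1 hs₁, (hseg b₂ S₂ hS₂ hS₂' s₂).1 hs₂]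
  have hmem : ∀ W : Submodule K V, W ≠ ⊥ → W ≠ ⊤ →
      cycleReduction M W (Ideal.span {π ^ m}) ∈ linearCyclesMod R M (Ideal.span {π ^ m}) := by
    intro W h₁ h₂
    obtain ⟨b, S, rfl, hS, hS'⟩ := hex W h₁ h₂
    exact ⟨redSpan _ b S, exists_isCompl_redSpan, redSpan_ne_bot hS, redSpan_ne_top hS',
      cycleReduction_basisSpan _⟩
  refine ⟨hwd, ?_, hiff⟩
  -- A segment may come from many subspaces. One is chosen, and `hiff` shows that its reduction does
  -- not depend on the choice.
  choose W hW hW' hs using fun s : initialSegments (R := R) (K := K) (vertex M) m => s.2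
  refine ⟨fun s => ⟨cycleReduction M (W s) (Ideal.span {π ^ m}), hmem _ (hW s) (hW' s)⟩,
    ⟨fun s t h => ?_, ?_⟩, fun s W' h h' hs' => ?_⟩
  · exact Subtype.ext ((hiff _ _ (hW s) (hW' s) (hW t) (hW' t) _ _ (hs s) (hs t)).2
      (congrArg Subtype.val h))
  -- A split `N` is the reduction of a part of a basis of `M`, and the span of this part over `K` is
  -- a subspace that reduces to `N`.
  · rintro ⟨_, N, hN, hN₁, hN₂, rfl⟩
    obtain ⟨b, S, rfl⟩ := exists_redSpan_eq (Module.finBasisOfFinrankEq R M hn) hN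
    have hb := basisSpan_ne_bot (K := K) (b := b) (nonempty_of_redSpan_ne_bot hN₁)
    have ht := basisSpan_ne_top (K := K) (b := b) (ne_univ_of_redSpan_ne_top hN₂)
    obtain ⟨s, hs', -⟩ := hwd _ hb ht
    refine ⟨⟨s, _, hb, ht, hs'⟩, Subtype.ext ?_⟩
    exact ((hiff _ _ (hW _) (hW' _) hb ht _ _ (hs _) hs').1 rfl).trans (cycleReduction_basisSpan _)
  · exact (hiff _ _ (hW s) (hW' s) h h' _ _ (hs s) hs').1 rfl
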